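/- Let $X$ be a connected finite CW complex with base point $x_0$, let $G=\pi_1(X,x_0)$, and let $H=G_{\mathrm{ab}}=H_1(X;\mathbb Z)$. For an abelian group $A$ and a character $\chi\in\mathrm{Hom}(A;\mathbb R)$, the initial form $\mathrm{in}_\chi(f)$ of a nonzero $f=\sum a_h h\in\mathbb Z[A]$ is the sum of the terms $a_h h$ for which $\chi(h)$ is minimal among all $h$ with $a_h\neq 0$. For an ideal $I\subseteq\mathbb Z[A]$ let $\mathrm{in}_\chi(I)$ be the ideal generated by all $\mathrm{in}_\chi(f)$ with $0\neq f\in I$, and put $$\mathrm{Trop}_{\mathbb Z}(I)=\{\chi\in\mathrm{Hom}(A;\mathbb R)\mid \mathrm{in}_\chi(I)\neq\mathbb Z[A]\}.$$ For an epimorphism $\nu\colon G\twoheadrightarrow H'$ onto an abelian group $H'$, let $X^\nu\to X$ be the connected regular covering with deck transformation group $H'$ corresponding to $\nu$. Its cellular chain complex $C_*(X^\nu;\mathbb Z)$, for the lifted cell structure, is a complex of finitely generated free $\mathbb Z[H']$-modules, and $H_i(X^\nu;\mathbb Z)$ denotes its homology, a $\mathbb Z[H']$-module via deck transformations; $\mathrm{Ann}$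 denotes the annihilator ideal in $\mathbb Z[H']$. Let $X^H$ be the maximal abelian cover of $X$ (the case $\nu\colon G\to H$). Write $c_j$ for the rank of the free $\mathbb Z[H]$-module $C_j(X^H;\mathbb Z)$, and $d_j\colon C_j(X^H;\mathbb Z)\to C_{j-1}(X^H;\mathbb Z)$ for the differential (with $d_0=0$). The $j$-th jump ideal $\mathcal J^j(X;\mathbb Z)\subseteq\mathbb Z[H]$ is the ideal generated by the $c_j\times c_j$ minors of $d_{j+1}\oplus d_j$, and $\mathcal J^{\leqslant k}(X;\mathbb Z)=\bigcap_{0\leqslant j\leqslant k}\mathcal J^j(X;\mathbb Z)$. **Proposition.** 1. Let $\nu\colon G\twoheadrightarrow H'$ be an epimorphism onto an abelian group with $\mathrm{rank}_{\mathbb Z}H'\geqslant 1$, and let $i\geqslant 0$. Then $H_i(X^\nu;\mathbb Z)$ is a finitely generated $\mathbb Z[H']$-module, and it is finitely generated over $\mathbb Z$ if and only if $\mathrm{Trop}_{\mathbb Z}(\mathrm{Ann}(H_i(X^\nu;\mathbb Z)))\subseteq\{0\}$. 2. Let $k\geqslant 0$. If $\mathrm{Trop}_{\mathbb Z}(\mathcal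 J^{\leqslant k}(X;\mathbb Z))\subseteq\{0\}$, then for every epimorphism $\nu\colon G\twoheadrightarrow H'$ onto an abelian group with $\mathrm{rank}_{\mathbb Z}H'\geqslant 1$ and every $0\leqslant i\leqslant k$, the group $H_i(X^\nu;\mathbb Z)$ is finitely generated over $\mathbb Z$. -/

import Mathlib

open CategoryTheory Topology Set

universe u v w z

noncomputable section

namespace AbCover

/-! ### Tropical varieties over a ring -/

section Trop

variable {R : Type u} [CommRing R] {H : Type v} [CommGroup H]

/-- The initial form `in_χ(f)` of `f = ∑ a_h h` in the group ring `R[H]`: the sum of all the terms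
`a_h h` of `f` for which `χ(h)` is minimal among the `χ(h')` with `a_{h'} ≠ 0`. -/
def initialForm (χ : Additive H →+ ℝ) (f : MonoidAlgebra R H) : MonoidAlgebra R H :=
  open Classical in
  MonoidAlgebra.ofCoeff (f.coeff.filter
    (fun h => ∀ h' ∈ f.coeff.support, χ (Additive.ofMul h) ≤ χ (Additive.ofMul h')))

/-- The initial ideal `in_χ(I)`, generated by the initial forms of the elements of `I`. -/
def initialIdeal (χ : Additive H →+ ℝ) (I : Ideal (MonoidAlgebra R H)) :
    Ideal (MonoidAlgebra R H) :=
  Ideal.span (initialForm χ '' (I : Set (MonoidAlgebra R H)))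

/-- The tropical variety over `R` of an ideal `I` of `R[H]`, a subset of `Hom(H, ℝ)`. -/
def tropVariety (I : Ideal (MonoidAlgebra R H)) : Set (Additive H →+ ℝ) :=
  {χ | initialIdeal χ I ≠ ⊤}

end Trop

/-! ### Jump ideals of a chain complex of finitely generated free modules -/

section Jump

variable {R : Type u} [CommRing R]

/-- The ideal generated by the `r × r` minors of the matrix of a linear map `f` between finitely
generated free modules.  The ideal does not depend on the bases in which the matrix is written;
here we take the minors of the matrices of `f` in all bases. -/
def minorsIdeal {M N : Type v} [AddCommGroup M] [Module R M] [AddCommGroup N] [Module R N]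
    (r : ℕ) (f : M →ₗ[R] N) : Ideal R :=
  Ideal.span {x | ∃ (m n : ℕ) (b : Module.Basis (Fin m) R M) (c : Module.Basis (Fin n) R N)
    (p : Fin r → Fin n) (q : Fin r → Fin m),
    x = ((LinearMap.toMatrix b c f).submatrix p q).det}

/-- The `i`-th jump ideal `I_{c_i}(∂ ⊕ ∂')` where `∂ : C_{i+1} → C_i` and `∂' : C_i → C_{i-1}` are
the differentials and `c_i` is the rank of `C_i`.  (For `i = 0`, the second differential is the
zero map `K.d 0 0`, which contributes only zero rows and columns.) -/
def jumpIdeal (K : ChainComplex (ModuleCat.{v} R) ℕ) (i : ℕ) : Ideal R :=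
  minorsIdeal (Module.finrank R (K.X i)) (LinearMap.prodMap (K.d (i + 1) i).hom (K.d i (i - 1)).hom)

/-- The intersection of the `j`-th jump ideals over `0 ≤ j ≤ k`. -/
def jumpIdealLE (K : ChainComplex (ModuleCat.{v} R) ℕ) (k : ℕ) : Ideal R :=
  ⨅ (j : ℕ) (_ : j ≤ k), jumpIdeal K j

end Jump

/-! ### Singular chains of a space with a group action -/

section Singular

/-- Singular `n`-simplices of `Y`. -/
abbrev SingSimplex (Y : Type v) [TopologicalSpace Y] (n : ℕ) : Type v :=
  C(stdSimplex ℝ (Fin (n + 1)), Y)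

/-- The `i`-th face of a singular simplex. -/
def face {Y : Type v} [TopologicalSpace Y] {n : ℕ} (i : Fin (n + 2)) (σ : SingSimplex Y (n + 1)) :
    SingSimplex Y n :=
  σ.comp ⟨stdSimplex.map i.succAbove, stdSimplex.continuous_map _⟩

variable (H : Type w) [CommGroup H] (Y : Type v) [TopologicalSpace Y] [MulAction H Y]
  [ContinuousConstSMul H Y]

/-- The action of `H` on the free abelian group on the singular `n`-simplices of `Y`. -/
def singRep (n : ℕ) : Representation ℤ H (SingSimplex Y n →₀ ℤ) where
  toFun h := Finsupp.lmapDomain ℤ ℤ (fun σ => h • σ)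
  map_one' := by
    ext σ : 1
    ext : 1
    simp
  map_mul' g h := by
    ext σ : 1
    ext : 1
    simp [mul_smul]

/-- The singular `n`-chains of `Y`, as a module over `ℤ[H]`. -/
abbrev SingChain (n : ℕ) : Type v := (singRep H Y n).asModule

variable {Y} in
/-- The singular simplex `σ`, as a singular chain. -/
def singOf {n : ℕ} (σ : SingSimplex Y n) : SingChain H Y n :=
  (singRep H Y n).asModuleEquiv.symm (Finsupp.single σ 1)

/-- The singular boundary `σ ↦ ∑ i, (-1)^i (face i σ)`, as a map of abelian groups. -/
def singBdryInt (n : ℕ) : (SingSimplex Y (n + 1) →₀ ℤ) →ₗ[ℤ] (SingSimplex Y n →₀ ℤ) :=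
  Finsupp.linearCombination ℤ
    (fun σ => ∑ i : Fin (n + 2), (-1 : ℤ) ^ (i : ℕ) • Finsupp.single (face i σ) (1 : ℤ))

/-- The singular boundary commutes with the action. -/
def singBdryHom (n : ℕ) : (singRep H Y (n + 1)).IntertwiningMap (singRep H Y n) where
  toLinearMap := singBdryInt Y n
  isIntertwining' g := by
    ext σ : 1
    ext : 1
    simp only [singBdryInt, singRep, MonoidHom.coe_mk, OneHom.coe_mk, LinearMap.comp_apply,
      Finsupp.lsingle_apply, Finsupp.lmapDomain_apply, Finsupp.mapDomain_single,
      Finsupp.linearCombination_single, one_smul]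
    rw [← Finsupp.lmapDomain_apply (M := ℤ) (R := ℤ), map_sum]
    refine Finset.sum_congr rfl fun i _ => ?_
    rw [map_smul, Finsupp.lmapDomain_apply, Finsupp.mapDomain_single]
    rfl

/-- The singular boundary as a `ℤ[H]`-linear map. -/
def singBdry (n : ℕ) : SingChain H Y (n + 1) →ₗ[MonoidAlgebra ℤ H] SingChain H Y n :=
  Representation.IntertwiningMap.equivLinearMapAsModule _ _ (singBdryHom H Y n)

theorem succAbove_succAbove_of_le {n : ℕ} {i j : Fin (n + 2)} (h : i ≤ j) (k : Fin (n + 1)) :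
    j.succ.succAbove (i.succAbove k) = i.castSucc.succAbove (j.succAbove k) := by
  rw [Fin.le_def] at h
  ext
  simp only [Fin.succAbove, Fin.lt_def]
  split_ifs <;> simp_all <;> omega

theorem face_face {n : ℕ} {i j : Fin (n + 2)} (h : i ≤ j) (σ : SingSimplex Y (n + 2)) :
    face i (face j.succ σ) = face j (face i.castSucc σ) := by
  ext x
  simp only [face, ContinuousMap.comp_apply, ContinuousMap.coe_mk, stdSimplex.map_comp_apply]
  congr 2
  funext k
  exact succAbove_succAbove_of_le h k

theorem singBdryInt_comp (n : ℕ) : singBdryInt Y n ∘ₗ singBdryInt Y (n + 1) = 0 := by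
  ext σ : 1
  ext : 1
  simp only [singBdryInt, LinearMap.comp_apply, Finsupp.lsingle_apply,
    Finsupp.linearCombination_single, one_mul, map_sum, map_smul, LinearMap.zero_apply,
    Finset.smul_sum, smul_smul]
  rw [← Fintype.sum_prod_type' (fun (j : Fin (n + 3)) (i : Fin (n + 2)) =>
    ((-1 : ℤ) ^ (j : ℕ) * (-1) ^ (i : ℕ)) • Finsupp.single (face i (face j σ)) (1 : ℤ))]
  rw [← Finset.sum_filter_add_sum_filter_not _
    (fun p : Fin (n + 3) × Fin (n + 2) => (p.1 : ℕ) ≤ (p.2 : ℕ)), ← eq_neg_iff_add_eq_zero,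
    ← Finset.sum_neg_distrib]
  refine Finset.sum_bij
    (fun p hp => (p.2.succ, p.1.castLT (lt_of_le_of_lt (Finset.mem_filter.1 hp).2 p.2.2)))
    ?_ ?_ ?_ ?_
  · rintro ⟨j, i⟩ hp
    simp at hp ⊢
    omega
  · rintro ⟨j, i⟩ hp ⟨j', i'⟩ hp' h
    simp only [Prod.mk.injEq, Fin.ext_iff, Fin.val_castLT, Fin.val_succ] at h ⊢
    omega
  · rintro ⟨j, i⟩ hp
    simp at hp
    have hj : j ≠ 0 := by
      rintro rfl
      simp at hp
    refine ⟨(i.castSucc, j.pred hj), ?_, ?_⟩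
    · simp
      omega
    · simp
  · rintro ⟨j, i⟩ hp
    have h2 : (j : ℕ) ≤ (i : ℕ) := (Finset.mem_filter.1 hp).2
    obtain ⟨j', rfl⟩ : ∃ j' : Fin (n + 2), j = j'.castSucc :=
      ⟨j.castLT (lt_of_le_of_lt h2 i.2), by simp⟩
    have h3 : j' ≤ i := Fin.le_def.2 h2
    simp only [Fin.castLT_castSucc, face_face Y h3, Fin.val_castSucc, Fin.val_succ]
    rw [← neg_smul]
    congr 1
    ring

theorem singBdry_singBdry (n : ℕ) (c : SingChain H Y (n + 2)) :
    singBdry H Y n (singBdry H Y (n + 1) c) = 0 :=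
  LinearMap.congr_fun (singBdryInt_comp Y n) c

variable {Y}

/-- The singular chains of the (invariant) subset `S`, as a submodule of those of `Y`. -/
def chainsIn (S : Set Y) (n : ℕ) : Submodule (MonoidAlgebra ℤ H) (SingChain H Y n) :=
  Submodule.span _ {c | ∃ σ : SingSimplex Y n, range σ ⊆ S ∧ c = singOf H σ}

/-- The relative `n`-cycles of the pair `(S, T)`. -/
def relCycles (S T : Set Y) : (n : ℕ) → Submodule (MonoidAlgebra ℤ H) (SingChain H Y n)
  | 0 => chainsIn H S 0
  | n + 1 => chainsIn H S (n + 1) ⊓ (chainsIn H T n).comap (singBdry H Y n)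

/-- The relative `n`-boundaries of the pair `(S, T)`. -/
def relBoundaries (S T : Set Y) (n : ℕ) : Submodule (MonoidAlgebra ℤ H) (SingChain H Y n) :=
  (chainsIn H S (n + 1)).map (singBdry H Y n) ⊔ chainsIn H T n

/-- The relative singular homology `H_n(S, T; ℤ)` of a pair `T ⊆ S` of invariant subsets of `Y`, as
a module over `ℤ[H]`: relative cycles modulo relative boundaries. -/
abbrev RelHomology (S T : Set Y) (n : ℕ) : Type v :=
  relCycles H S T n ⧸ (relBoundaries H S T n).submoduleOf (relCycles H S T n)

end Singular

/-! ### The cellular chain complex -/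

section Cellular

variable (H : Type w) [CommGroup H] {Y : Type v} [TopologicalSpace Y] [MulAction H Y]
  [ContinuousConstSMul H Y] (F : ℕ → Set Y)

theorem singBdry_mem_relCycles (n : ℕ) {S T U : Set Y} {c : SingChain H Y (n + 1)}
    (hc : c ∈ relCycles H S T (n + 1)) : singBdry H Y n c ∈ relCycles H T U n := by
  cases n with
  | zero => exact hc.2
  | succ n =>
    refine ⟨hc.2, ?_⟩
    simp [singBdry_singBdry]

/-- The boundary on relative cycles. -/
def cycleBdry (S T U : Set Y) (n : ℕ) :
    relCycles H S T (n + 1) →ₗ[MonoidAlgebra ℤ H] relCycles H T U n :=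
  (singBdry H Y n).restrict fun _ hc => singBdry_mem_relCycles H n hc

theorem cycleBdry_boundaries (S T U : Set Y) (n : ℕ) :
    (relBoundaries H S T (n + 1)).submoduleOf (relCycles H S T (n + 1)) ≤
      ((relBoundaries H T U n).submoduleOf (relCycles H T U n)).comap (cycleBdry H S T U n) := by
  rintro ⟨c, hc⟩ hb
  obtain ⟨x, hx, y, hy, rfl⟩ := Submodule.mem_sup.1 (show c ∈ relBoundaries H S T (n + 1) from hb)
  obtain ⟨z, -, rfl⟩ := hx
  show singBdry H Y n (singBdry H Y (n + 1) z + y) ∈ relBoundaries H T U n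
  rw [map_add, singBdry_singBdry, zero_add]
  exact Submodule.mem_sup_left ⟨y, hy, rfl⟩

/-- The connecting map `H_{n+1}(S, T) → H_n(T, U)` of a triple, `[c] ↦ [∂ c]`. -/
def relBdry (S T U : Set Y) (n : ℕ) :
    RelHomology H S T (n + 1) →ₗ[MonoidAlgebra ℤ H] RelHomology H T U n :=
  Submodule.mapQ _ _ (cycleBdry H S T U n) (cycleBdry_boundaries H S T U n)

theorem relBdry_comp (S T U V : Set Y) (n : ℕ) :
    relBdry H T U V n ∘ₗ relBdry H S T U (n + 1) = 0 := by
  refine Submodule.linearMap_qext _ ?_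
  ext ⟨c, hc⟩ : 1
  have : cycleBdry H T U V n (cycleBdry H S T U (n + 1) ⟨c, hc⟩) = 0 :=
    Subtype.ext (singBdry_singBdry H Y n c)
  simp [relBdry, this]

/-- The cellular chain complex of a space `Y` filtered by invariant subsets `F 0 ⊆ F 1 ⊆ ⋯`, where
`F n` stands for the `(n-1)`-skeleton: the complex of `ℤ[H]`-modules with
`C_n = H_n(F (n + 1), F n; ℤ)` and the differentials `[c] ↦ [∂ c]`. -/
def filtrationComplex : ChainComplex (ModuleCat.{v} (MonoidAlgebra ℤ H)) ℕ :=
  ChainComplex.of (fun n => ModuleCat.of _ (RelHomology H (F (n + 1)) (F n) n))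
    (fun n => ModuleCat.ofHom (relBdry H (F (n + 2)) (F (n + 1)) (F n) n))
    (fun n => by
      rw [← ModuleCat.ofHom_comp]
      exact congrArg ModuleCat.ofHom
        (relBdry_comp H (F (n + 3)) (F (n + 2)) (F (n + 1)) (F n) n))

end Cellular

/-! ### Abelian covers -/

section Cover

variable {X : Type u} [TopologicalSpace X]

/-- The connected regular covering `X^ν → X` that corresponds to a homomorphism `ν : π₁(X, x₀) → H`
onto an abelian group: `Y` is path-connected, `H` acts on `Y` as the group of deck transformations
of `proj`, and the lift to `Y` of a loop `γ` at `x₀` that starts at the base point `base` ends at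
`ν(γ) • base`. -/
structure AbelianCover (x₀ : X) {H : Type w} [CommGroup H] (ν : FundamentalGroup X x₀ →* H)
    (Y : Type v) [TopologicalSpace Y] [MulAction H Y] where
  /-- the covering projection -/
  proj : Y → X
  isCover : IsQuotientCoveringMap proj H
  pathConnected : PathConnectedSpace Y
  /-- the base point, above `x₀` -/
  base : proj ⁻¹' {x₀}
  monodromy_base (γ : FundamentalGroup X x₀) :
    (isCover.isCoveringMap.monodromy γ base : Y) = ν γ • (base : Y)

variable [T2Space X] [CWComplex (univ : Set X)] {x₀ : X} {H : Type w} [CommGroup H]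
  {ν : FundamentalGroup X x₀ →* H} {Y : Type v} [TopologicalSpace Y] [MulAction H Y]
  [ContinuousConstSMul H Y]

/-- The cellular chain complex `C_*(X^ν; ℤ)` of the cover of a CW complex, as a complex of
`ℤ[H]`-modules; the `n`-skeleton of `X^ν` is the preimage of the `n`-skeleton of `X`, the union of
the cells of dimension `< n + 1`. -/
def AbelianCover.cellularComplex (c : AbelianCover x₀ ν Y) :
    ChainComplex (ModuleCat.{v} (MonoidAlgebra ℤ H)) ℕ :=
  filtrationComplex H (fun n => c.proj ⁻¹' (CWComplex.skeletonLT (univ : Set X) (n : ℕ∞) : Set X))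

/-- The homology `H_i(X^ν; ℤ)`, as a module over `ℤ[H]` by deck transformations. -/
abbrev AbelianCover.homology (c : AbelianCover x₀ ν Y) (i : ℕ) :
    ModuleCat.{v} (MonoidAlgebra ℤ H) :=
  c.cellularComplex.homology i

end Cover

end AbCover

end

open AbCover

/-!
The tropical variety of an ideal `I ⊆ ℤ[A]`, with `A` finitely generated, is contained in `{0}` if
and only if for every `χ ≠ 0` the ideal contains some `1 + g` with all terms of `g` of positive
`χ`-degree. For the annihilator of a module that is finitely generated over `ℤ`, such an element
comes from Cayley–Hamilton applied to the action of some `h` with `χ(h) > 0`. Conversely, such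
relations can be chosen uniformly for `χ` in the compact unit sphere; they move every lattice point
that is far from the origin closer to it, so that `ℤ[A] ⧸ I` is spanned by finitely many elements
of `A`, and any finitely generated module annihilated by `I` is finitely generated over `ℤ`.

For the second part, let `N = d P + Q d` for matrices `P`, `Q` over `ℤ[H']`, where `d` is the
differential of the cover `X^ν`. By Cayley–Hamilton, `det N` annihilates `H_j(X^ν)`. A prime that
contains all these determinants contains the `c_j × c_j` minors of `d_{j+1} ⊕ d_j`, for a nonzero
minor over a field forces the complex to split. Hence the image of the jump ideal `𝒥ʲ` in `ℤ[H']`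
lies in the radical of the annihilator of `H_j(X^ν)`, which bounds its tropical variety.

Both parts rest on the fact that the cellular chain modules of a cover, which are defined by
relative singular homology of skeleta, are free on lifts of the cells, compatibly with maps of
covers. A relative cycle is subdivided until each of its simplices lies in an open cell or avoids
the cores of all cells; after the collars of the cells are collapsed, it is a sum of relative cycles
of the standard simplex, which are multiples of the identity by simplicial approximation. The cells
are independent because a Sperner labelling gives a degree that detects each of them.
-/

noncomputable section

namespace AbCover

section FinsuppMaps

variable {α R M : Type*} [Semiring R] [AddCommMonoid M] [Module R M]

theorem apply_eq_of_forall_single (f g : (α →₀ R) →ₗ[R] M)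
    (h : ∀ a, f (Finsupp.single a 1) = g (Finsupp.single a 1)) (c : α →₀ R) : f c = g c :=
  LinearMap.congr_fun (Finsupp.lhom_ext' fun a => LinearMap.ext_ring (h a)) c

theorem map_mem_of_mem_supported (f : (α →₀ R) →ₗ[R] M) (N : Submodule R M) {s : Set α}
    (h : ∀ a ∈ s, f (Finsupp.single a 1) ∈ N) {c : α →₀ R} (hc : c ∈ Finsupp.supported R R s) :
    f c ∈ N := by
  rw [Finsupp.supported_eq_span_single] at hc
  have hs : Submodule.span R ((fun a => Finsupp.single a (1 : R)) '' s) ≤ N.comap f :=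
    Submodule.span_le.2 (forall_mem_image.2 h)
  exact hs hc

end FinsuppMaps

/-! ### Ordered chains -/

section Ordered

variable {V W V' W' : Type*}

/-- The group of ordered chains on the vertex set `V`, the combinatorial model in which the
subdivision and prism operators are built. The index counts vertices, so that `n = 0` is the
augmentation degree. -/
abbrev OrdChain (V : Type*) (n : ℕ) : Type _ := (Fin n → V) →₀ ℤ

/-- The ordered simplex with vertices `w`, as an ordered chain. -/
abbrev ofVertices {n : ℕ} (w : Fin n → V) : OrdChain V n := Finsupp.single w 1

/-- The augmented boundary operator of ordered chains. -/
def ordBdry (V : Type*) (n : ℕ) : OrdChain V (n + 1) →ₗ[ℤ] OrdChain V n :=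
  Finsupp.linearCombination ℤ
    (fun w => ∑ i : Fin (n + 1), (-1 : ℤ) ^ (i : ℕ) • ofVertices (w ∘ i.succAbove))

/-- The cone operator with apex `p`: a contraction of the augmented complex of ordered chains. -/
def ordCone (p : V) (n : ℕ) : OrdChain V n →ₗ[ℤ] OrdChain V (n + 1) :=
  Finsupp.lmapDomain ℤ ℤ (fun w => (Fin.cons p w : Fin (n + 1) → V))

/-- The chain map of ordered chains induced by a map of vertex sets. -/
def mapVertices (f : V → W) (n : ℕ) : OrdChain V n →ₗ[ℤ] OrdChain W n :=
  Finsupp.lmapDomain ℤ ℤ (fun w => f ∘ w)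

theorem ordBdry_ofVertices {n : ℕ} (w : Fin (n + 1) → V) :
    ordBdry V n (ofVertices w) =
      ∑ i : Fin (n + 1), (-1 : ℤ) ^ (i : ℕ) • ofVertices (w ∘ i.succAbove) := by
  simp [ordBdry]

@[simp] theorem ordCone_ofVertices (p : V) {n : ℕ} (w : Fin n → V) :
    ordCone p n (ofVertices w) = ofVertices (Fin.cons p w : Fin (n + 1) → V) := by
  simp [ordCone]

@[simp] theorem mapVertices_ofVertices (f : V → W) {n : ℕ} (w : Fin n → V) :
    mapVertices f n (ofVertices w) = ofVertices (f ∘ w) := by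
  simp [mapVertices]

theorem mapVertices_mapVertices (g : W → W') (f : V → W) (n : ℕ) (c : OrdChain V n) :
    mapVertices g n (mapVertices f n c) = mapVertices (g ∘ f) n c :=
  apply_eq_of_forall_single (mapVertices g n ∘ₗ mapVertices f n) (mapVertices (g ∘ f) n)
    (fun w => by simp [mapVertices, Function.comp_assoc]) c

theorem ordBdry_ordCone_succ (p : V) (n : ℕ) (c : OrdChain V (n + 1)) :
    ordBdry V (n + 1) (ordCone p (n + 1) c) = c - ordCone p n (ordBdry V n c) := by
  refine apply_eq_of_forall_single (ordBdry V (n + 1) ∘ₗ ordCone p (n + 1))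
    (LinearMap.id - ordCone p n ∘ₗ ordBdry V n) (fun w => ?_) c
  simp only [LinearMap.comp_apply, LinearMap.sub_apply, LinearMap.id_apply, ordCone_ofVertices,
    ordBdry_ofVertices, map_sum, map_smul]
  rw [Fin.sum_univ_succ, sub_eq_add_neg, ← Finset.sum_neg_distrib]
  congr 1
  · simp only [Fin.val_zero, pow_zero, one_smul]
    congr 1
  · refine Finset.sum_congr rfl fun i _ => ?_
    rw [Fin.val_succ, pow_succ, mul_neg_one, neg_smul]
    congr 3
    funext k
    refine Fin.cases ?_ (fun k => ?_) k <;> simp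

theorem ordBdry_ordCone_zero (p : V) (c : OrdChain V 0) : ordBdry V 0 (ordCone p 0 c) = c := by
  refine apply_eq_of_forall_single (ordBdry V 0 ∘ₗ ordCone p 0) LinearMap.id (fun w => ?_) c
  simp only [LinearMap.comp_apply, LinearMap.id_apply, ordCone_ofVertices, ordBdry_ofVertices]
  simp

theorem ordBdry_ordBdry (n : ℕ) (c : OrdChain V (n + 2)) :
    ordBdry V n (ordBdry V (n + 1) c) = 0 := by
  refine apply_eq_of_forall_single (ordBdry V n ∘ₗ ordBdry V (n + 1)) 0 (fun w => ?_) c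
  change ordBdry V n (ordBdry V (n + 1) (ofVertices w)) = 0
  rw [← Fin.cons_self_tail w, ← ordCone_ofVertices, ordBdry_ordCone_succ, map_sub]
  cases n with
  | zero => rw [ordBdry_ordCone_zero, sub_self]
  | succ n => rw [ordBdry_ordCone_succ, ordBdry_ordBdry n, map_zero, sub_zero, sub_self]

theorem ordBdry_mapVertices (f : V → W) (n : ℕ) (c : OrdChain V (n + 1)) :
    ordBdry W n (mapVertices f (n + 1) c) = mapVertices f n (ordBdry V n c) := by
  refine apply_eq_of_forall_single (ordBdry W n ∘ₗ mapVertices f (n + 1))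
    (mapVertices f n ∘ₗ ordBdry V n) (fun w => ?_) c
  simp only [LinearMap.comp_apply, mapVertices_ofVertices, ordBdry_ofVertices, map_sum, map_smul]
  rfl

theorem mapVertices_ordCone (f : V → W) (p : V) (n : ℕ) (c : OrdChain V n) :
    mapVertices f (n + 1) (ordCone p n c) = ordCone (f p) n (mapVertices f n c) := by
  refine apply_eq_of_forall_single (mapVertices f (n + 1) ∘ₗ ordCone p n)
    (ordCone (f p) n ∘ₗ mapVertices f n) (fun w => ?_) c
  simp only [LinearMap.comp_apply, mapVertices_ofVertices, ordCone_ofVertices]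
  congr 1
  funext k
  refine Fin.cases ?_ (fun k => ?_) k <;> simp

theorem mapVertices_zero_eq (f g : V → W) (c : OrdChain V 0) :
    mapVertices f 0 c = mapVertices g 0 c := by
  refine apply_eq_of_forall_single (mapVertices f 0) (mapVertices g 0) (fun w => ?_) c
  simp only [mapVertices_ofVertices]
  congr 1
  exact Subsingleton.elim _ _

/-- The acyclic-models homotopy between two maps `f`, `g` of ordered chains: degree by degree, the
defect of the homotopy formula on the simplex `w` is coned off from the apex `p n w`. -/
def coneHomotopy (f g : ∀ n, OrdChain V n →ₗ[ℤ] OrdChain W n) (p : ∀ n, (Fin (n + 1) → V) → W) :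
    ∀ n, OrdChain V n →ₗ[ℤ] OrdChain W (n + 1)
  | 0 => 0
  | n + 1 => Finsupp.linearCombination ℤ (fun w => ordCone (p n w) (n + 1)
      (f (n + 1) (ofVertices w) - g (n + 1) (ofVertices w) - coneHomotopy f g p n
        (ordBdry V n (ofVertices w))))

theorem ordBdry_coneHomotopy (f g : ∀ n, OrdChain V n →ₗ[ℤ] OrdChain W n)
    (p : ∀ n, (Fin (n + 1) → V) → W) (hf : ∀ n c, ordBdry W n (f (n + 1) c) = f n (ordBdry V n c))
    (hg : ∀ n c, ordBdry W n (g (n + 1) c) = g n (ordBdry V n c)) (h0 : ∀ c, f 0 c = g 0 c)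
    (n : ℕ) (c : OrdChain V (n + 1)) :
    ordBdry W (n + 1) (coneHomotopy f g p (n + 1) c) =
      f (n + 1) c - g (n + 1) c - coneHomotopy f g p n (ordBdry V n c) := by
  induction n with
  | zero =>
    refine apply_eq_of_forall_single (ordBdry W 1 ∘ₗ coneHomotopy f g p 1)
      (f 1 - g 1 - coneHomotopy f g p 0 ∘ₗ ordBdry V 0) (fun w => ?_) c
    simp only [LinearMap.comp_apply, coneHomotopy, Finsupp.linearCombination_single, one_smul,
      LinearMap.sub_apply, ordBdry_ordCone_succ, map_sub, hf, hg, h0]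
    simp
  | succ n ih =>
    refine apply_eq_of_forall_single (ordBdry W (n + 2) ∘ₗ coneHomotopy f g p (n + 2))
      (f (n + 2) - g (n + 2) - coneHomotopy f g p (n + 1) ∘ₗ ordBdry V (n + 1)) (fun w => ?_) c
    rw [LinearMap.comp_apply, coneHomotopy]
    simp only [Finsupp.linearCombination_single, one_smul, LinearMap.sub_apply,
      LinearMap.comp_apply, ordBdry_ordCone_succ, map_sub, hf, hg, ih, ordBdry_ordBdry, map_zero,
      sub_zero]
    abel

theorem mapVertices_coneHomotopy {f g : ∀ n, OrdChain V n →ₗ[ℤ] OrdChain W n}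
    {p : ∀ n, (Fin (n + 1) → V) → W} {f' g' : ∀ n, OrdChain V' n →ₗ[ℤ] OrdChain W' n}
    {p' : ∀ n, (Fin (n + 1) → V') → W'} (α : V → V') (β : W → W')
    (hf : ∀ n c, mapVertices β n (f n c) = f' n (mapVertices α n c))
    (hg : ∀ n c, mapVertices β n (g n c) = g' n (mapVertices α n c))
    (hp : ∀ n w, β (p n w) = p' n (α ∘ w)) (n : ℕ) (c : OrdChain V n) :
    mapVertices β (n + 1) (coneHomotopy f g p n c) =
      coneHomotopy f' g' p' n (mapVertices α n c) := by
  induction n with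
  | zero => simp [coneHomotopy]
  | succ n ih =>
    refine apply_eq_of_forall_single (mapVertices β (n + 2) ∘ₗ coneHomotopy f g p (n + 1))
      (coneHomotopy f' g' p' (n + 1) ∘ₗ mapVertices α (n + 1)) (fun w => ?_) c
    simp only [LinearMap.comp_apply, coneHomotopy, Finsupp.linearCombination_single, one_smul,
      mapVertices_ofVertices, mapVertices_ordCone, map_sub, hf, hg, hp, ih, ← ordBdry_mapVertices]

/-- Barycentric subdivision of ordered chains, for a choice `b` of the barycenters: the subdivided
boundary of a simplex is coned off from its barycenter. -/
def ordSubdiv (b : ∀ n, (Fin (n + 1) → V) → V) : ∀ n, OrdChain V n →ₗ[ℤ] OrdChain V n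
  | 0 => LinearMap.id
  | n + 1 => Finsupp.linearCombination ℤ
      (fun w => ordCone (b n w) n (ordSubdiv b n (ordBdry V n (ofVertices w))))

theorem ordSubdiv_ofVertices (b : ∀ n, (Fin (n + 1) → V) → V) {n : ℕ} (w : Fin (n + 1) → V) :
    ordSubdiv b (n + 1) (ofVertices w) =
      ordCone (b n w) n (ordSubdiv b n (ordBdry V n (ofVertices w))) := by
  simp [ordSubdiv]

theorem ordBdry_ordSubdiv (b : ∀ n, (Fin (n + 1) → V) → V) (n : ℕ) (c : OrdChain V (n + 1)) :
    ordBdry V n (ordSubdiv b (n + 1) c) = ordSubdiv b n (ordBdry V n c) := by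
  induction n with
  | zero =>
    refine apply_eq_of_forall_single (ordBdry V 0 ∘ₗ ordSubdiv b 1) (ordSubdiv b 0 ∘ₗ ordBdry V 0)
      (fun w => ?_) c
    rw [LinearMap.comp_apply, ordSubdiv_ofVertices, ordBdry_ordCone_zero, LinearMap.comp_apply]
  | succ n ih =>
    refine apply_eq_of_forall_single (ordBdry V (n + 1) ∘ₗ ordSubdiv b (n + 2))
      (ordSubdiv b (n + 1) ∘ₗ ordBdry V (n + 1)) (fun w => ?_) c
    rw [LinearMap.comp_apply, ordSubdiv_ofVertices, ordBdry_ordCone_succ, ih, ordBdry_ordBdry,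
      map_zero, map_zero, sub_zero, LinearMap.comp_apply]

theorem mapVertices_ordSubdiv {b : ∀ n, (Fin (n + 1) → V) → V} {b' : ∀ n, (Fin (n + 1) → W) → W}
    (α : V → W) (hb : ∀ n w, α (b n w) = b' n (α ∘ w)) (n : ℕ) (c : OrdChain V n) :
    mapVertices α n (ordSubdiv b n c) = ordSubdiv b' n (mapVertices α n c) := by
  induction n with
  | zero => rfl
  | succ n ih =>
    refine apply_eq_of_forall_single (mapVertices α (n + 1) ∘ₗ ordSubdiv b (n + 1))
      (ordSubdiv b' (n + 1) ∘ₗ mapVertices α (n + 1)) (fun w => ?_) c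
    simp only [LinearMap.comp_apply, ordSubdiv_ofVertices, mapVertices_ofVertices,
      mapVertices_ordCone, hb, ih, ← ordBdry_mapVertices]

/-- The `k`-fold iterated subdivision of ordered chains. -/
def ordSubdivIter (b : ∀ n, (Fin (n + 1) → V) → V) (k : ℕ) (n : ℕ) :
    OrdChain V n →ₗ[ℤ] OrdChain V n :=
  (ordSubdiv b n) ^ k

theorem ordBdry_ordSubdivIter (b : ∀ n, (Fin (n + 1) → V) → V) (k n : ℕ) (c : OrdChain V (n + 1)) :
    ordBdry V n (ordSubdivIter b k (n + 1) c) = ordSubdivIter b k n (ordBdry V n c) := by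
  induction k with
  | zero => rfl
  | succ k ih =>
    simp only [ordSubdivIter] at ih
    simp only [ordSubdivIter, pow_succ', Module.End.mul_apply, ordBdry_ordSubdiv, ih]

theorem mapVertices_ordSubdivIter {b : ∀ n, (Fin (n + 1) → V) → V}
    {b' : ∀ n, (Fin (n + 1) → W) → W} (α : V → W) (hb : ∀ n w, α (b n w) = b' n (α ∘ w)) (k n : ℕ)
    (c : OrdChain V n) :
    mapVertices α n (ordSubdivIter b k n c) = ordSubdivIter b' k n (mapVertices α n c) := by
  induction k with
  | zero => rfl
  | succ k ih =>
    simp only [ordSubdivIter] at ih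
    simp only [ordSubdivIter, pow_succ', Module.End.mul_apply, mapVertices_ordSubdiv α hb, ih]

theorem ordSubdivIter_zero_eq (b : ∀ n, (Fin (n + 1) → V) → V) (k : ℕ) (c : OrdChain V 0) :
    ordSubdivIter b k 0 c = c := by
  change ((1 : Module.End ℤ (OrdChain V 0)) ^ k) c = c
  rw [one_pow, Module.End.one_apply]

end Ordered

/-! ### Affine simplices -/

/-- The standard `n`-simplex. -/
abbrev StdSimplex (n : ℕ) : Type := stdSimplex ℝ (Fin (n + 1))

/-- The inclusion of the face of the standard simplex opposite to the `i`-th vertex. -/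
def faceInclusion {n : ℕ} (i : Fin (n + 2)) : C(StdSimplex n, StdSimplex (n + 1)) :=
  ⟨stdSimplex.map i.succAbove, stdSimplex.continuous_map _⟩

/-- A space in which every finite sequence of vertices spans an affine simplex, compatibly with
faces. It serves to realize ordered chains by singular chains, uniformly in standard simplices and
in prisms over them. -/
class AffineSimplices (V : Type*) [TopologicalSpace V] where
  /-- the affine simplex with vertices `w` -/
  affineSimplex {n : ℕ} (w : Fin (n + 1) → V) : C(StdSimplex n, V)
  affineSimplex_face {n : ℕ} (i : Fin (n + 2)) (w : Fin (n + 2) → V) :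
    (affineSimplex w).comp (faceInclusion i) = affineSimplex (w ∘ i.succAbove)

open AffineSimplices

section Affine

theorem sum_map_mul {m n : ℕ} (f : Fin m → Fin n) (t : stdSimplex ℝ (Fin m)) (c : Fin n → ℝ) :
    ∑ j, stdSimplex.map f t j * c j = ∑ i, t i * c (f i) := by
  simp only [stdSimplex.map_coe, FunOnFinite.linearMap_apply_apply, Finset.sum_mul]
  rw [← Finset.sum_fiberwise Finset.univ f]
  refine Finset.sum_congr rfl fun j _ => Finset.sum_congr rfl fun i hi => ?_
  rw [(Finset.mem_filter.1 hi).2]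

instance (m : ℕ) : AffineSimplices (stdSimplex ℝ (Fin m)) where
  affineSimplex w :=
    { toFun := fun t => ⟨fun j => ∑ i, t i * w i j, by
        refine ⟨fun j => Finset.sum_nonneg fun i _ => mul_nonneg (t.2.1 i) ((w i).2.1 j), ?_⟩
        rw [Finset.sum_comm]
        have : ∀ i, ∑ j, t i * w i j = t i := fun i => by
          rw [← Finset.mul_sum, stdSimplex.sum_eq_one, mul_one]
        simp only [this, stdSimplex.sum_eq_one]⟩
      continuous_toFun := by
        refine Continuous.subtype_mk (continuous_pi fun j => continuous_finsetSum _ fun i _ => ?_) _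
        exact ((continuous_apply i).comp continuous_subtype_val).mul continuous_const }
  affineSimplex_face i w := by
    ext t j
    exact sum_map_mul _ _ _

instance (V W : Type*) [TopologicalSpace V] [TopologicalSpace W] [AffineSimplices V]
    [AffineSimplices W] : AffineSimplices (V × W) where
  affineSimplex w := (affineSimplex (fun i => (w i).1)).prodMk (affineSimplex (fun i => (w i).2))
  affineSimplex_face i w := by
    have h1 := AffineSimplices.affineSimplex_face i (fun k => (w k).1)
    have h2 := AffineSimplices.affineSimplex_face i (fun k => (w k).2)
    ext1 t
    exact Prod.ext (DFunLike.congr_fun h1 t) (DFunLike.congr_fun h2 t)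

theorem affineSimplex_apply {m n : ℕ} (w : Fin (n + 1) → stdSimplex ℝ (Fin m)) (t : StdSimplex n)
    (j : Fin m) : affineSimplex w t j = ∑ i, t i * w i j := rfl

/-- The vertices of the standard simplex, as a sequence spanning an affine simplex. -/
def vertices (n : ℕ) : Fin (n + 1) → StdSimplex n := fun i => stdSimplex.vertex i

theorem affineSimplex_vertices_apply (n : ℕ) (t : StdSimplex n) :
    affineSimplex (vertices n) t = t := by
  ext j
  change ∑ i, t i * (stdSimplex.vertex i : StdSimplex n) j = t j
  rw [Finset.sum_eq_single j]
  · simp [stdSimplex.vertex_coe]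
  · intro i _ hi
    simp [stdSimplex.vertex_coe, hi.symm]
  · simp

theorem affineSimplex_vertices (n : ℕ) : affineSimplex (vertices n) = ContinuousMap.id _ :=
  ContinuousMap.ext (affineSimplex_vertices_apply n)

theorem affineSimplex_apply_vertices {m n : ℕ} (w : Fin (n + 1) → stdSimplex ℝ (Fin m))
    (i : Fin (n + 1)) : affineSimplex w (vertices n i) = w i := by
  ext j
  change ∑ k, (stdSimplex.vertex i : StdSimplex n) k * w k j = w i j
  rw [Finset.sum_eq_single i]
  · simp [stdSimplex.vertex_coe]
  · intro k _ hk
    simp [stdSimplex.vertex_coe, hk]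
  · simp

theorem faceInclusion_vertices {n : ℕ} (i : Fin (n + 2)) :
    faceInclusion i ∘ vertices n = vertices (n + 1) ∘ i.succAbove := by
  funext k
  exact stdSimplex.map_vertex _ _

theorem faceInclusion_eq {n : ℕ} (i : Fin (n + 2)) :
    faceInclusion i = affineSimplex (vertices (n + 1) ∘ i.succAbove) := by
  rw [← AffineSimplices.affineSimplex_face, affineSimplex_vertices, ContinuousMap.id_comp]

theorem affineSimplex_affineSimplex {l m n : ℕ} (w : Fin (n + 1) → stdSimplex ℝ (Fin m))
    (v : Fin (l + 1) → StdSimplex n) :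
    (affineSimplex w).comp (affineSimplex v) = affineSimplex (affineSimplex w ∘ v) := by
  ext t j
  change ∑ i, (∑ k, t k * v k i) * w i j = ∑ k, t k * (∑ i, v k i * w i j)
  simp only [Finset.sum_mul, Finset.mul_sum]
  rw [Finset.sum_comm]
  simp only [mul_assoc]

theorem faceInclusion_affineSimplex {l n : ℕ} (i : Fin (n + 2)) (v : Fin (l + 1) → StdSimplex n) :
    (faceInclusion i).comp (affineSimplex v) = affineSimplex (faceInclusion i ∘ v) := by
  rw [faceInclusion_eq, affineSimplex_affineSimplex]

end Affine

/-! ### Realization of ordered chains -/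

section Realization

variable {V W : Type*} [TopologicalSpace V] [AffineSimplices V] [TopologicalSpace W]
  [AffineSimplices W]
  {Y Y' : Type*} [TopologicalSpace Y] [TopologicalSpace Y']

/-- The group of integral singular `n`-chains, the source of `singBdryInt`. -/
abbrev IntChain (Y : Type*) [TopologicalSpace Y] (n : ℕ) : Type _ := SingSimplex Y n →₀ ℤ

/-- The singular simplex `σ`, as a singular chain. -/
abbrev ofSimplex {n : ℕ} (σ : SingSimplex Y n) : IntChain Y n := Finsupp.single σ 1

theorem singBdryInt_ofSimplex {n : ℕ} (σ : SingSimplex Y (n + 1)) :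
    singBdryInt Y n (ofSimplex σ) =
      ∑ i : Fin (n + 2), (-1 : ℤ) ^ (i : ℕ) • ofSimplex (face i σ) := by
  simp [singBdryInt]

/-- The chain map of singular chains induced by a continuous map. -/
def mapChain (f : C(Y, Y')) (n : ℕ) : IntChain Y n →ₗ[ℤ] IntChain Y' n :=
  Finsupp.lmapDomain ℤ ℤ (fun σ => f.comp σ)

@[simp] theorem mapChain_ofSimplex (f : C(Y, Y')) {n : ℕ} (σ : SingSimplex Y n) :
    mapChain f n (ofSimplex σ) = ofSimplex (f.comp σ) := by
  simp [mapChain]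

theorem mapChain_mapChain {Y'' : Type*} [TopologicalSpace Y''] (g : C(Y', Y'')) (f : C(Y, Y'))
    (n : ℕ) (c : IntChain Y n) : mapChain g n (mapChain f n c) = mapChain (g.comp f) n c :=
  apply_eq_of_forall_single (mapChain g n ∘ₗ mapChain f n) (mapChain (g.comp f) n)
    (fun σ => by simp [mapChain, ContinuousMap.comp_assoc]) c

theorem face_comp (f : C(Y, Y')) {n : ℕ} (i : Fin (n + 2)) (σ : SingSimplex Y (n + 1)) :
    face i (f.comp σ) = f.comp (face i σ) := rfl

theorem face_eq {n : ℕ} (i : Fin (n + 2)) (σ : SingSimplex Y (n + 1)) :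
    face i σ = σ.comp (faceInclusion i) := rfl

theorem singBdryInt_mapChain (f : C(Y, Y')) (n : ℕ) (c : IntChain Y (n + 1)) :
    singBdryInt Y' n (mapChain f (n + 1) c) = mapChain f n (singBdryInt Y n c) := by
  refine apply_eq_of_forall_single (singBdryInt Y' n ∘ₗ mapChain f (n + 1))
    (mapChain f n ∘ₗ singBdryInt Y n) (fun σ => ?_) c
  simp only [LinearMap.comp_apply, mapChain_ofSimplex, singBdryInt_ofSimplex, map_sum, map_smul,
    face_comp]

/-- The singular chain in `Y` realizing an ordered chain of `V` by affine simplices of `V`, followed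
by the map `g`. It transfers identities between ordered chains to singular chains. -/
def realize (g : C(V, Y)) (n : ℕ) : OrdChain V (n + 1) →ₗ[ℤ] IntChain Y n :=
  Finsupp.lmapDomain ℤ ℤ (fun w => g.comp (affineSimplex w))

@[simp] theorem realize_ofVertices (g : C(V, Y)) {n : ℕ} (w : Fin (n + 1) → V) :
    realize g n (ofVertices w) = ofSimplex (g.comp (affineSimplex w)) := by
  simp [realize]

theorem singBdryInt_realize (g : C(V, Y)) (n : ℕ) (c : OrdChain V (n + 2)) :
    singBdryInt Y n (realize g (n + 1) c) = realize g n (ordBdry V (n + 1) c) := by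
  refine apply_eq_of_forall_single (singBdryInt Y n ∘ₗ realize g (n + 1))
    (realize g n ∘ₗ ordBdry V (n + 1)) (fun w => ?_) c
  simp only [LinearMap.comp_apply, realize_ofVertices, singBdryInt_ofSimplex, ordBdry_ofVertices,
    map_sum, map_smul, face_eq, ContinuousMap.comp_assoc, AffineSimplices.affineSimplex_face]

theorem realize_comp (g : C(W, Y)) (φ : C(V, W))
    (hφ : ∀ {n : ℕ} (w : Fin (n + 1) → V), φ.comp (affineSimplex w) = affineSimplex (φ ∘ w)) (n : ℕ)
    (c : OrdChain V (n + 1)) : realize (g.comp φ) n c = realize g n (mapVertices φ (n + 1) c) := by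
  refine apply_eq_of_forall_single (realize (g.comp φ) n) (realize g n ∘ₗ mapVertices φ (n + 1))
    (fun w => ?_) c
  simp only [LinearMap.comp_apply, realize_ofVertices, mapVertices_ofVertices,
    ContinuousMap.comp_assoc, hφ]

/-- The group of singular chains all of whose simplices belong to `Q`. -/
abbrev supportedOn {n : ℕ} (Q : Set (SingSimplex Y n)) : Submodule ℤ (IntChain Y n) :=
  Finsupp.supported ℤ ℤ Q

theorem mem_supportedOn_univ {n : ℕ} (c : IntChain Y n) :
    c ∈ supportedOn (univ : Set (SingSimplex Y n)) := by
  rw [supportedOn, Finsupp.supported_univ]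
  trivial

theorem ofSimplex_mem_supportedOn {n : ℕ} {Q : Set (SingSimplex Y n)} {σ : SingSimplex Y n}
    (h : σ ∈ Q) : ofSimplex σ ∈ supportedOn Q := Finsupp.single_mem_supported ℤ _ h

theorem realize_mem_supportedOn (g : C(V, Y)) {n : ℕ} {Q : Set (SingSimplex Y n)}
    {c : OrdChain V (n + 1)} (h : ∀ w ∈ c.support, g.comp (affineSimplex w) ∈ Q) :
    realize g n c ∈ supportedOn Q := by
  rw [← Finsupp.sum_single c, Finsupp.sum, map_sum]
  refine Submodule.sum_mem _ fun w hw => ?_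
  rw [← mul_one (c w), ← smul_eq_mul, ← Finsupp.smul_single, map_smul]
  refine Submodule.smul_mem _ _ ?_
  rw [realize_ofVertices]
  exact ofSimplex_mem_supportedOn (h w hw)

/-- The singular simplices with image in the subset `S`; they support the chains of `S`. -/
def simplicesIn (S : Set Y) (n : ℕ) : Set (SingSimplex Y n) := {σ | range σ ⊆ S}

theorem mem_simplicesIn {S : Set Y} {n : ℕ} {σ : SingSimplex Y n} :
    σ ∈ simplicesIn S n ↔ ∀ x, σ x ∈ S := by
  simp [simplicesIn, range_subset_iff]

theorem singBdryInt_mem_supportedOn {n : ℕ} {Q : Set (SingSimplex Y (n + 1))}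
    {Q' : Set (SingSimplex Y n)} (h : ∀ σ ∈ Q, ∀ i, face i σ ∈ Q') {c : IntChain Y (n + 1)}
    (hc : c ∈ supportedOn Q) : singBdryInt Y n c ∈ supportedOn Q' := by
  refine map_mem_of_mem_supported _ _ (fun σ hσ => ?_) hc
  rw [singBdryInt_ofSimplex]
  exact Submodule.sum_mem _ fun i _ => Submodule.smul_mem _ _ (ofSimplex_mem_supportedOn (h σ hσ i))

theorem mapChain_mem_supportedOn (f : C(Y, Y')) {n : ℕ} {Q : Set (SingSimplex Y n)}
    {Q' : Set (SingSimplex Y' n)} (h : ∀ σ ∈ Q, f.comp σ ∈ Q') {c : IntChain Y n}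
    (hc : c ∈ supportedOn Q) : mapChain f n c ∈ supportedOn Q' := by
  refine map_mem_of_mem_supported _ _ (fun σ hσ => ?_) hc
  rw [mapChain_ofSimplex]
  exact ofSimplex_mem_supportedOn (h σ hσ)

end Realization

/-! ### Subdivision of singular chains -/

section Subdivision

variable {Y Y' : Type*} [TopologicalSpace Y] [TopologicalSpace Y']

/-- The barycenter of a sequence of points of a standard simplex. -/
def barycenter {m : ℕ} (n : ℕ) (w : Fin (n + 1) → stdSimplex ℝ (Fin m)) : stdSimplex ℝ (Fin m) :=
  affineSimplex w stdSimplex.barycenter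

theorem faceInclusion_barycenter {m : ℕ} (i : Fin (m + 2)) (n : ℕ)
    (w : Fin (n + 1) → StdSimplex m) :
    faceInclusion i (barycenter n w) = barycenter n (faceInclusion i ∘ w) :=
  DFunLike.congr_fun (faceInclusion_affineSimplex i w) _

/-- The `k`-fold barycentric subdivision of singular chains, induced by the subdivision of the
standard simplices. -/
def subdiv (Y : Type*) [TopologicalSpace Y] (k n : ℕ) : IntChain Y n →ₗ[ℤ] IntChain Y n :=
  Finsupp.linearCombination ℤ (fun σ => realize σ n
    (ordSubdivIter barycenter k (n + 1) (ofVertices (vertices n))))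

theorem subdiv_ofSimplex (k : ℕ) {n : ℕ} (σ : SingSimplex Y n) :
    subdiv Y k n (ofSimplex σ) =
      realize σ n (ordSubdivIter barycenter k (n + 1) (ofVertices (vertices n))) := by
  simp [subdiv]

/-- The chain homotopy from the identity to the `k`-fold subdivision of singular chains. -/
def subdivHomotopy (Y : Type*) [TopologicalSpace Y] (k n : ℕ) :
    IntChain Y n →ₗ[ℤ] IntChain Y (n + 1) :=
  Finsupp.linearCombination ℤ (fun σ => realize σ (n + 1)
    (coneHomotopy (ordSubdivIter barycenter k) (fun _ => LinearMap.id) barycenter (n + 1)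
      (ofVertices (vertices n))))

theorem subdivHomotopy_ofSimplex (k : ℕ) {n : ℕ} (σ : SingSimplex Y n) :
    subdivHomotopy Y k n (ofSimplex σ) =
      realize σ (n + 1) (coneHomotopy (ordSubdivIter barycenter k) (fun _ => LinearMap.id)
        barycenter (n + 1) (ofVertices (vertices n))) := by
  simp [subdivHomotopy]

theorem ordBdry_vertices (n : ℕ) :
    ordBdry (StdSimplex (n + 1)) (n + 1) (ofVertices (vertices (n + 1))) =
      ∑ i : Fin (n + 2), (-1 : ℤ) ^ (i : ℕ) • mapVertices (faceInclusion i) (n + 1)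
        (ofVertices (vertices n)) := by
  simp only [ordBdry_ofVertices, mapVertices_ofVertices, faceInclusion_vertices]

theorem singBdryInt_subdiv (k n : ℕ) (c : IntChain Y (n + 1)) :
    singBdryInt Y n (subdiv Y k (n + 1) c) = subdiv Y k n (singBdryInt Y n c) := by
  refine apply_eq_of_forall_single (singBdryInt Y n ∘ₗ subdiv Y k (n + 1))
    (subdiv Y k n ∘ₗ singBdryInt Y n) (fun σ => ?_) c
  simp only [LinearMap.comp_apply, subdiv_ofSimplex, singBdryInt_ofSimplex, map_sum, map_smul,
    singBdryInt_realize, ordBdry_ordSubdivIter, ordBdry_vertices, face_eq]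
  refine Finset.sum_congr rfl fun i _ => ?_
  rw [realize_comp _ _ (faceInclusion_affineSimplex i),
    mapVertices_ordSubdivIter _ (faceInclusion_barycenter i)]

theorem singBdryInt_subdivHomotopy (k n : ℕ) (c : IntChain Y (n + 1)) :
    singBdryInt Y (n + 1) (subdivHomotopy Y k (n + 1) c) =
      subdiv Y k (n + 1) c - c - subdivHomotopy Y k n (singBdryInt Y n c) := by
  refine apply_eq_of_forall_single (singBdryInt Y (n + 1) ∘ₗ subdivHomotopy Y k (n + 1))
    (subdiv Y k (n + 1) - LinearMap.id - subdivHomotopy Y k n ∘ₗ singBdryInt Y n) (fun σ => ?_) c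
  simp only [LinearMap.comp_apply, LinearMap.sub_apply, LinearMap.id_apply,
    subdivHomotopy_ofSimplex, subdiv_ofSimplex, singBdryInt_ofSimplex, map_sum, map_smul,
    singBdryInt_realize]
  rw [ordBdry_coneHomotopy _ _ _ (ordBdry_ordSubdivIter _ k) (fun _ _ => rfl)
    (ordSubdivIter_zero_eq _ k), map_sub, map_sub, ordBdry_vertices]
  congr 1
  · congr 1
    rw [LinearMap.id_apply, realize_ofVertices, affineSimplex_vertices, ContinuousMap.comp_id]
  · simp only [map_sum, map_smul, face_eq]
    refine Finset.sum_congr rfl fun i _ => ?_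
    rw [realize_comp _ _ (faceInclusion_affineSimplex i)]
    congr 2
    exact (mapVertices_coneHomotopy _ _
      (mapVertices_ordSubdivIter _ (faceInclusion_barycenter i) k) (fun _ _ => rfl)
      (faceInclusion_barycenter i) _ _).symm

theorem subdiv_mem_supportedOn (k : ℕ) {n : ℕ} {S : Set Y} {c : IntChain Y n}
    (hc : c ∈ supportedOn (simplicesIn S n)) : subdiv Y k n c ∈ supportedOn (simplicesIn S n) := by
  refine map_mem_of_mem_supported _ _ (fun σ hσ => ?_) hc
  rw [subdiv_ofSimplex]
  refine realize_mem_supportedOn _ fun w _ => ?_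
  rw [mem_simplicesIn] at hσ ⊢
  exact fun x => hσ _

theorem subdivHomotopy_mem_supportedOn (k : ℕ) {n : ℕ} {S : Set Y} {c : IntChain Y n}
    (hc : c ∈ supportedOn (simplicesIn S n)) :
    subdivHomotopy Y k n c ∈ supportedOn (simplicesIn S (n + 1)) := by
  refine map_mem_of_mem_supported _ _ (fun σ hσ => ?_) hc
  rw [subdivHomotopy_ofSimplex]
  refine realize_mem_supportedOn _ fun w _ => ?_
  rw [mem_simplicesIn] at hσ ⊢
  exact fun x => hσ _

end Subdivision

/-! ### The prism operator -/

section Prism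

variable {Y : Type*} [TopologicalSpace Y]

/-- The two ends of the standard `1`-simplex. -/
abbrev endpoint (i : Fin 2) : StdSimplex 1 := stdSimplex.vertex i

/-- The inclusions of the two ends of the cylinder on `X`. -/
def cylinderEnd (X : Type*) [TopologicalSpace X] (i : Fin 2) : C(X, X × StdSimplex 1) :=
  (ContinuousMap.id X).prodMk (ContinuousMap.const X (endpoint i))

theorem affineSimplex_const {m n : ℕ} (x : stdSimplex ℝ (Fin m)) :
    affineSimplex (fun _ : Fin (n + 1) => x) = ContinuousMap.const _ x := by
  ext t j
  change ∑ i, t i * x j = x j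
  rw [← Finset.sum_mul, stdSimplex.sum_eq_one, one_mul]

theorem cylinderEnd_affineSimplex {m n : ℕ} (i : Fin 2) (w : Fin (n + 1) → StdSimplex m) :
    (cylinderEnd (StdSimplex m) i).comp (affineSimplex w) =
      affineSimplex (cylinderEnd (StdSimplex m) i ∘ w) := by
  ext1 t
  refine Prod.ext rfl ?_
  exact (DFunLike.congr_fun (affineSimplex_const (n := n) (endpoint i)) t).symm

/-- The triangulation of the prism over an ordered chain, obtained as the homotopy between the two
ends of the prism. -/
def ordPrism (m : ℕ) (n : ℕ) :
    OrdChain (StdSimplex m) n →ₗ[ℤ] OrdChain (StdSimplex m × StdSimplex 1) (n + 1) :=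
  coneHomotopy (mapVertices (cylinderEnd _ 1)) (mapVertices (cylinderEnd _ 0))
    (fun _ w => cylinderEnd _ 0 (w 0)) n

/-- The prism operator of a family `G` of homotopies, one for each singular simplex. It is a chain
homotopy when the homotopies are compatible with faces. -/
def prism (G : ∀ n, SingSimplex Y n → C(StdSimplex n × StdSimplex 1, Y)) (n : ℕ) :
    IntChain Y n →ₗ[ℤ] IntChain Y (n + 1) :=
  Finsupp.linearCombination ℤ (fun σ => realize (G n σ) (n + 1)
    (ordPrism n (n + 1) (ofVertices (vertices n))))

theorem prism_ofSimplex (G : ∀ n, SingSimplex Y n → C(StdSimplex n × StdSimplex 1, Y)) {n : ℕ}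
    (σ : SingSimplex Y n) :
    prism G n (ofSimplex σ) =
      realize (G n σ) (n + 1) (ordPrism n (n + 1) (ofVertices (vertices n))) := by
  simp [prism]

/-- The map of singular chains given by the `i`-th end of the homotopies `G`. -/
def endChain (G : ∀ n, SingSimplex Y n → C(StdSimplex n × StdSimplex 1, Y)) (i : Fin 2) (n : ℕ) :
    IntChain Y n →ₗ[ℤ] IntChain Y n :=
  Finsupp.lmapDomain ℤ ℤ (fun σ => (G n σ).comp (cylinderEnd _ i))

@[simp] theorem endChain_ofSimplex (G : ∀ n, SingSimplex Y n → C(StdSimplex n × StdSimplex 1, Y))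
    (i : Fin 2) {n : ℕ} (σ : SingSimplex Y n) :
    endChain G i n (ofSimplex σ) = ofSimplex ((G n σ).comp (cylinderEnd _ i)) := by
  simp [endChain]

theorem prodMap_affineSimplex {m n : ℕ} (i : Fin (m + 2))
    (w : Fin (n + 1) → StdSimplex m × StdSimplex 1) :
    ((faceInclusion i).prodMap (ContinuousMap.id (StdSimplex 1))).comp (affineSimplex w) =
      affineSimplex ((faceInclusion i).prodMap (ContinuousMap.id (StdSimplex 1)) ∘ w) := by
  ext1 t
  refine Prod.ext ?_ rfl
  exact DFunLike.congr_fun (faceInclusion_affineSimplex i (fun k => (w k).1)) t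

theorem singBdryInt_prism (G : ∀ n, SingSimplex Y n → C(StdSimplex n × StdSimplex 1, Y))
    (hG : ∀ n i σ,
      G n (face i σ) = (G (n + 1) σ).comp ((faceInclusion i).prodMap (ContinuousMap.id _)))
    (n : ℕ) (c : IntChain Y (n + 1)) :
    singBdryInt Y (n + 1) (prism G (n + 1) c) =
      endChain G 1 (n + 1) c - endChain G 0 (n + 1) c - prism G n (singBdryInt Y n c) := by
  refine apply_eq_of_forall_single (singBdryInt Y (n + 1) ∘ₗ prism G (n + 1))
    (endChain G 1 (n + 1) - endChain G 0 (n + 1) - prism G n ∘ₗ singBdryInt Y n) (fun σ => ?_) c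
  simp only [LinearMap.comp_apply, LinearMap.sub_apply, prism_ofSimplex, endChain_ofSimplex,
    singBdryInt_ofSimplex, map_sum, map_smul, singBdryInt_realize]
  have hz : ∀ c : OrdChain (StdSimplex (n + 1)) 0,
      mapVertices (cylinderEnd (StdSimplex (n + 1)) 1) 0 c =
        mapVertices (cylinderEnd (StdSimplex (n + 1)) 0) 0 c :=
    mapVertices_zero_eq _ _
  rw [ordPrism, ordBdry_coneHomotopy _ _ _ (ordBdry_mapVertices _) (ordBdry_mapVertices _) hz,
    map_sub, map_sub, ordBdry_vertices]
  congr 1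
  · congr 1
    · rw [← realize_comp _ _ (cylinderEnd_affineSimplex 1), realize_ofVertices,
        affineSimplex_vertices, ContinuousMap.comp_id]
    · rw [← realize_comp _ _ (cylinderEnd_affineSimplex 0), realize_ofVertices,
        affineSimplex_vertices, ContinuousMap.comp_id]
  · simp only [map_sum, map_smul, hG]
    refine Finset.sum_congr rfl fun i _ => ?_
    rw [realize_comp _ _ (prodMap_affineSimplex i), ordPrism]
    congr 2
    exact (mapVertices_coneHomotopy _ _ (fun n c => by simp only [mapVertices_mapVertices]; rfl)
      (fun n c => by simp only [mapVertices_mapVertices]; rfl) (fun _ _ => rfl) _ _).symm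

theorem prism_mem_supportedOn (G : ∀ n, SingSimplex Y n → C(StdSimplex n × StdSimplex 1, Y))
    {n : ℕ} {S : Set Y} {Q : Set (SingSimplex Y n)} (h : ∀ σ ∈ Q, ∀ x, G n σ x ∈ S)
    {c : IntChain Y n} (hc : c ∈ supportedOn Q) :
    prism G n c ∈ supportedOn (simplicesIn S (n + 1)) := by
  refine map_mem_of_mem_supported _ _ (fun σ hσ => ?_) hc
  rw [prism_ofSimplex]
  refine realize_mem_supportedOn _ fun w _ => ?_
  rw [mem_simplicesIn]
  exact fun x => h σ hσ _

end Prism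

/-! ### Small simplices -/

section Small

variable {m : ℕ}

theorem dist_affineSimplex_le {n : ℕ} (w : Fin (n + 1) → stdSimplex ℝ (Fin m)) (t : StdSimplex n)
    (x : stdSimplex ℝ (Fin m)) {r : ℝ} (hr : 0 ≤ r) (h : ∀ i, dist (w i) x ≤ r) :
    dist (affineSimplex w t) x ≤ r := by
  rw [Subtype.dist_eq, dist_pi_le_iff hr]
  intro j
  have hx : x.1 j = ∑ i, t i * x.1 j := by
    rw [← Finset.sum_mul, stdSimplex.sum_eq_one, one_mul]
  change |(∑ i, t i * (w i).1 j) - x.1 j| ≤ r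
  rw [hx, ← Finset.sum_sub_distrib]
  refine (Finset.abs_sum_le_sum_abs _ _).trans ?_
  calc ∑ i, |t i * (w i).1 j - t i * x.1 j| ≤ ∑ i, t i * r := by
        refine Finset.sum_le_sum fun i _ => ?_
        rw [← mul_sub, abs_mul, abs_of_nonneg (stdSimplex.zero_le t i)]
        refine mul_le_mul_of_nonneg_left ?_ (stdSimplex.zero_le t i)
        exact (dist_le_pi_dist (w i).1 x.1 j).trans (h i)
    _ = r := by rw [← Finset.sum_mul, stdSimplex.sum_eq_one, one_mul]

theorem dist_barycenter_le {n : ℕ} (w : Fin (n + 1) → stdSimplex ℝ (Fin m)) {d : ℝ} (hd : 0 ≤ d)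
    (h : ∀ i j, dist (w i) (w j) ≤ d) (k : Fin (n + 1)) :
    dist (w k) (barycenter n w) ≤ n / (n + 1) * d := by
  rw [Subtype.dist_eq, dist_pi_le_iff (by positivity)]
  intro j
  change |(w k).1 j - ∑ i, (stdSimplex.barycenter : StdSimplex n) i * (w i).1 j| ≤ _
  have hb : ∀ i, (stdSimplex.barycenter : StdSimplex n) i = 1 / (n + 1) := fun i => by
    simp [stdSimplex.barycenter, DFunLike.coe]
  have hx : (w k).1 j = ∑ i : Fin (n + 1), (1 / ((n : ℝ) + 1)) * (w k).1 j := by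
    rw [Finset.sum_const, Finset.card_univ, Fintype.card_fin, nsmul_eq_mul]
    push_cast
    field_simp
  rw [hx, ← Finset.sum_sub_distrib, ← Finset.add_sum_erase _ _ (Finset.mem_univ k)]
  simp only [hb, sub_self, zero_add]
  refine (Finset.abs_sum_le_sum_abs _ _).trans ?_
  calc ∑ i ∈ Finset.univ.erase k, |1 / ((n : ℝ) + 1) * (w k).1 j - 1 / ((n : ℝ) + 1) * (w i).1 j|
      ≤ ∑ i ∈ Finset.univ.erase k, 1 / ((n : ℝ) + 1) * d := by
        refine Finset.sum_le_sum fun i _ => ?_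
        rw [← mul_sub, abs_mul, abs_of_nonneg (by positivity)]
        refine mul_le_mul_of_nonneg_left ?_ (by positivity)
        exact (dist_le_pi_dist (w k).1 (w i).1 j).trans (h k i)
    _ = n / (n + 1) * d := by
        rw [Finset.sum_const, Finset.card_erase_of_mem (Finset.mem_univ k), Finset.card_univ,
          Fintype.card_fin, nsmul_eq_mul, Nat.add_sub_cancel]
        ring

theorem ordSubdiv_mem_supported_dist_le {n : ℕ} (w : Fin n → stdSimplex ℝ (Fin m))
    (x : stdSimplex ℝ (Fin m)) {r : ℝ} (hr : 0 ≤ r) (h : ∀ i, dist (w i) x ≤ r) :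
    ordSubdiv barycenter n (ofVertices w) ∈ Finsupp.supported ℤ ℤ {u | ∀ i, dist (u i) x ≤ r} := by
  induction n with
  | zero => exact Finsupp.single_mem_supported ℤ _ fun i => i.elim0
  | succ n ih =>
    rw [ordSubdiv_ofVertices, ordBdry_ofVertices, map_sum]
    simp only [map_smul, map_sum]
    refine Submodule.sum_mem _ fun i _ => Submodule.smul_mem _ _ ?_
    refine map_mem_of_mem_supported _ _ (fun u hu => ?_) (ih (w ∘ i.succAbove) fun _ => h _)
    rw [ordCone_ofVertices]
    refine Finsupp.single_mem_supported ℤ _ fun k => ?_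
    refine Fin.cases ?_ (fun k => ?_) k
    · exact dist_affineSimplex_le w _ x hr h
    · exact hu k

theorem dist_cons_le {X : Type*} [PseudoMetricSpace X] {n : ℕ} {p : X} {u : Fin n → X} {r : ℝ}
    (hr : 0 ≤ r) (hp : ∀ i, dist (u i) p ≤ r) (hu : ∀ i j, dist (u i) (u j) ≤ r)
    (k l : Fin (n + 1)) :
    dist ((Fin.cons p u : Fin (n + 1) → X) k) ((Fin.cons p u : Fin (n + 1) → X) l) ≤ r := by
  refine Fin.cases ?_ (fun k => ?_) k <;> refine Fin.cases ?_ (fun l => ?_) l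
  · rwa [Fin.cons_zero, dist_self]
  · rw [Fin.cons_zero, Fin.cons_succ, dist_comm]
    exact hp l
  · exact hp k
  · exact hu k l

theorem ordSubdiv_mem_supported_pairwise_dist_le {n : ℕ} (w : Fin (n + 1) → stdSimplex ℝ (Fin m))
    {d : ℝ} (hd : 0 ≤ d) (h : ∀ i j, dist (w i) (w j) ≤ d) :
    ordSubdiv barycenter (n + 1) (ofVertices w) ∈
      Finsupp.supported ℤ ℤ {u | ∀ i j, dist (u i) (u j) ≤ n / (n + 1) * d} := by
  induction n with
  | zero =>
    rw [Finsupp.mem_supported]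
    intro u _ i j
    rw [(Subsingleton.elim (α := Fin 1) i j : i = j), dist_self]
    positivity
  | succ n ih =>
    rw [ordSubdiv_ofVertices, ordBdry_ofVertices, map_sum]
    simp only [map_smul, map_sum]
    refine Submodule.sum_mem _ fun i _ => Submodule.smul_mem _ _ ?_
    have hpair := ih (w ∘ i.succAbove) fun _ _ => h _ _
    have hbary := ordSubdiv_mem_supported_dist_le (w ∘ i.succAbove) (barycenter (n + 1) w)
      (by positivity) fun k => dist_barycenter_le w hd h _
    have hmem := Submodule.mem_inf.2 ⟨hpair, hbary⟩
    rw [← Finsupp.supported_inter] at hmem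
    refine map_mem_of_mem_supported _ _ (fun u hu => ?_) hmem
    rw [ordCone_ofVertices]
    have hle : (n : ℝ) / (n + 1) * d ≤ ((n + 1 : ℕ) : ℝ) / ((n + 1 : ℕ) + 1) * d := by
      refine mul_le_mul_of_nonneg_right ?_ hd
      rw [div_le_div_iff₀ (by positivity) (by positivity)]
      push_cast
      nlinarith
    exact Finsupp.single_mem_supported ℤ _
      (dist_cons_le (by positivity) hu.2 fun k l => (hu.1 k l).trans hle)

theorem ordSubdivIter_mem_supported_pairwise_dist_le (k : ℕ) {n : ℕ}
    (w : Fin (n + 1) → stdSimplex ℝ (Fin m)) {d : ℝ} (hd : 0 ≤ d)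
    (h : ∀ i j, dist (w i) (w j) ≤ d) :
    ordSubdivIter barycenter k (n + 1) (ofVertices w) ∈
      Finsupp.supported ℤ ℤ {u | ∀ i j, dist (u i) (u j) ≤ (n / (n + 1)) ^ k * d} := by
  induction k with
  | zero =>
    refine Finsupp.single_mem_supported ℤ _ fun i j => ?_
    simpa using h i j
  | succ k ih =>
    rw [pow_succ' ((n : ℝ) / (n + 1)), ordSubdivIter, pow_succ' (ordSubdiv _ _),
      Module.End.mul_apply]
    refine map_mem_of_mem_supported _ _ (fun u hu => ?_) ih
    have := ordSubdiv_mem_supported_pairwise_dist_le u (by positivity) hu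
    rwa [← mul_assoc] at this

theorem dist_stdSimplex_le_one (x y : stdSimplex ℝ (Fin m)) : dist x y ≤ 1 := by
  rw [Subtype.dist_eq, dist_pi_le_iff zero_le_one]
  intro j
  exact Real.dist_le_of_mem_Icc_01 ⟨stdSimplex.zero_le x j, stdSimplex.le_one x j⟩
    ⟨stdSimplex.zero_le y j, stdSimplex.le_one y j⟩

theorem exists_ordSubdivIter_mem_supported_pairwise_dist_lt (n : ℕ) {δ : ℝ} (hδ : 0 < δ) :
    ∃ k₀, ∀ k ≥ k₀, ordSubdivIter barycenter k (n + 1) (ofVertices (vertices n)) ∈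
      Finsupp.supported ℤ ℤ {u | ∀ i j, dist (u i) (u j) < δ} := by
  have h1 : (n : ℝ) / (n + 1) < 1 := by
    rw [div_lt_one (by positivity)]
    linarith
  obtain ⟨k₀, hk₀⟩ := exists_pow_lt_of_lt_one hδ h1
  refine ⟨k₀, fun k hk => ?_⟩
  refine Finsupp.supported_mono (fun u hu i j => ?_)
    (ordSubdivIter_mem_supported_pairwise_dist_le k (vertices n) zero_le_one
      fun _ _ => dist_stdSimplex_le_one _ _)
  refine (hu i j).trans_lt ?_
  rw [mul_one]
  exact (pow_le_pow_of_le_one (by positivity) h1.le hk).trans_lt hk₀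

variable {Y : Type*} [TopologicalSpace Y]

/-- The singular simplices subordinate to the family `U`, that is, with image in one of its members;
they support the small chains. -/
def subordinateSimplices {ι : Type*} (U : ι → Set Y) (n : ℕ) : Set (SingSimplex Y n) :=
  {σ | ∃ i, ∀ x, σ x ∈ U i}

theorem face_mem_subordinateSimplices {ι : Type*} {U : ι → Set Y} {n : ℕ}
    {σ : SingSimplex Y (n + 1)} (h : σ ∈ subordinateSimplices U (n + 1)) (i : Fin (n + 2)) :
    face i σ ∈ subordinateSimplices U n := by
  obtain ⟨j, hj⟩ := h
  exact ⟨j, fun x => hj _⟩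

theorem exists_subdiv_mem_supportedOn_subordinate {ι : Type*} {U : ι → Set Y}
    (hU : ∀ i, IsOpen (U i)) (hc : ∀ y, ∃ i, y ∈ U i) {n : ℕ} (c : IntChain Y n) :
    ∃ k₀, ∀ k ≥ k₀, subdiv Y k n c ∈ supportedOn (subordinateSimplices U n) := by
  induction c using Finsupp.induction_linear with
  | zero => exact ⟨0, fun k _ => by rw [map_zero]; exact Submodule.zero_mem _⟩
  | add c d hc hd =>
    obtain ⟨k₀, h₀⟩ := hc
    obtain ⟨k₁, h₁⟩ := hd
    refine ⟨max k₀ k₁, fun k hk => ?_⟩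
    rw [map_add]
    exact Submodule.add_mem _ (h₀ k (le_of_max_le_left hk)) (h₁ k (le_of_max_le_right hk))
  | single σ a =>
    obtain ⟨δ, hδ, h⟩ := lebesgue_number_lemma_of_metric (s := (univ : Set (StdSimplex n)))
      (c := fun i => σ ⁻¹' U i) isCompact_univ (fun i => (hU i).preimage σ.continuous)
      (fun x _ => mem_iUnion.2 (hc (σ x)))
    obtain ⟨k₀, h₀⟩ := exists_ordSubdivIter_mem_supported_pairwise_dist_lt n (half_pos hδ)
    refine ⟨k₀, fun k hk => ?_⟩
    rw [← mul_one a, ← smul_eq_mul, ← Finsupp.smul_single, map_smul, subdiv_ofSimplex]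
    refine Submodule.smul_mem _ _ (realize_mem_supportedOn _ fun u hu => ?_)
    obtain ⟨i, hi⟩ := h (u 0) (mem_univ _)
    refine ⟨i, fun x => hi ?_⟩
    rw [Metric.mem_ball]
    refine (dist_affineSimplex_le u x (u 0) (half_pos hδ).le fun j => ?_).trans_lt (half_lt_self hδ)
    exact ((Finsupp.mem_supported ℤ _).1 (h₀ k hk) hu j 0).le

end Small

/-! ### Labels and degrees -/

section Label

variable {V : Type*}

theorem exists_one_div_le_apply {n : ℕ} (x : StdSimplex n) : ∃ i, 1 / ((n : ℝ) + 1) ≤ x i := by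
  by_contra! h
  have h1 : ∑ i, x i < ∑ _i : Fin (n + 1), 1 / ((n : ℝ) + 1) :=
    Finset.sum_lt_sum_of_nonempty Finset.univ_nonempty fun i _ => h i
  rw [stdSimplex.sum_eq_one, Finset.sum_const, Finset.card_univ, Fintype.card_fin, nsmul_eq_mul]
    at h1
  push_cast at h1
  rw [mul_one_div_cancel (by positivity)] at h1
  exact lt_irrefl _ h1

/-- A Sperner labelling of the points of the standard simplex: a chosen index at which the
barycentric coordinate is at least `1 / (n + 1)`. -/
def label {n : ℕ} (x : StdSimplex n) : Fin (n + 1) := (exists_one_div_le_apply x).choose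

theorem one_div_le_apply_label {n : ℕ} (x : StdSimplex n) : 1 / ((n : ℝ) + 1) ≤ x (label x) :=
  (exists_one_div_le_apply x).choose_spec

theorem label_ne_of_apply_lt {n : ℕ} {x : StdSimplex n} {i : Fin (n + 1)}
    (h : x i < 1 / ((n : ℝ) + 1)) : label x ≠ i := by
  rintro rfl
  exact h.not_ge (one_div_le_apply_label x)

theorem vertices_apply {n : ℕ} (i j : Fin (n + 1)) : vertices n i j = if i = j then 1 else 0 := by
  change (stdSimplex.vertex i : StdSimplex n) j = _
  simp only [stdSimplex.vertex_coe, Pi.single_apply]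
  simp only [eq_comm]

theorem label_vertices {n : ℕ} (i : Fin (n + 1)) : label (vertices n i) = i := by
  by_contra h
  have := one_div_le_apply_label (vertices n i)
  rw [vertices_apply, if_neg (Ne.symm h)] at this
  exact absurd this (not_le.2 (by positivity))

theorem faceInclusion_apply_self {n : ℕ} (i : Fin (n + 2)) (x : StdSimplex n) :
    faceInclusion i x i = 0 := by
  change stdSimplex.map i.succAbove x i = 0
  rw [stdSimplex.map_coe, FunOnFinite.linearMap_apply_apply]
  refine Finset.sum_eq_zero fun k hk => ?_
  exact absurd (Finset.mem_filter.1 hk).2 (Fin.succAbove_ne i k)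

/-- The cochain that sends an ordered simplex to the determinant of the labels of its vertices. For
`labelVec` it counts the fully labelled simplices with sign, as in Sperner's lemma, and so computes
the degree of a chain relative to the boundary of the simplex. -/
def labelDegree {n : ℕ} (l : V → Fin (n + 1) → ℤ) : OrdChain V (n + 1) →ₗ[ℤ] ℤ :=
  Finsupp.linearCombination ℤ (fun w => Matrix.det (Matrix.of fun i => l (w i)))

@[simp] theorem labelDegree_ofVertices {n : ℕ} (l : V → Fin (n + 1) → ℤ) (w : Fin (n + 1) → V) :
    labelDegree l (ofVertices w) = Matrix.det (Matrix.of fun i => l (w i)) := by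
  simp [labelDegree]

theorem sum_neg_one_pow_mul_det_succAbove_eq_zero {n : ℕ} (v : Fin (n + 2) → Fin (n + 1) → ℤ)
    (h : ∀ i, ∑ j, v i j = 1) :
    ∑ i : Fin (n + 2), (-1 : ℤ) ^ (i : ℕ) * Matrix.det (Matrix.of fun k => v (i.succAbove k)) =
      0 := by
  let M : Matrix (Fin (n + 2)) (Fin (n + 2)) ℤ := Matrix.of fun i =>
    (Fin.cons 1 (v i) : Fin (n + 2) → ℤ)
  have h0 : M.det = 0 := by
    rw [← Matrix.exists_mulVec_eq_zero_iff]
    refine ⟨Fin.cons 1 (fun _ => -1), fun h => by simpa using congrFun h 0, ?_⟩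
    funext i
    simp [M, Matrix.mulVec, dotProduct, Fin.sum_univ_succ (n := n + 1), h i]
  rw [Matrix.det_succ_column_zero] at h0
  rw [← h0]
  refine Finset.sum_congr rfl fun i _ => ?_
  have : M i 0 = 1 := rfl
  rw [this, mul_one]
  rfl

/-- The label of a point, encoded as a standard basis vector. -/
def labelVec {n : ℕ} (x : StdSimplex n) : Fin (n + 1) → ℤ := Pi.single (label x) 1

theorem sum_labelVec {n : ℕ} (x : StdSimplex n) : ∑ j, labelVec x j = 1 := by
  simp [labelVec]

theorem labelDegree_ordBdry {n : ℕ} {l : V → Fin (n + 1) → ℤ} (h : ∀ v, ∑ j, l v j = 1)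
    (c : OrdChain V (n + 2)) : labelDegree l (ordBdry V (n + 1) c) = 0 := by
  refine apply_eq_of_forall_single (labelDegree l ∘ₗ ordBdry V (n + 1)) 0 (fun w => ?_) c
  simp only [LinearMap.comp_apply, ordBdry_ofVertices, map_sum, map_smul, labelDegree_ofVertices,
    smul_eq_mul]
  exact sum_neg_one_pow_mul_det_succAbove_eq_zero (fun i => l (w i)) fun i => h (w i)

theorem labelDegree_vertices (n : ℕ) : labelDegree labelVec (ofVertices (vertices n)) = 1 := by
  rw [labelDegree_ofVertices]
  convert Matrix.det_one (n := Fin (n + 1)) (R := ℤ)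
  ext i j
  simp [labelVec, label_vertices, Matrix.one_apply, Pi.single_apply, eq_comm]

theorem labelDegree_mapVertices_faceInclusion {n : ℕ} (i : Fin (n + 2))
    (c : OrdChain (StdSimplex n) (n + 2)) :
    labelDegree labelVec (mapVertices (faceInclusion i) (n + 2) c) = 0 := by
  refine apply_eq_of_forall_single
    (labelDegree labelVec ∘ₗ mapVertices (faceInclusion i) (n + 2)) 0 (fun w => ?_) c
  rw [LinearMap.comp_apply, mapVertices_ofVertices, labelDegree_ofVertices, LinearMap.zero_apply]
  refine Matrix.det_eq_zero_of_column_eq_zero i fun k => ?_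
  refine Pi.single_eq_of_ne (label_ne_of_apply_lt ?_).symm _
  rw [Function.comp_apply, faceInclusion_apply_self]
  positivity

theorem labelDegree_coneHomotopy_ordBdry_vertices (k n : ℕ) :
    labelDegree labelVec (coneHomotopy (ordSubdivIter barycenter k) (fun _ => LinearMap.id)
      barycenter n (ordBdry (StdSimplex n) n (ofVertices (vertices n)))) = 0 := by
  cases n with
  | zero => simp [coneHomotopy]
  | succ n =>
    rw [ordBdry_vertices]
    simp only [map_sum, map_smul]
    refine Finset.sum_eq_zero fun i _ => ?_
    rw [← mapVertices_coneHomotopy (g := fun _ => LinearMap.id) (faceInclusion i)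
      (faceInclusion i) (mapVertices_ordSubdivIter _ (faceInclusion_barycenter i) k)
      (fun _ _ => rfl) (faceInclusion_barycenter i), labelDegree_mapVertices_faceInclusion,
      smul_zero]

theorem labelDegree_ordSubdivIter (k n : ℕ) :
    labelDegree labelVec (ordSubdivIter barycenter k (n + 1) (ofVertices (vertices n))) = 1 := by
  have h := congrArg (labelDegree labelVec)
    (ordBdry_coneHomotopy (ordSubdivIter barycenter k) (fun _ => LinearMap.id) barycenter
      (ordBdry_ordSubdivIter barycenter k) (fun _ _ => rfl) (ordSubdivIter_zero_eq barycenter k) n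
      (ofVertices (vertices n)))
  rw [labelDegree_ordBdry sum_labelVec, map_sub, map_sub, LinearMap.id_apply, labelDegree_vertices,
    labelDegree_coneHomotopy_ordBdry_vertices, sub_zero] at h
  exact (sub_eq_zero.1 h.symm)

end Label

/-! ### Relative cycles of the standard simplex -/

section SimplexCycles

/-- The boundary of the standard simplex, as the set of points with a vanishing coordinate. -/
def boundarySimplices (n : ℕ) : Set (StdSimplex n) := {x | ∃ i, x i = 0}

/-- The relative boundaries of the pair `(Y, A)`, enlarged by the span of the simplices in `s`. A
chain belongs to it when it is homologous relative to `A` to a combination of simplices in `s`. -/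
def relSpan {Y : Type*} [TopologicalSpace Y] (A : Set Y) {n : ℕ} (s : Set (SingSimplex Y n)) :
    Submodule ℤ (IntChain Y n) :=
  supportedOn s ⊔ (LinearMap.range (singBdryInt Y n) ⊔ supportedOn (simplicesIn A n))

section

variable {Y : Type*} [TopologicalSpace Y] {A : Set Y} {n : ℕ} {s : Set (SingSimplex Y n)}

theorem ofSimplex_mem_relSpan {σ : SingSimplex Y n} (h : σ ∈ s) : ofSimplex σ ∈ relSpan A s :=
  Submodule.mem_sup_left (ofSimplex_mem_supportedOn h)

theorem singBdryInt_mem_relSpan (c : IntChain Y (n + 1)) : singBdryInt Y n c ∈ relSpan A s :=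
  Submodule.mem_sup_right (Submodule.mem_sup_left ⟨c, rfl⟩)

theorem mem_relSpan_of_mem_supportedOn {c : IntChain Y n} (h : c ∈ supportedOn (simplicesIn A n)) :
    c ∈ relSpan A s :=
  Submodule.mem_sup_right (Submodule.mem_sup_right h)

theorem mapChain_mem_relSpan {Y' : Type*} [TopologicalSpace Y'] {A' : Set Y'}
    {s' : Set (SingSimplex Y' n)} (f : C(Y, Y')) (hA : ∀ x ∈ A, f x ∈ A')
    (hs : ∀ σ ∈ s, f.comp σ ∈ s') {c : IntChain Y n} (hc : c ∈ relSpan A s) :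
    mapChain f n c ∈ relSpan A' s' := by
  obtain ⟨x, hx, y, hy, rfl⟩ := Submodule.mem_sup.1 hc
  obtain ⟨_, ⟨b, rfl⟩, a, ha, rfl⟩ := Submodule.mem_sup.1 hy
  rw [map_add, map_add, ← singBdryInt_mapChain]
  refine Submodule.add_mem _ (Submodule.mem_sup_left (mapChain_mem_supportedOn f hs hx))
    (Submodule.add_mem _ (singBdryInt_mem_relSpan _)
      (mem_relSpan_of_mem_supportedOn (mapChain_mem_supportedOn f ?_ ha)))
  intro σ hσ
  rw [mem_simplicesIn] at hσ ⊢
  exact fun x => hA _ (hσ x)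

theorem mem_relSpan_of_subdiv {s : Set (SingSimplex Y (n + 1))} {c : IntChain Y (n + 1)}
    (hc : singBdryInt Y n c ∈ supportedOn (simplicesIn A n)) (k : ℕ)
    (h : subdiv Y k (n + 1) c ∈ relSpan A s) : c ∈ relSpan A s := by
  have hdecomp : c = subdiv Y k (n + 1) c - singBdryInt Y (n + 1) (subdivHomotopy Y k (n + 1) c) -
      subdivHomotopy Y k n (singBdryInt Y n c) := by
    rw [singBdryInt_subdivHomotopy]
    abel
  rw [hdecomp]
  exact Submodule.sub_mem _ (Submodule.sub_mem _ h (singBdryInt_mem_relSpan _))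
    (mem_relSpan_of_mem_supportedOn (subdivHomotopy_mem_supportedOn k hc))

theorem mem_relSpan_of_endChain (G : ∀ n, SingSimplex Y n → C(StdSimplex n × StdSimplex 1, Y))
    (hG : ∀ n i σ,
      G n (face i σ) = (G (n + 1) σ).comp ((faceInclusion i).prodMap (ContinuousMap.id _)))
    (h0 : ∀ n σ, (G n σ).comp (cylinderEnd _ 0) = σ) {s : Set (SingSimplex Y (n + 1))}
    {c : IntChain Y (n + 1)} {Q : Set (SingSimplex Y n)} (hc : singBdryInt Y n c ∈ supportedOn Q)
    (hQ : ∀ σ ∈ Q, ∀ x, G n σ x ∈ A) (h : endChain G 1 (n + 1) c ∈ relSpan A s) :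
    c ∈ relSpan A s := by
  have hstart : endChain G 0 (n + 1) c = c := by
    refine apply_eq_of_forall_single (endChain G 0 (n + 1)) LinearMap.id (fun σ => ?_) c
    rw [endChain_ofSimplex, h0, LinearMap.id_apply]
  have hdecomp : c = endChain G 1 (n + 1) c - singBdryInt Y (n + 1) (prism G (n + 1) c) -
      prism G n (singBdryInt Y n c) := by
    rw [singBdryInt_prism G hG, hstart]
    abel
  rw [hdecomp]
  exact Submodule.sub_mem _ (Submodule.sub_mem _ h (singBdryInt_mem_relSpan _))
    (mem_relSpan_of_mem_supportedOn (prism_mem_supportedOn G hQ hc))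

end

theorem affineSimplex_mem_boundarySimplices {m n : ℕ} (w : Fin (m + 1) → StdSimplex n)
    (i : Fin (n + 1)) (h : ∀ k, w k i = 0) (x : StdSimplex m) :
    affineSimplex w x ∈ boundarySimplices n :=
  ⟨i, by rw [affineSimplex_apply]; simp [h]⟩

theorem affineSimplex_vertices_mem_simplicesIn_boundary {n : ℕ} (l : Fin (n + 1) → Fin (n + 1))
    (h : ¬ Function.Surjective l) :
    affineSimplex (vertices n ∘ l) ∈ simplicesIn (boundarySimplices n) n := by
  rw [mem_simplicesIn]
  intro x
  simp only [Function.Surjective, not_forall, not_exists] at h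
  obtain ⟨i, hi⟩ := h
  refine affineSimplex_mem_boundarySimplices _ i (fun k => ?_) x
  rw [Function.comp_apply, vertices_apply, if_neg (hi k)]

/-- The degeneracy `0, …, i, i + 1, i, i + 2, …, n` of the vertices of the `n`-simplex. Its only
nondegenerate faces are the identity and the transposition of `i` and `i + 1`, so that its boundary
relates the two. -/
def repeatVertex {n : ℕ} (i : Fin n) (j : Fin (n + 2)) : Fin (n + 1) :=
  ⟨if (j : ℕ) ≤ i + 1 then j else if (j : ℕ) = i + 2 then i else j - 1, by split_ifs <;> omega⟩

theorem val_succAbove {n : ℕ} (j : Fin (n + 1)) (k : Fin n) :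
    (j.succAbove k : ℕ) = if (k : ℕ) < j then (k : ℕ) else k + 1 := by
  rw [Fin.succAbove, apply_ite Fin.val]
  rfl

theorem repeatVertex_comp_succAbove_castSucc {n : ℕ} (i : Fin n) :
    repeatVertex i ∘ (i.castSucc.castSucc).succAbove = Equiv.swap i.castSucc i.succ := by
  funext k
  rw [Fin.ext_iff, Equiv.swap_apply_def, apply_ite Fin.val, apply_ite Fin.val]
  simp only [Function.comp_apply, repeatVertex, val_succAbove, Fin.val_castSucc, Fin.val_succ,
    Fin.ext_iff]
  split_ifs <;> omega

theorem repeatVertex_comp_succAbove_succ {n : ℕ} (i : Fin n) :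
    repeatVertex i ∘ (i.succ.succ).succAbove = id := by
  funext k
  rw [Fin.ext_iff]
  simp only [Function.comp_apply, repeatVertex, val_succAbove, Fin.val_succ, id]
  split_ifs <;> omega

theorem not_surjective_repeatVertex_comp_succAbove {n : ℕ} (i : Fin n) (j : Fin (n + 2))
    (h1 : j ≠ i.castSucc.castSucc) (h2 : j ≠ i.succ.succ) :
    ¬ Function.Surjective (repeatVertex i ∘ j.succAbove) := by
  intro hs
  simp only [ne_eq, Fin.ext_iff, Fin.val_castSucc, Fin.val_succ] at h1 h2
  obtain ⟨k, hk⟩ := hs (repeatVertex i j)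
  simp only [Function.comp_apply, Fin.ext_iff, repeatVertex, val_succAbove] at hk
  split_ifs at hk <;> omega

theorem affineSimplex_mul_swap_mem_relSpan {n : ℕ} (π : Equiv.Perm (Fin (n + 1))) (i : Fin n)
    (hπ : ofSimplex (affineSimplex (vertices n ∘ π)) ∈
      relSpan (boundarySimplices n) {ContinuousMap.id (StdSimplex n)}) :
    ofSimplex (affineSimplex (vertices n ∘ ⇑(π * Equiv.swap i.castSucc i.succ))) ∈
      relSpan (boundarySimplices n) {ContinuousMap.id (StdSimplex n)} := by
  let w := vertices n ∘ π ∘ repeatVertex i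
  have hswap : w ∘ (i.castSucc.castSucc).succAbove =
      vertices n ∘ ⇑(π * Equiv.swap i.castSucc i.succ) :=
    congrArg (fun f => vertices n ∘ π ∘ f) (repeatVertex_comp_succAbove_castSucc i)
  have hid : w ∘ (i.succ.succ).succAbove = vertices n ∘ π :=
    congrArg (fun f => vertices n ∘ π ∘ f) (repeatVertex_comp_succAbove_succ i)
  have hbdry := singBdryInt_mem_relSpan (A := boundarySimplices n)
    (s := {ContinuousMap.id (StdSimplex n)}) (ofSimplex (affineSimplex w))
  rw [singBdryInt_ofSimplex, ← Finset.add_sum_erase _ _ (Finset.mem_univ i.castSucc.castSucc),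
    Submodule.add_mem_iff_left, face_eq, affineSimplex_face, hswap] at hbdry
  · rcases neg_one_pow_eq_or ℤ ((i.castSucc.castSucc : Fin (n + 2)) : ℕ) with hsign | hsign
    · rwa [hsign, one_smul] at hbdry
    · rwa [hsign, neg_smul, one_smul, Submodule.neg_mem_iff] at hbdry
  · refine Submodule.sum_mem _ fun j hj => Submodule.smul_mem _ _ ?_
    rw [face_eq, affineSimplex_face]
    by_cases hji : j = i.succ.succ
    · rwa [hji, hid]
    · refine mem_relSpan_of_mem_supportedOn (ofSimplex_mem_supportedOn
        (affineSimplex_vertices_mem_simplicesIn_boundary (π ∘ repeatVertex i ∘ j.succAbove) ?_))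
      rw [π.comp_surjective]
      exact not_surjective_repeatVertex_comp_succAbove i j (Finset.ne_of_mem_erase hj) hji

theorem affineSimplex_perm_mem_relSpan {n : ℕ} (π : Equiv.Perm (Fin (n + 1))) :
    ofSimplex (affineSimplex (vertices n ∘ π)) ∈
      relSpan (boundarySimplices n) {ContinuousMap.id (StdSimplex n)} := by
  have hπ : π ∈ Submonoid.closure (range fun i : Fin n => Equiv.swap i.castSucc i.succ) := by
    rw [Equiv.Perm.mclosure_swap_castSucc_succ]
    trivial
  induction hπ using Submonoid.closure_induction_right with
  | one =>
    rw [Equiv.Perm.coe_one, Function.comp_id, affineSimplex_vertices]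
    exact ofSimplex_mem_relSpan rfl
  | mul_right π _ s hs ih =>
    obtain ⟨i, rfl⟩ := hs
    exact affineSimplex_mul_swap_mem_relSpan π i ih

theorem affineSimplex_vertices_comp_mem_relSpan {n : ℕ} (l : Fin (n + 1) → Fin (n + 1)) :
    ofSimplex (affineSimplex (vertices n ∘ l)) ∈
      relSpan (boundarySimplices n) {ContinuousMap.id (StdSimplex n)} := by
  by_cases h : Function.Surjective l
  · exact affineSimplex_perm_mem_relSpan
      (Equiv.ofBijective l (Finite.surjective_iff_bijective.1 h))
  · exact mem_relSpan_of_mem_supportedOn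
      (ofSimplex_mem_supportedOn (affineSimplex_vertices_mem_simplicesIn_boundary l h))

/-- The straight-line path between two points of the standard simplex. -/
def lineSimplex (n : ℕ) : C((StdSimplex n × StdSimplex n) × StdSimplex 1, StdSimplex n) where
  toFun p := affineSimplex ![p.1.1, p.1.2] p.2
  continuous_toFun := by
    refine Continuous.subtype_mk (continuous_pi fun j => continuous_finsetSum _ fun i _ => ?_) _
    refine ((continuous_apply i).comp (continuous_subtype_val.comp continuous_snd)).mul ?_
    fin_cases i
    · exact (continuous_apply j).comp
        (continuous_subtype_val.comp (continuous_fst.comp continuous_fst))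
    · exact (continuous_apply j).comp
        (continuous_subtype_val.comp (continuous_snd.comp continuous_fst))

/-- The simplicial approximation of a singular simplex of the standard simplex: the affine simplex
on the labels of its vertices. -/
def labelSimplex {m n : ℕ} (σ : SingSimplex (StdSimplex n) m) : SingSimplex (StdSimplex n) m :=
  affineSimplex (fun i => vertices n (label (σ (vertices m i))))

theorem labelSimplex_face {m n : ℕ} (i : Fin (m + 2)) (σ : SingSimplex (StdSimplex n) (m + 1)) :
    labelSimplex (face i σ) = face i (labelSimplex σ) := by
  rw [face_eq i (labelSimplex σ), labelSimplex, labelSimplex, AffineSimplices.affineSimplex_face]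
  congr 1
  funext k
  simp only [Function.comp_apply]
  rw [← Function.comp_apply (f := vertices (m + 1)), ← faceInclusion_vertices]
  rfl

/-- The straight-line homotopy from a singular simplex to its simplicial approximation. -/
def labelHomotopy {n : ℕ} (m : ℕ) (σ : SingSimplex (StdSimplex n) m) :
    C(StdSimplex m × StdSimplex 1, StdSimplex n) :=
  (lineSimplex n).comp ((σ.prodMk (labelSimplex σ)).prodMap (ContinuousMap.id _))

theorem labelHomotopy_end {m n : ℕ} (σ : SingSimplex (StdSimplex n) m) (i : Fin 2) :
    (labelHomotopy m σ).comp (cylinderEnd _ i) = ![σ, labelSimplex σ] i := by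
  ext1 x
  refine (affineSimplex_apply_vertices ![σ x, labelSimplex σ x] i).trans ?_
  fin_cases i <;> rfl

theorem labelHomotopy_face {n : ℕ} (m : ℕ) (i : Fin (m + 2))
    (σ : SingSimplex (StdSimplex n) (m + 1)) :
    labelHomotopy m (face i σ) =
      (labelHomotopy (m + 1) σ).comp ((faceInclusion i).prodMap (ContinuousMap.id _)) := by
  simp only [labelHomotopy, labelSimplex_face]
  rfl

theorem labelHomotopy_mem_boundarySimplices {m n : ℕ} {σ : SingSimplex (StdSimplex n) m}
    (hσ : σ ∈ simplicesIn (boundarySimplices n) m)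
    (hsmall : ∀ x y, dist (σ x) (σ y) < 1 / ((n : ℝ) + 1)) (p : StdSimplex m × StdSimplex 1) :
    labelHomotopy m σ p ∈ boundarySimplices n := by
  obtain ⟨x, s⟩ := p
  obtain ⟨j, hj⟩ := mem_simplicesIn.1 hσ x
  have hlabel : ∀ y, label (σ y) ≠ j := fun y => by
    refine label_ne_of_apply_lt (lt_of_le_of_lt ?_ (hsmall y x))
    calc (σ y) j ≤ |(σ y) j - (σ x) j| := by rw [hj, sub_zero]; exact le_abs_self _
      _ ≤ dist (σ y) (σ x) := dist_le_pi_dist (σ y).1 (σ x).1 j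
  have hlabelSimplex : labelSimplex σ x j = 0 := by
    rw [labelSimplex, affineSimplex_apply]
    exact Finset.sum_eq_zero fun i _ => by rw [vertices_apply, if_neg (hlabel _), mul_zero]
  refine ⟨j, ?_⟩
  change affineSimplex ![σ x, labelSimplex σ x] s j = 0
  rw [affineSimplex_apply, Fin.sum_univ_two]
  simp [hj, hlabelSimplex]

theorem endChain_labelHomotopy_mem_relSpan {n : ℕ} (c : IntChain (StdSimplex n) n) :
    endChain labelHomotopy 1 n c ∈ relSpan (boundarySimplices n) {ContinuousMap.id _} := by
  refine map_mem_of_mem_supported _ _ (fun σ _ => ?_) (mem_supportedOn_univ c)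
  rw [endChain_ofSimplex, labelHomotopy_end]
  exact affineSimplex_vertices_comp_mem_relSpan (fun i => label (σ (vertices n i)))

theorem stdSimplex_cycle_mem_relSpan {n : ℕ} {c : IntChain (StdSimplex (n + 1)) (n + 1)}
    (hc : singBdryInt _ n c ∈ supportedOn (simplicesIn (boundarySimplices (n + 1)) n)) :
    c ∈ relSpan (boundarySimplices (n + 1)) {ContinuousMap.id (StdSimplex (n + 1))} := by
  set r : ℝ := 1 / (((n + 1 : ℕ) : ℝ) + 1)
  have hrpos : 0 < r := by positivity
  let U : StdSimplex (n + 1) → Set (StdSimplex (n + 1)) := fun x => Metric.ball x (r / 2)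
  obtain ⟨k, hk⟩ := exists_subdiv_mem_supportedOn_subordinate (U := U)
    (fun x => Metric.isOpen_ball) (fun y => ⟨y, Metric.mem_ball_self (half_pos hrpos)⟩) c
  have hsmall := hk k le_rfl
  have hbdry : singBdryInt _ n (subdiv _ k (n + 1) c) ∈
      supportedOn (simplicesIn (boundarySimplices (n + 1)) n ∩ subordinateSimplices U n) := by
    rw [supportedOn, Finsupp.supported_inter]
    refine ⟨?_, singBdryInt_mem_supportedOn (fun σ hσ => face_mem_subordinateSimplices hσ) hsmall⟩
    rw [singBdryInt_subdiv]
    exact subdiv_mem_supportedOn k hc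
  refine mem_relSpan_of_subdiv hc k (mem_relSpan_of_endChain labelHomotopy labelHomotopy_face
    (fun m σ => (labelHomotopy_end σ 0).trans rfl) hbdry ?_ (endChain_labelHomotopy_mem_relSpan _))
  rintro σ ⟨hσ, z, hz⟩
  refine labelHomotopy_mem_boundarySimplices hσ fun x y => ?_
  calc dist (σ x) (σ y) ≤ dist (σ x) z + dist (σ y) z := dist_triangle_right _ _ _
    _ < r / 2 + r / 2 := add_lt_add (hz x) (hz y)
    _ = r := add_halves r

end SimplexCycles

/-! ### Collapsing a collar of the boundary of the simplex -/

section Collapse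

/-- The smallest barycentric coordinate, measuring the distance to the boundary of the simplex. -/
def minCoord {n : ℕ} (x : StdSimplex n) : ℝ := Finset.univ.inf' Finset.univ_nonempty (fun i => x i)

theorem minCoord_le {n : ℕ} (x : StdSimplex n) (i : Fin (n + 1)) : minCoord x ≤ x i :=
  Finset.inf'_le _ (Finset.mem_univ i)

theorem minCoord_nonneg {n : ℕ} (x : StdSimplex n) : 0 ≤ minCoord x :=
  Finset.le_inf' _ _ fun i _ => stdSimplex.zero_le x i

theorem exists_minCoord_eq {n : ℕ} (x : StdSimplex n) : ∃ i, minCoord x = x i := by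
  obtain ⟨i, -, hi⟩ := Finset.exists_mem_eq_inf' Finset.univ_nonempty (fun i => x i)
  exact ⟨i, hi⟩

theorem continuous_coord {n : ℕ} (i : Fin (n + 1)) : Continuous fun x : StdSimplex n => x i :=
  (continuous_apply i).comp continuous_subtype_val

theorem continuous_minCoord (n : ℕ) : Continuous (minCoord (n := n)) :=
  Continuous.finset_inf'_apply _ fun i _ => continuous_coord i

/-- The size of the collar of the boundary of the `n`-simplex. It is below the minimal coordinate
`1 / (n + 1)` of the barycenter, so that the collar does not exhaust the simplex. -/
def collar (n : ℕ) : ℝ := 1 / (2 * (n + 1))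

theorem collar_pos (n : ℕ) : 0 < collar n := by
  unfold collar
  positivity

/-- The amount subtracted from all coordinates by the collapse of the collar at time `p.2`. -/
def collapseShift {n : ℕ} (p : StdSimplex n × StdSimplex 1) :
    ℝ := p.2 1 * min (collar n) (minCoord p.1)

theorem collapseShift_le {n : ℕ} (p : StdSimplex n × StdSimplex 1) :
    collapseShift p ≤ min (collar n) (minCoord p.1) :=
  mul_le_of_le_one_left (le_min (collar_pos n).le (minCoord_nonneg _)) (stdSimplex.le_one _ _)

theorem collapse_denom_pos {n : ℕ} (p : StdSimplex n × StdSimplex 1) :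
    0 < 1 - (n + 1) * collapseShift p := by
  have hshift := (collapseShift_le p).trans (min_le_left _ _)
  have hcollar : ((n : ℝ) + 1) * collar n = 1 / 2 := by
    unfold collar
    field_simp
  have hle : ((n : ℝ) + 1) * collapseShift p ≤ (n + 1) * collar n := by gcongr
  linarith

/-- The homotopy of the standard simplex, relative to the boundary, that collapses a collar of the
boundary: coordinates are lowered by `collapseShift` and renormalized. -/
def collapse (n : ℕ) : C(StdSimplex n × StdSimplex 1, StdSimplex n) where
  toFun p := ⟨fun i => (p.1 i - collapseShift p) / (1 - (n + 1) * collapseShift p), by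
    refine ⟨fun i => div_nonneg ?_ (collapse_denom_pos p).le, ?_⟩
    · have := (collapseShift_le p).trans (min_le_right _ _)
      linarith [minCoord_le p.1 i]
    · rw [← Finset.sum_div, Finset.sum_sub_distrib, stdSimplex.sum_eq_one, Finset.sum_const,
        Finset.card_univ, Fintype.card_fin, nsmul_eq_mul]
      push_cast
      exact div_self (collapse_denom_pos p).ne'⟩
  continuous_toFun := by
    have hs : Continuous (collapseShift (n := n)) :=
      ((continuous_coord 1).comp continuous_snd).mul
        (continuous_const.min ((continuous_minCoord n).comp continuous_fst))
    refine Continuous.subtype_mk (continuous_pi fun i => ?_) _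
    refine Continuous.div (((continuous_coord i).comp continuous_fst).sub hs)
      (continuous_const.sub (continuous_const.mul hs)) fun p => (collapse_denom_pos p).ne'

theorem collapse_apply {n : ℕ} (p : StdSimplex n × StdSimplex 1) (i : Fin (n + 1)) :
    collapse n p i = (p.1 i - collapseShift p) / (1 - (n + 1) * collapseShift p) := rfl

theorem collapse_eq_fst {n : ℕ} (p : StdSimplex n × StdSimplex 1) (h : collapseShift p = 0) :
    collapse n p = p.1 := by
  ext i
  change collapse n p i = p.1 i
  rw [collapse_apply, h]
  simp

theorem endpoint_apply (i j : Fin 2) : endpoint i j = if i = j then 1 else 0 := vertices_apply i j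

theorem collapse_zero {n : ℕ} (x : StdSimplex n) : collapse n (x, endpoint 0) = x :=
  collapse_eq_fst _ (by simp [collapseShift, endpoint_apply])

theorem collapse_of_mem_boundary {n : ℕ} {x : StdSimplex n} (h : x ∈ boundarySimplices n)
    (s : StdSimplex 1) : collapse n (x, s) = x := by
  obtain ⟨i, hi⟩ := h
  have h0 : minCoord x = 0 := le_antisymm (hi ▸ minCoord_le x i) (minCoord_nonneg x)
  exact collapse_eq_fst _ (by simp [collapseShift, h0, (collar_pos n).le])

/-- The closed set of points of the standard simplex outside the collar. -/
def coreSimplex (n : ℕ) : Set (StdSimplex n) := {x | ∀ i, collar n ≤ x i}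

theorem collapse_one_mem_boundary {n : ℕ} {x : StdSimplex n} (h : x ∉ coreSimplex n) :
    collapse n (x, endpoint 1) ∈ boundarySimplices n := by
  obtain ⟨i, hi⟩ : ∃ i, x i < collar n := by simpa [coreSimplex] using h
  obtain ⟨j, hj⟩ := exists_minCoord_eq x
  refine ⟨j, ?_⟩
  have : collapseShift (x, endpoint 1) = x j := by
    rw [← hj]
    simp [collapseShift, endpoint_apply, ((minCoord_le x i).trans hi.le)]
  rw [collapse_apply, this]
  simp

theorem isClosed_coreSimplex (n : ℕ) : IsClosed (coreSimplex n) := by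
  simp only [coreSimplex, ofPred_forall]
  exact isClosed_iInter fun i => isClosed_le continuous_const (continuous_coord i)

end Collapse

/-! ### Relative cells -/

section RelativeCells

variable {B : Type*} [TopologicalSpace B] {J : Type*}

/-- The interior of the standard simplex. -/
def openSimplex (n : ℕ) : Set (StdSimplex n) := {x | ∀ i, 0 < x i}

theorem mem_boundarySimplices_of_notMem_openSimplex {n : ℕ} {x : StdSimplex n}
    (h : x ∉ openSimplex n) : x ∈ boundarySimplices n := by
  obtain ⟨i, hi⟩ : ∃ i, x i ≤ 0 := by simpa [openSimplex] using h
  exact ⟨i, le_antisymm hi (stdSimplex.zero_le x i)⟩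

theorem coreSimplex_subset_openSimplex (n : ℕ) : coreSimplex n ⊆ openSimplex n :=
  fun _ h i => (collar_pos n).trans_le (h i)

/-- The open set of points of the standard simplex outside the closed collar: the interior of
`coreSimplex n`. -/
def openCore (n : ℕ) : Set (StdSimplex n) := {x | ∀ i, collar n < x i}

theorem isOpen_openCore (n : ℕ) : IsOpen (openCore n) := by
  simp only [openCore, ofPred_forall]
  exact isOpen_iInter_of_finite fun i => isOpen_lt continuous_const (continuous_coord i)

theorem openCore_subset_openSimplex (n : ℕ) : openCore n ⊆ openSimplex n :=
  fun _ h i => (collar_pos n).trans (h i)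

/-- The degree cochain of a labelling `l` of the points of a space by integral vectors: its value on
a singular simplex is the determinant of the labels of the vertices. -/
def cellDegree {n : ℕ} (l : B → Fin (n + 1) → ℤ) : IntChain B n →ₗ[ℤ] ℤ :=
  Finsupp.linearCombination ℤ (fun σ => Matrix.det (Matrix.of fun i => l (σ (vertices n i))))

theorem cellDegree_ofSimplex {n : ℕ} (l : B → Fin (n + 1) → ℤ) (σ : SingSimplex B n) :
    cellDegree l (ofSimplex σ) = Matrix.det (Matrix.of fun i => l (σ (vertices n i))) := by
  simp [cellDegree]

theorem cellDegree_realize {m n : ℕ} (l : B → Fin (n + 1) → ℤ) (g : C(StdSimplex m, B))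
    (c : OrdChain (StdSimplex m) (n + 1)) :
    cellDegree l (realize g n c) = labelDegree (l ∘ g) c := by
  refine apply_eq_of_forall_single (cellDegree l ∘ₗ realize g n) (labelDegree (l ∘ g))
    (fun w => ?_) c
  simp only [LinearMap.comp_apply, realize_ofVertices, cellDegree_ofSimplex, labelDegree_ofVertices,
    ContinuousMap.comp_apply, affineSimplex_apply_vertices, Function.comp_apply]

theorem cellDegree_singBdryInt_ofSimplex {n : ℕ} (l : B → Fin (n + 1) → ℤ)
    (τ : SingSimplex B (n + 1)) :
    cellDegree l (singBdryInt B n (ofSimplex τ)) =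
      ∑ i : Fin (n + 2), (-1 : ℤ) ^ (i : ℕ) * Matrix.det (Matrix.of fun k =>
        l (τ (vertices (n + 1) (i.succAbove k)))) := by
  simp only [singBdryInt_ofSimplex, map_sum, map_smul, cellDegree_ofSimplex, smul_eq_mul, face_eq,
    ContinuousMap.comp_apply]
  refine Finset.sum_congr rfl fun i _ => ?_
  have : ∀ k, faceInclusion i (vertices n k) = vertices (n + 1) (i.succAbove k) :=
    congrFun (faceInclusion_vertices i)
  simp only [this]

/-- The space `B` is obtained from the closed subset `A` by attaching the `n`-cells `φ j`, each of
them parametrized by the standard simplex. -/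
structure RelativeCells (A : Set B) (n : ℕ) (φ : J → C(StdSimplex n, B)) : Prop where
  isClosed : IsClosed A
  locallyFinite : LocallyFinite fun j => range (φ j)
  bdry {j x} : x ∈ boundarySimplices n → φ j x ∈ A
  int {j x} : x ∈ openSimplex n → φ j x ∉ A
  inj {j j' x x'} : x ∈ openSimplex n → φ j x = φ j' x' → j = j' ∧ x = x'
  cover (y) : y ∈ A ∨ ∃ j x, φ j x = y

namespace RelativeCells

variable {A : Set B} {n : ℕ} {φ : J → C(StdSimplex n, B)} (h : RelativeCells A n φ)
include h

variable [T2Space B]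

theorem isClosed_union (S : J → Set (StdSimplex n)) (hS : ∀ j, IsClosed (S j)) :
    IsClosed (A ∪ ⋃ j, φ j '' S j) := by
  refine h.isClosed.union (LocallyFinite.isClosed_iUnion
    (h.locallyFinite.subset fun j => image_subset_range _ _) fun j => ?_)
  exact ((hS j).isCompact.image (φ j).continuous).isClosed

theorem isOpen_cell (j : J) {S : Set (StdSimplex n)} (hS : IsOpen S) (hSi : S ⊆ openSimplex n) :
    IsOpen (φ j '' S) := by
  classical
  have hclosed : IsClosed (A ∪ ⋃ j', φ j' '' if j' = j then Sᶜ else univ) :=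
    h.isClosed_union _ fun j' => by
      split_ifs
      · exact hS.isClosed_compl
      · exact isClosed_univ
  convert hclosed.isOpen_compl
  ext y
  simp only [mem_compl_iff, mem_union, mem_iUnion, not_or, not_exists, mem_image]
  constructor
  · rintro ⟨x, hx, rfl⟩
    refine ⟨h.int (hSi hx), ?_⟩
    rintro j' x' ⟨hx', hxx⟩
    obtain ⟨rfl, rfl⟩ := h.inj (hSi hx) hxx.symm
    rw [if_pos rfl] at hx'
    exact hx' hx
  · rintro ⟨hA, hy⟩
    obtain hA' | ⟨j', x, rfl⟩ := h.cover y
    · exact absurd hA' hA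
    · by_cases hj : j' = j
      · subst hj
        refine ⟨x, ?_, rfl⟩
        by_contra hx
        exact hy j' x ⟨by rwa [if_pos rfl], rfl⟩
      · exact absurd ⟨by rw [if_neg hj]; trivial, rfl⟩ (hy j' x)

end RelativeCells

open Classical in
/-- The labelling of the points of `B` that is `labelVec` on the open core of the cell `φ` and zero
elsewhere. -/
def cellLabel {n : ℕ} (φ : C(StdSimplex n, B)) (y : B) : Fin (n + 1) → ℤ :=
  if h : ∃ x ∈ openCore n, φ x = y then labelVec h.choose else 0

theorem cellLabel_of_notMem {n : ℕ} {φ : C(StdSimplex n, B)} {y : B} (hy : y ∉ φ '' openCore n) :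
    cellLabel φ y = 0 :=
  dif_neg hy

/-- The part of the core of the cell `φ` where the `i`-th barycentric coordinate is at least
`1 / (n + 1)`; it contains all points whose label is `i`. -/
def labelRegion {n : ℕ} (φ : C(StdSimplex n, B)) (i : Fin (n + 1)) : Set B :=
  φ '' (coreSimplex n ∩ {x | 1 / ((n : ℝ) + 1) ≤ x i})

/-- The open core of the cell `φ` together with the complements of the sets `labelRegion φ i`. On a
set of the first kind the labels have coordinate sum one, on one of the second kind their `i`-th
coordinate vanishes. -/
def labelCover {n : ℕ} (φ : C(StdSimplex n, B)) (o : Option (Fin (n + 1))) : Set B :=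
  o.elim (φ '' openCore n) fun i => (labelRegion φ i)ᶜ

namespace RelativeCells

variable {A : Set B} {n : ℕ} {φ : J → C(StdSimplex n, B)} (h : RelativeCells A n φ)
include h

theorem cellLabel_apply {j : J} {x : StdSimplex n} (hx : x ∈ openCore n) :
    cellLabel (φ j) (φ j x) = labelVec x := by
  have hex : ∃ x' ∈ openCore n, φ j x' = φ j x := ⟨x, hx, rfl⟩
  rw [cellLabel, dif_pos hex,
    (h.inj (openCore_subset_openSimplex n hex.choose_spec.1) hex.choose_spec.2).2]

theorem cellLabel_of_mem {j : J} {y : B} (hy : y ∈ A) : cellLabel (φ j) y = 0 := by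
  refine cellLabel_of_notMem ?_
  rintro ⟨x, hx, rfl⟩
  exact h.int (openCore_subset_openSimplex n hx) hy

theorem cellLabel_apply_of_ne {j j' : J} (hj : j' ≠ j) (x : StdSimplex n) :
    cellLabel (φ j) (φ j' x) = 0 := by
  refine cellLabel_of_notMem ?_
  rintro ⟨x', hx', hxx⟩
  exact hj (h.inj (openCore_subset_openSimplex n hx') hxx).1.symm

theorem sum_cellLabel {j : J} {y : B} (hy : y ∈ labelCover (φ j) none) :
    ∑ i, cellLabel (φ j) y i = 1 := by
  obtain ⟨x, hx, rfl⟩ := hy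
  rw [h.cellLabel_apply hx, sum_labelVec]

theorem cellLabel_apply_eq_zero {j : J} {i : Fin (n + 1)} {y : B}
    (hy : y ∈ labelCover (φ j) (some i)) : cellLabel (φ j) y i = 0 := by
  by_cases hcore : y ∈ φ j '' openCore n
  · obtain ⟨x, hx, rfl⟩ := hcore
    rw [h.cellLabel_apply hx]
    refine Pi.single_eq_of_ne (label_ne_of_apply_lt ?_).symm _
    by_contra! hxi
    exact hy ⟨x, ⟨fun q => (hx q).le, hxi⟩, rfl⟩
  · rw [cellLabel_of_notMem hcore, Pi.zero_apply]

theorem isOpen_labelCover [T2Space B] (j : J) (o : Option (Fin (n + 1))) :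
    IsOpen (labelCover (φ j) o) := by
  cases o with
  | none => exact h.isOpen_cell j (isOpen_openCore n) (openCore_subset_openSimplex n)
  | some i =>
    have hclosed : IsClosed (coreSimplex n ∩ {x | 1 / ((n : ℝ) + 1) ≤ x i}) :=
      (isClosed_coreSimplex n).inter (isClosed_le continuous_const (continuous_coord i))
    exact (hclosed.isCompact.image (φ j).continuous).isClosed.isOpen_compl

theorem exists_mem_labelCover (j : J) (y : B) : ∃ o, y ∈ labelCover (φ j) o := by
  by_contra! hy
  have hregion (i) : y ∈ labelRegion (φ j) i := not_notMem.1 (hy (some i))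
  obtain ⟨x, ⟨hx, -⟩, hxy⟩ := hregion 0
  refine hy none ⟨x, fun i => ?_, hxy⟩
  obtain ⟨x', ⟨-, hx'⟩, hxy'⟩ := hregion i
  obtain ⟨-, rfl⟩ := h.inj (coreSimplex_subset_openSimplex n hx) (hxy.trans hxy'.symm)
  exact (one_div_lt_one_div_of_lt (by positivity) (by linarith)).trans_le hx'

theorem cellDegree_singBdryInt_of_subordinate (j : J) {c : IntChain B (n + 1)}
    (hc : c ∈ supportedOn (subordinateSimplices (labelCover (φ j)) (n + 1))) :
    cellDegree (cellLabel (φ j)) (singBdryInt B n c) = 0 := by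
  refine (Submodule.mem_bot ℤ).1 (map_mem_of_mem_supported
    (cellDegree (cellLabel (φ j)) ∘ₗ singBdryInt B n) ⊥ ?_ hc)
  rintro τ ⟨o, ho⟩
  rw [Submodule.mem_bot, LinearMap.comp_apply, cellDegree_singBdryInt_ofSimplex]
  cases o with
  | none =>
    exact sum_neg_one_pow_mul_det_succAbove_eq_zero
      (fun i => cellLabel (φ j) (τ (vertices (n + 1) i))) fun i => h.sum_cellLabel (ho _)
  | some i =>
    refine Finset.sum_eq_zero fun k _ => ?_
    exact mul_eq_zero_of_right _
      (Matrix.det_eq_zero_of_column_eq_zero i fun k => h.cellLabel_apply_eq_zero (ho _))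

theorem cellDegree_of_mem_supportedOn (j : J) {a : IntChain B n}
    (ha : a ∈ supportedOn (simplicesIn A n)) : cellDegree (cellLabel (φ j)) a = 0 := by
  refine (Submodule.mem_bot ℤ).1 (map_mem_of_mem_supported (cellDegree (cellLabel (φ j))) ⊥
    (fun σ hσ => ?_) ha)
  rw [mem_simplicesIn] at hσ
  rw [Submodule.mem_bot, cellDegree_ofSimplex]
  exact Matrix.det_eq_zero_of_column_eq_zero 0 fun i => congrFun (h.cellLabel_of_mem (hσ _)) 0

/-- If the vertices of a small simplex do not all lie in the open core, then one of the coordinates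
is small throughout, and the corresponding columns of both matrices vanish. -/
theorem det_cellLabel_eq_det_labelVec (j : J) {u : Fin (n + 1) → StdSimplex n}
    (hu : ∀ i i', dist (u i) (u i') < collar n) :
    Matrix.det (Matrix.of fun i => cellLabel (φ j) (φ j (u i))) =
      Matrix.det (Matrix.of fun i => labelVec (u i)) := by
  by_cases hcore : ∀ i, u i ∈ openCore n
  · congr 2
    funext i
    exact h.cellLabel_apply (hcore i)
  simp only [openCore, mem_ofPred_eq, not_forall, not_lt] at hcore
  obtain ⟨i, q, hq⟩ := hcore
  have hsmall (i') : u i' q < 1 / ((n : ℝ) + 1) := by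
    have hdist : dist (u i' q) (u i q) < collar n :=
      (dist_le_pi_dist (u i').1 (u i).1 q).trans_lt (hu i' i)
    calc u i' q = (u i' q - u i q) + u i q := (sub_add_cancel _ _).symm
      _ < collar n + collar n := add_lt_add_of_lt_of_le
        ((le_abs_self _).trans_lt ((Real.dist_eq _ _).symm.trans_lt hdist)) hq
      _ = 1 / ((n : ℝ) + 1) := by rw [collar]; field_simp; norm_num
  rw [Matrix.det_eq_zero_of_column_eq_zero q, Matrix.det_eq_zero_of_column_eq_zero q]
  · exact fun i' => Pi.single_eq_of_ne (label_ne_of_apply_lt (hsmall i')).symm _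
  · refine fun i' => h.cellLabel_apply_eq_zero ?_
    rintro ⟨x, ⟨hx, hxq⟩, hxu⟩
    obtain ⟨-, rfl⟩ := h.inj (coreSimplex_subset_openSimplex n hx) hxu
    exact (hsmall i').not_ge hxq

theorem cellDegree_subdiv_self (j : J) {k : ℕ}
    (hk : ordSubdivIter barycenter k (n + 1) (ofVertices (vertices n)) ∈
      Finsupp.supported ℤ ℤ {u | ∀ i i', dist (u i) (u i') < collar n}) :
    cellDegree (cellLabel (φ j)) (subdiv B k n (ofSimplex (φ j))) = 1 := by
  rw [subdiv_ofSimplex, cellDegree_realize, ← labelDegree_ordSubdivIter k n, ← sub_eq_zero,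
    ← LinearMap.sub_apply]
  refine (Submodule.mem_bot ℤ).1 (map_mem_of_mem_supported
    (labelDegree (cellLabel (φ j) ∘ φ j) - labelDegree labelVec) ⊥ (fun u hu => ?_) hk)
  rw [Submodule.mem_bot, LinearMap.sub_apply, labelDegree_ofVertices, labelDegree_ofVertices,
    sub_eq_zero]
  exact h.det_cellLabel_eq_det_labelVec j hu

theorem cellDegree_subdiv_of_ne {j j' : J} (hj : j' ≠ j) (k : ℕ) :
    cellDegree (cellLabel (φ j)) (subdiv B k n (ofSimplex (φ j'))) = 0 := by
  rw [subdiv_ofSimplex, cellDegree_realize,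
    show cellLabel (φ j) ∘ φ j' = fun _ => 0 from funext (h.cellLabel_apply_of_ne hj)]
  refine apply_eq_of_forall_single (labelDegree fun _ => 0) 0 (fun w => ?_) _
  exact (labelDegree_ofVertices _ w).trans
    (Matrix.det_eq_zero_of_column_eq_zero 0 fun _ => rfl)

theorem eq_zero_of_linearCombination_eq_singBdryInt_add [T2Space B] {m : J →₀ ℤ}
    {b : IntChain B (n + 1)} {a : IntChain B n} (ha : a ∈ supportedOn (simplicesIn A n))
    (heq : Finsupp.linearCombination ℤ (fun j => ofSimplex (φ j)) m = singBdryInt B n b + a) :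
    m = 0 := by
  classical
  ext j
  obtain ⟨k₀, hk₀⟩ := exists_subdiv_mem_supportedOn_subordinate (h.isOpen_labelCover j)
    (h.exists_mem_labelCover j) b
  obtain ⟨k₁, hk₁⟩ := exists_ordSubdivIter_mem_supported_pairwise_dist_lt n (collar_pos n)
  let k := max k₀ k₁
  have hcell (j') : cellDegree (cellLabel (φ j)) (subdiv B k n (ofSimplex (φ j'))) =
      if j' = j then 1 else 0 := by
    split_ifs with hj
    · rw [hj]
      exact h.cellDegree_subdiv_self j (hk₁ k (le_max_right _ _))
    · exact h.cellDegree_subdiv_of_ne hj k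
  have hdegree := congrArg (fun c => cellDegree (cellLabel (φ j)) (subdiv B k n c)) heq
  simp only [map_add, ← singBdryInt_subdiv,
    h.cellDegree_singBdryInt_of_subordinate j (hk₀ k (le_max_left _ _)),
    h.cellDegree_of_mem_supportedOn j (subdiv_mem_supportedOn k ha), add_zero] at hdegree
  rw [Finsupp.linearCombination_apply, Finsupp.sum, map_sum, map_sum] at hdegree
  simp only [map_smul, hcell, smul_eq_mul, mul_ite, mul_one, mul_zero, Finset.sum_ite_eq',
    Finsupp.mem_support_iff, ite_not] at hdegree
  simpa using hdegree

end RelativeCells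

end RelativeCells

/-! ### Relative cells span the relative cycles -/

section RelativeCellsSpan

theorem continuousOn_range_of_continuous_comp {X Y Z : Type*} [TopologicalSpace X] [CompactSpace X]
    [TopologicalSpace Y] [T2Space Y] [TopologicalSpace Z] {g : X → Y} (hg : Continuous g)
    {R : Y → Z} (hR : Continuous (R ∘ g)) : ContinuousOn R (range g) := by
  rw [continuousOn_iff_isClosed]
  refine fun t ht => ⟨g '' ((R ∘ g) ⁻¹' t), ((ht.preimage hR).isCompact.image hg).isClosed, ?_⟩
  ext y
  constructor
  · rintro ⟨hy, x, rfl⟩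
    exact ⟨⟨x, hy, rfl⟩, x, rfl⟩
  · rintro ⟨⟨x, hx, rfl⟩, hy⟩
    exact ⟨hx, hy⟩

theorem isOpen_openSimplex (n : ℕ) : IsOpen (openSimplex n) := by
  simp only [openSimplex, ofPred_forall]
  exact isOpen_iInter_of_finite fun i => isOpen_lt continuous_const (continuous_coord i)

variable {B : Type*} [TopologicalSpace B] {J : Type*}

namespace RelativeCells

variable {A : Set B} {n : ℕ} {φ : J → C(StdSimplex n, B)}

open Classical in
/-- The homotopy of `B` that collapses the collars of all cells `φ j` and is constant elsewhere. -/
def collapseCells (φ : J → C(StdSimplex n, B)) (p : B × StdSimplex 1) : B :=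
  if h : ∃ q : J × StdSimplex n, q.2 ∈ openSimplex n ∧ φ q.1 q.2 = p.1 then
    φ h.choose.1 (collapse n (h.choose.2, p.2)) else p.1

theorem collapseCells_of_mem (h : RelativeCells A n φ) {y : B} (hy : y ∈ A) (s : StdSimplex 1) :
    collapseCells φ (y, s) = y := by
  refine dif_neg ?_
  rintro ⟨q, hq, rfl⟩
  exact h.int hq hy

theorem collapseCells_apply (h : RelativeCells A n φ) (j : J) (x : StdSimplex n)
    (s : StdSimplex 1) : collapseCells φ (φ j x, s) = φ j (collapse n (x, s)) := by
  by_cases hx : x ∈ openSimplex n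
  · have hex : ∃ q : J × StdSimplex n, q.2 ∈ openSimplex n ∧ φ q.1 q.2 = φ j x := ⟨(j, x), hx, rfl⟩
    refine (dif_pos hex).trans ?_
    obtain ⟨hj, hx'⟩ := h.inj hex.choose_spec.1 hex.choose_spec.2
    rw [hj, hx']
  · have hx' := mem_boundarySimplices_of_notMem_openSimplex hx
    rw [h.collapseCells_of_mem (h.bdry hx'), collapse_of_mem_boundary hx']

theorem collapseCells_zero (h : RelativeCells A n φ) (y : B) :
    collapseCells φ (y, endpoint 0) = y := by
  obtain hy | ⟨j, x, rfl⟩ := h.cover y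
  · exact h.collapseCells_of_mem hy _
  · rw [h.collapseCells_apply, collapse_zero]

/-- The singular simplex `σ` lies in the open cell `φ q.1`, where it is the image of `q.2`. -/
def InCell (φ : J → C(StdSimplex n, B)) {m : ℕ} (σ : SingSimplex B m)
    (q : J × SingSimplex (StdSimplex n) m) : Prop :=
  (∀ x, q.2 x ∈ openSimplex n) ∧ (φ q.1).comp q.2 = σ

theorem InCell.eq_of_inCell (h : RelativeCells A n φ) {m : ℕ} {σ : SingSimplex B m}
    {q q' : J × SingSimplex (StdSimplex n) m} (hq : InCell φ σ q) (hq' : InCell φ σ q') :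
    q = q' := by
  have hinj (x) := h.inj (hq.1 x) (DFunLike.congr_fun (hq.2.trans hq'.2.symm) x)
  exact Prod.ext (hinj (vertices m 0)).1 (ContinuousMap.ext fun x => (hinj x).2)

theorem InCell.face {m : ℕ} {σ : SingSimplex B (m + 1)} {q : J × SingSimplex (StdSimplex n) (m + 1)}
    (hq : InCell φ σ q) (i : Fin (m + 2)) :
    InCell φ (face i σ) (q.1, AbCover.face i q.2) :=
  ⟨fun x => hq.1 _, by rw [← hq.2]; rfl⟩

open Classical in
/-- The part of a chain that lies in the open cells, pulled back to the standard simplex. -/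
def cellPart (φ : J → C(StdSimplex n, B)) (m : ℕ) :
    IntChain B m →ₗ[ℤ] J →₀ IntChain (StdSimplex n) m :=
  Finsupp.linearCombination ℤ (fun σ =>
    if h : ∃ q, InCell φ σ q then Finsupp.single h.choose.1 (ofSimplex h.choose.2) else 0)

theorem cellPart_of_inCell (h : RelativeCells A n φ) {m : ℕ} {σ : SingSimplex B m}
    {q : J × SingSimplex (StdSimplex n) m} (hq : InCell φ σ q) :
    cellPart φ m (ofSimplex σ) = Finsupp.single q.1 (ofSimplex q.2) := by
  have hex : ∃ q, InCell φ σ q := ⟨q, hq⟩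
  rw [cellPart, Finsupp.linearCombination_single, one_smul, dif_pos hex,
    InCell.eq_of_inCell h hex.choose_spec hq]

theorem cellPart_of_forall_not_inCell {m : ℕ} {σ : SingSimplex B m} (hσ : ∀ q, ¬ InCell φ σ q) :
    cellPart φ m (ofSimplex σ) = 0 := by
  rw [cellPart, Finsupp.linearCombination_single, one_smul, dif_neg (not_exists.2 hσ)]

theorem cellPart_of_mem_supportedOn (h : RelativeCells A n φ) {m : ℕ} {c : IntChain B m}
    (hc : c ∈ supportedOn (simplicesIn A m)) : cellPart φ m c = 0 := by
  refine (Submodule.mem_bot ℤ).1 (map_mem_of_mem_supported (cellPart φ m) ⊥ (fun σ hσ =>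
    (Submodule.mem_bot ℤ).2 (cellPart_of_forall_not_inCell ?_)) hc)
  rintro q ⟨hq, rfl⟩
  exact h.int (hq (vertices m 0)) (mem_simplicesIn.1 hσ (vertices m 0))

/-- The chain of `B` with prescribed parts in the cells, given as chains of the standard simplex. -/
def cellSum (φ : J → C(StdSimplex n, B)) (m : ℕ) :
    (J →₀ IntChain (StdSimplex n) m) →ₗ[ℤ] IntChain B m :=
  Finsupp.lsum ℤ fun j => mapChain (φ j) m

/-- The open cover of `B` by the open cells and the complement of the union of their cores. -/
def cellCover (φ : J → C(StdSimplex n, B)) (o : Option J) : Set B :=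
  o.elim (⋃ j, φ j '' coreSimplex n)ᶜ fun j => φ j '' openSimplex n

theorem exists_mem_cellCover (φ : J → C(StdSimplex n, B)) (y : B) : ∃ o, y ∈ cellCover φ o := by
  by_cases hy : ∃ j, y ∈ φ j '' openSimplex n
  · obtain ⟨j, hj⟩ := hy
    exact ⟨some j, hj⟩
  · refine ⟨none, fun hcore => hy ?_⟩
    obtain ⟨j, hj⟩ := mem_iUnion.1 hcore
    exact ⟨j, image_mono (coreSimplex_subset_openSimplex n) hj⟩

theorem mem_relSpan_range_zero {φ : J → C(StdSimplex 0, B)} (h : RelativeCells A 0 φ)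
    (c : IntChain B 0) : c ∈ relSpan A (range φ) := by
  have hpoint : Subsingleton (StdSimplex 0) := inferInstanceAs (Subsingleton (stdSimplex ℝ (Fin 1)))
  refine map_mem_of_mem_supported LinearMap.id _ (fun σ _ => ?_) (mem_supportedOn_univ c)
  rw [LinearMap.id_apply]
  obtain hA | ⟨j, x, hx⟩ := h.cover (σ (vertices 0 0))
  · refine mem_relSpan_of_mem_supportedOn (ofSimplex_mem_supportedOn (mem_simplicesIn.2 fun x =>
      ?_))
    rwa [Subsingleton.elim x (vertices 0 0)]
  · refine ofSimplex_mem_relSpan ⟨j, ContinuousMap.ext fun y => ?_⟩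
    rw [Subsingleton.elim y x, hx, Subsingleton.elim x (vertices 0 0)]

theorem cellPart_apply_mem_supportedOn (h : RelativeCells A n φ) {m : ℕ} {σ : SingSimplex B m}
    (hσ : σ ∈ simplicesIn (cellCover φ none) m) (j : J) :
    cellPart φ m (ofSimplex σ) j ∈ supportedOn (simplicesIn (coreSimplex n)ᶜ m) := by
  classical
  by_cases hq : ∃ q, InCell φ σ q
  · obtain ⟨q, hq⟩ := hq
    rw [cellPart_of_inCell h hq, Finsupp.single_apply]
    split_ifs
    · refine ofSimplex_mem_supportedOn (mem_simplicesIn.2 fun x hx => ?_)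
      exact mem_simplicesIn.1 hσ x (mem_iUnion.2 ⟨q.1, q.2 x, hx, DFunLike.congr_fun hq.2 x⟩)
    · exact Submodule.zero_mem _
  · rw [cellPart_of_forall_not_inCell (not_exists.1 hq)]
    exact Submodule.zero_mem _

variable [T2Space B]

theorem continuous_collapseCells (h : RelativeCells A n φ) : Continuous (collapseCells φ) := by
  let T : Option J → Set (B × StdSimplex 1) :=
    fun o => o.elim (Prod.fst ⁻¹' A) fun j => Prod.fst ⁻¹' range (φ j)
  have hclosed (o) : IsClosed (T o) := by
    cases o with
    | none => exact h.isClosed.preimage continuous_fst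
    | some j => exact (isCompact_range (φ j).continuous).isClosed.preimage continuous_fst
  have hfinite : LocallyFinite T :=
    locallyFinite_option.2 (h.locallyFinite.preimage_continuous continuous_fst)
  refine hfinite.continuous (eq_univ_of_forall fun p => mem_iUnion.2 ?_) hclosed ?_
  · obtain hp | ⟨j, x, hx⟩ := h.cover p.1
    · exact ⟨none, hp⟩
    · exact ⟨some j, x, hx⟩
  rintro (_ | j)
  · exact continuous_fst.continuousOn.congr fun p hp => h.collapseCells_of_mem hp p.2
  · have hcell : Continuous fun p : StdSimplex n × StdSimplex 1 => (φ j p.1, p.2) :=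
      (φ j).continuous.prodMap continuous_id
    refine (continuousOn_range_of_continuous_comp hcell ?_).mono ?_
    · exact ((φ j).continuous.comp (collapse n).continuous).congr
        fun p => (h.collapseCells_apply j p.1 p.2).symm
    · rintro ⟨_, s⟩ ⟨x, rfl⟩
      exact ⟨(x, s), rfl⟩

/-- `collapseCells` as a continuous map. -/
def collapseHomotopy (h : RelativeCells A n φ) : C(B × StdSimplex 1, B) :=
  ⟨collapseCells φ, h.continuous_collapseCells⟩

/-- The final stage of `collapseCells`; it maps everything outside the cores of the cells to `A`. -/
def collapseEnd (h : RelativeCells A n φ) : C(B, B) := h.collapseHomotopy.comp (cylinderEnd B 1)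

theorem collapseEnd_comp (h : RelativeCells A n φ) (j : J) :
    h.collapseEnd.comp (φ j) = (φ j).comp ((collapse n).comp (cylinderEnd _ 1)) :=
  ContinuousMap.ext fun x => h.collapseCells_apply j x _

theorem exists_comp_eq_of_forall_mem (h : RelativeCells A n φ) {m : ℕ} {j : J}
    {σ : SingSimplex B m} (hσ : ∀ x, σ x ∈ φ j '' openSimplex n) :
    ∃ τ : SingSimplex (StdSimplex n) m, (∀ x, τ x ∈ openSimplex n) ∧ (φ j).comp τ = σ := by
  choose τ hτ hτσ using hσ
  refine ⟨⟨τ, ?_⟩, hτ, ContinuousMap.ext hτσ⟩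
  rw [continuous_iff_isClosed]
  intro t ht
  have hpreimage : τ ⁻¹' t = σ ⁻¹' (φ j '' t) := by
    ext x
    constructor
    · exact fun hx => ⟨τ x, hx, hτσ x⟩
    · rintro ⟨y, hy, hyx⟩
      exact mem_preimage.2 ((h.inj (hτ x) ((hτσ x).trans hyx.symm)).2 ▸ hy)
  rw [hpreimage]
  exact (ht.isCompact.image (φ j).continuous).isClosed.preimage σ.continuous

theorem isOpen_cellCover (h : RelativeCells A n φ) (o : Option J) : IsOpen (cellCover φ o) := by
  cases o with
  | none =>
    refine (LocallyFinite.isClosed_iUnion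
      (h.locallyFinite.subset fun j => image_subset_range _ _) fun j => ?_).isOpen_compl
    exact ((isClosed_coreSimplex n).isCompact.image (φ j).continuous).isClosed
  | some j => exact h.isOpen_cell j (isOpen_openSimplex n) subset_rfl

theorem exists_inCell_or_mem_simplicesIn (h : RelativeCells A n φ) {m : ℕ} {σ : SingSimplex B m}
    (hσ : σ ∈ subordinateSimplices (cellCover φ) m) :
    (∃ q, InCell φ σ q) ∨ σ ∈ simplicesIn (cellCover φ none) m := by
  obtain ⟨_ | j, hσ⟩ := hσ
  · exact Or.inr (mem_simplicesIn.2 hσ)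
  · obtain ⟨τ, hτ, hτσ⟩ := h.exists_comp_eq_of_forall_mem hσ
    exact Or.inl ⟨(j, τ), hτ, hτσ⟩

theorem singBdryInt_cellPart_sub_mem_supportedOn (h : RelativeCells A n φ) (m : ℕ) (j : J)
    {c : IntChain B (m + 1)} (hc : c ∈ supportedOn (subordinateSimplices (cellCover φ) (m + 1))) :
    singBdryInt _ m (cellPart φ (m + 1) c j) - cellPart φ m (singBdryInt B m c) j ∈
      supportedOn (simplicesIn (coreSimplex n)ᶜ m) := by
  classical
  refine map_mem_of_mem_supported (singBdryInt _ m ∘ₗ Finsupp.lapply j ∘ₗ cellPart φ (m + 1) -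
    Finsupp.lapply j ∘ₗ cellPart φ m ∘ₗ singBdryInt B m) _ (fun σ hσ => ?_) hc
  simp only [LinearMap.sub_apply, LinearMap.comp_apply, Finsupp.lapply_apply, singBdryInt_ofSimplex,
    map_sum, map_smul]
  by_cases hq : ∃ q, InCell φ σ q
  · obtain ⟨q, hq⟩ := hq
    have hface (i) : cellPart φ m (ofSimplex (face i σ)) =
        Finsupp.single q.1 (ofSimplex (AbCover.face i q.2)) :=
      cellPart_of_inCell h (hq.face i)
    simp only [cellPart_of_inCell h hq, hface, Finsupp.single_apply]
    split_ifs
    · rw [singBdryInt_ofSimplex, sub_self]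
      exact Submodule.zero_mem _
    · simp
  · have hσ' := (h.exists_inCell_or_mem_simplicesIn hσ).resolve_left hq
    rw [cellPart_of_forall_not_inCell (not_exists.1 hq), Finsupp.coe_zero, Pi.zero_apply, map_zero,
      zero_sub, Submodule.neg_mem_iff]
    exact Submodule.sum_mem _ fun i _ => Submodule.smul_mem _ _ (h.cellPart_apply_mem_supportedOn
      (mem_simplicesIn.2 fun x => mem_simplicesIn.1 hσ' (faceInclusion i x)) j)

theorem sub_cellSum_cellPart_mem_supportedOn (h : RelativeCells A n φ) {m : ℕ} {c : IntChain B m}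
    (hc : c ∈ supportedOn (subordinateSimplices (cellCover φ) m)) :
    c - cellSum φ m (cellPart φ m c) ∈ supportedOn (simplicesIn (cellCover φ none) m) := by
  refine map_mem_of_mem_supported (LinearMap.id - cellSum φ m ∘ₗ cellPart φ m) _ (fun σ hσ => ?_) hc
  rw [LinearMap.sub_apply, LinearMap.comp_apply, LinearMap.id_apply]
  by_cases hq : ∃ q, InCell φ σ q
  · obtain ⟨q, hq⟩ := hq
    rw [cellPart_of_inCell h hq, cellSum, Finsupp.lsum_single, mapChain_ofSimplex, hq.2, sub_self]
    exact Submodule.zero_mem _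
  · rw [cellPart_of_forall_not_inCell (not_exists.1 hq), map_zero, sub_zero]
    exact ofSimplex_mem_supportedOn ((h.exists_inCell_or_mem_simplicesIn hσ).resolve_left hq)

theorem mapChain_collapseEnd_mem_supportedOn (h : RelativeCells A n φ) {m : ℕ} {c : IntChain B m}
    (hc : c ∈ supportedOn (simplicesIn (cellCover φ none) m)) :
    mapChain h.collapseEnd m c ∈ supportedOn (simplicesIn A m) := by
  refine mapChain_mem_supportedOn _ (fun σ hσ => ?_) hc
  rw [mem_simplicesIn] at hσ ⊢
  intro x
  change collapseCells φ (σ x, endpoint 1) ∈ A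
  obtain hA | ⟨j, y, hy⟩ := h.cover (σ x)
  · rwa [h.collapseCells_of_mem hA]
  · rw [← hy, h.collapseCells_apply]
    exact h.bdry (collapse_one_mem_boundary fun hy' => hσ x (mem_iUnion.2 ⟨j, y, hy', hy⟩))

theorem mapChain_collapseEnd_mem_relSpan {φ : J → C(StdSimplex (n + 1), B)}
    (h : RelativeCells A (n + 1) φ) (j : J) {d : IntChain (StdSimplex (n + 1)) (n + 1)}
    (hd : singBdryInt _ n d ∈ supportedOn (simplicesIn (coreSimplex (n + 1))ᶜ n)) :
    mapChain h.collapseEnd (n + 1) (mapChain (φ j) (n + 1) d) ∈ relSpan A (range φ) := by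
  rw [mapChain_mapChain, h.collapseEnd_comp, ← mapChain_mapChain]
  refine mapChain_mem_relSpan (φ j) (fun x hx => h.bdry hx) (fun σ hσ => ?_)
    (stdSimplex_cycle_mem_relSpan ?_)
  · rw [mem_singleton_iff.1 hσ]
    exact ⟨j, rfl⟩
  · rw [singBdryInt_mapChain]
    refine mapChain_mem_supportedOn _ (fun σ hσ => ?_) hd
    rw [mem_simplicesIn] at hσ ⊢
    exact fun x => collapse_one_mem_boundary (hσ x)

theorem mem_relSpan_of_subordinate {φ : J → C(StdSimplex (n + 1), B)}
    (h : RelativeCells A (n + 1) φ) {c : IntChain B (n + 1)}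
    (hsmall : c ∈ supportedOn (subordinateSimplices (cellCover φ) (n + 1)))
    (hc : singBdryInt B n c ∈ supportedOn (simplicesIn A n)) : c ∈ relSpan A (range φ) := by
  let G (m) (σ : SingSimplex B m) : C(StdSimplex m × StdSimplex 1, B) :=
    h.collapseHomotopy.comp (σ.prodMap (ContinuousMap.id _))
  refine mem_relSpan_of_endChain G (fun m i σ => rfl)
    (fun m σ => ContinuousMap.ext fun x => h.collapseCells_zero _) hc (fun σ hσ x => ?_) ?_
  · have hx := mem_simplicesIn.1 hσ x.1
    exact mem_of_eq_of_mem (h.collapseCells_of_mem hx x.2) hx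
  change mapChain h.collapseEnd (n + 1) c ∈ relSpan A (range φ)
  rw [← sub_add_cancel c (cellSum φ (n + 1) (cellPart φ (n + 1) c)), map_add]
  refine Submodule.add_mem _ (mem_relSpan_of_mem_supportedOn
    (h.mapChain_collapseEnd_mem_supportedOn (h.sub_cellSum_cellPart_mem_supportedOn hsmall))) ?_
  rw [cellSum, Finsupp.lsum_apply, Finsupp.sum, map_sum]
  refine Submodule.sum_mem _ fun j _ => h.mapChain_collapseEnd_mem_relSpan j ?_
  have hbdry := h.singBdryInt_cellPart_sub_mem_supportedOn n j hsmall
  rwa [h.cellPart_of_mem_supportedOn hc, Finsupp.coe_zero, Pi.zero_apply, sub_zero] at hbdry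

theorem mem_relSpan_range {φ : J → C(StdSimplex (n + 1), B)} (h : RelativeCells A (n + 1) φ)
    {c : IntChain B (n + 1)} (hc : singBdryInt B n c ∈ supportedOn (simplicesIn A n)) :
    c ∈ relSpan A (range φ) := by
  obtain ⟨k, hk⟩ := exists_subdiv_mem_supportedOn_subordinate h.isOpen_cellCover
    (exists_mem_cellCover φ) c
  refine mem_relSpan_of_subdiv hc k (h.mem_relSpan_of_subordinate (hk k le_rfl) ?_)
  rw [singBdryInt_subdiv]
  exact subdiv_mem_supportedOn k hc

end RelativeCells

end RelativeCellsSpan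

/-! ### Equivariant chains -/

section Equivariant

variable (H : Type w) [CommGroup H] {Y : Type v} [TopologicalSpace Y] [MulAction H Y]
  [ContinuousConstSMul H Y]

/-- The additive group of the module of equivariant singular chains is the group of integral
singular chains, on which the homotopy-theoretic part of the argument takes place. -/
def toIntChain (n : ℕ) : SingChain H Y n ≃+ IntChain Y n :=
  (singRep H Y n).asModuleEquiv.toAddEquiv

theorem toIntChain_singOf {n : ℕ} (σ : SingSimplex Y n) :
    toIntChain H n (singOf H σ) = ofSimplex σ := rfl

theorem toIntChain_singBdry (n : ℕ) (c : SingChain H Y (n + 1)) :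
    toIntChain H n (singBdry H Y n c) = singBdryInt Y n (toIntChain H (n + 1) c) := rfl

theorem singRep_ofSimplex {n : ℕ} (h : H) (σ : SingSimplex Y n) :
    singRep H Y n h (ofSimplex σ) = ofSimplex (h • σ) := by
  simp [singRep]

theorem toIntChain_single_smul {n : ℕ} (h : H) (a : ℤ) (c : SingChain H Y n) :
    toIntChain H n (MonoidAlgebra.single h a • c) = a • singRep H Y n h (toIntChain H n c) := by
  rw [Representation.single_smul]
  change toIntChain H n (a • (toIntChain H n).symm (singRep H Y n h (toIntChain H n c))) = _
  rw [map_zsmul, AddEquiv.apply_symm_apply]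

theorem toIntChain_single_smul_singOf {n : ℕ} (h : H) (a : ℤ) (σ : SingSimplex Y n) :
    toIntChain H n (MonoidAlgebra.single h a • singOf H σ) = a • ofSimplex (h • σ) := by
  rw [toIntChain_single_smul, toIntChain_singOf, singRep_ofSimplex]

/-- A subset of `Y` that is mapped into itself by the action of `H`. -/
def Invariant (S : Set Y) : Prop := ∀ (h : H), ∀ y ∈ S, h • y ∈ S

variable {H}

theorem monoidAlgebra_induction_single {R M : Type*} [Semiring R] {p : MonoidAlgebra R M → Prop}
    (x : MonoidAlgebra R M) (zero : p 0) (add : ∀ x y, p x → p y → p (x + y))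
    (single : ∀ h a, p (MonoidAlgebra.single h a)) : p x := by
  suffices hcoeff : ∀ f : M →₀ R, p (MonoidAlgebra.ofCoeff f) from hcoeff x.coeff
  intro f
  induction f using Finsupp.induction_linear with
  | zero => exact zero
  | add f g hf hg => exact add _ _ hf hg
  | single h a => exact single h a

theorem Invariant.smul_mem_supportedOn {S : Set Y} (hS : Invariant H S) {n : ℕ}
    (r : MonoidAlgebra ℤ H) {c : SingChain H Y n}
    (hc : toIntChain H n c ∈ supportedOn (simplicesIn S n)) :
    toIntChain H n (r • c) ∈ supportedOn (simplicesIn S n) := by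
  induction r using monoidAlgebra_induction_single with
  | zero =>
    rw [zero_smul, map_zero]
    exact Submodule.zero_mem _
  | add x y hx hy =>
    rw [add_smul, map_add]
    exact Submodule.add_mem _ hx hy
  | single h a =>
    rw [toIntChain_single_smul]
    refine Submodule.smul_mem _ _ (map_mem_of_mem_supported (singRep H Y n h) _ (fun σ hσ => ?_) hc)
    rw [singRep_ofSimplex]
    exact ofSimplex_mem_supportedOn
      (mem_simplicesIn.2 fun x => hS h _ (mem_simplicesIn.1 hσ x))

theorem mem_chainsIn {S : Set Y} (hS : Invariant H S) {n : ℕ} {c : SingChain H Y n} :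
    c ∈ chainsIn H S n ↔ toIntChain H n c ∈ supportedOn (simplicesIn S n) := by
  constructor
  · intro hc
    induction hc using Submodule.span_induction with
    | mem x hx =>
      obtain ⟨σ, hσ, rfl⟩ := hx
      exact ofSimplex_mem_supportedOn hσ
    | zero =>
      rw [map_zero]
      exact Submodule.zero_mem _
    | add x y _ _ hx hy =>
      rw [map_add]
      exact Submodule.add_mem _ hx hy
    | smul r x _ hx => exact hS.smul_mem_supportedOn r hx
  · intro hc
    rw [← (toIntChain H n).symm_apply_apply c]
    exact map_mem_of_mem_supported (toIntChain H n).symm.toAddMonoidHom.toIntLinearMap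
      (chainsIn H S n).toAddSubgroup.toIntSubmodule
      (fun σ hσ => (Submodule.subset_span ⟨σ, hσ, rfl⟩ : singOf H σ ∈ chainsIn H S n)) hc

theorem mem_relCycles_succ {S T : Set Y} (hS : Invariant H S) (hT : Invariant H T) {n : ℕ}
    {c : SingChain H Y (n + 1)} : c ∈ relCycles H S T (n + 1) ↔
      toIntChain H (n + 1) c ∈ supportedOn (simplicesIn S (n + 1)) ∧
        singBdryInt Y n (toIntChain H (n + 1) c) ∈ supportedOn (simplicesIn T n) := by
  rw [← mem_chainsIn hS, ← toIntChain_singBdry, ← mem_chainsIn hT]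
  rfl

theorem toIntChain_mem_of_mem_relCycles {S T : Set Y} (hS : Invariant H S) {n : ℕ}
    {c : SingChain H Y n} (hc : c ∈ relCycles H S T n) :
    toIntChain H n c ∈ supportedOn (simplicesIn S n) := by
  cases n with
  | zero => exact (mem_chainsIn hS).1 hc
  | succ n => exact (mem_chainsIn hS).1 hc.1

theorem mem_relBoundaries {S T : Set Y} (hS : Invariant H S) (hT : Invariant H T) {n : ℕ}
    {c : SingChain H Y n} : c ∈ relBoundaries H S T n ↔
      ∃ b ∈ supportedOn (simplicesIn S (n + 1)), ∃ a ∈ supportedOn (simplicesIn T n),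
        toIntChain H n c = singBdryInt Y n b + a := by
  constructor
  · intro hc
    obtain ⟨_, ⟨b, hb, rfl⟩, a, ha, rfl⟩ := Submodule.mem_sup.1 hc
    refine ⟨toIntChain H _ b, (mem_chainsIn hS).1 hb, toIntChain H _ a, (mem_chainsIn hT).1 ha, ?_⟩
    rw [map_add, toIntChain_singBdry]
  · rintro ⟨b, hb, a, ha, hc⟩
    refine Submodule.mem_sup.2 ⟨singBdry H Y n ((toIntChain H _).symm b), ⟨_, ?_, rfl⟩,
      (toIntChain H _).symm a, ?_, ?_⟩
    · exact (mem_chainsIn hS).2 (by rwa [AddEquiv.apply_symm_apply])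
    · exact (mem_chainsIn hT).2 (by rwa [AddEquiv.apply_symm_apply])
    · apply (toIntChain H n).injective
      rw [map_add, toIntChain_singBdry, hc, AddEquiv.apply_symm_apply, AddEquiv.apply_symm_apply]

end Equivariant

section Inclusion

variable {Y : Type v} [TopologicalSpace Y] {S T : Set Y} {n : ℕ}

/-- The inclusion of a subset as a continuous map, along which chains are pushed forward. -/
abbrev inclusionMap (S : Set Y) : C(S, Y) := ⟨Subtype.val, continuous_subtype_val⟩

theorem exists_mapChain_inclusionMap_eq {c : IntChain Y n}
    (hc : c ∈ supportedOn (simplicesIn S n)) : ∃ c', mapChain (inclusionMap S) n c' = c := by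
  refine map_mem_of_mem_supported LinearMap.id (LinearMap.range (mapChain (inclusionMap S) n))
    (fun σ hσ => ?_) hc
  refine ⟨ofSimplex ⟨fun x => ⟨σ x, mem_simplicesIn.1 hσ x⟩, σ.continuous.subtype_mk _⟩, ?_⟩
  rw [mapChain_ofSimplex]
  rfl

theorem mapChain_inclusionMap_injective (S : Set Y) (n : ℕ) :
    Function.Injective (mapChain (inclusionMap S) n) :=
  Finsupp.mapDomain_injective fun _ _ hστ =>
    ContinuousMap.ext fun x => Subtype.ext (DFunLike.congr_fun hστ x)

theorem mem_supportedOn_of_mapChain_inclusionMap (hTS : T ⊆ S) {c : IntChain S n}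
    (hc : mapChain (inclusionMap S) n c ∈ supportedOn (simplicesIn T n)) :
    c ∈ supportedOn (simplicesIn (Subtype.val ⁻¹' T : Set S) n) := by
  suffices hmap : mapChain (inclusionMap S) n c ∈
      (supportedOn (simplicesIn (Subtype.val ⁻¹' T : Set S) n)).map
        (mapChain (inclusionMap S) n) by
    obtain ⟨c', hc', heq⟩ := hmap
    rwa [← mapChain_inclusionMap_injective S n heq]
  refine map_mem_of_mem_supported LinearMap.id _ (fun σ hσ => ?_) hc
  refine ⟨ofSimplex ⟨fun x => ⟨σ x, hTS (mem_simplicesIn.1 hσ x)⟩, σ.continuous.subtype_mk _⟩,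
    ofSimplex_mem_supportedOn (mem_simplicesIn.2 fun x => mem_simplicesIn.1 hσ x), ?_⟩
  rw [mapChain_ofSimplex]
  rfl

end Inclusion

/-! ### Relative homology of equivariant cells -/

section EquivariantHomology

variable {H : Type w} [CommGroup H] {Y : Type v} [TopologicalSpace Y] [MulAction H Y]
  [ContinuousConstSMul H Y] {S T : Set Y} {n : ℕ} {E : Type*} {φ : E → C(StdSimplex n, Y)}

/-- The translate `h • σ` of a simplex in an invariant set `S`, with codomain `S`. -/
def Invariant.translate (hS : Invariant H S) (σ : C(StdSimplex n, Y)) (hσ : ∀ x, σ x ∈ S) (h : H) :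
    C(StdSimplex n, S) :=
  ⟨fun x => ⟨h • σ x, hS h _ (hσ x)⟩, (σ.continuous.const_smul h).subtype_mk _⟩

theorem Invariant.inclusionMap_comp_translate (hS : Invariant H S) (σ : C(StdSimplex n, Y))
    (hσ : ∀ x, σ x ∈ S) (h : H) : (inclusionMap S).comp (hS.translate σ hσ h) = h • σ := rfl

/-- The translates of the simplices `φ e` under the free action of `H` are the characteristic maps
of the `n`-cells of the pair `(S, T)`, each cell being indexed by exactly one `(e, h)`. -/
structure EquivariantCells (H : Type w) [CommGroup H] {Y : Type v} [TopologicalSpace Y]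
    [MulAction H Y] [ContinuousConstSMul H Y] (S T : Set Y) (n : ℕ) {E : Type*}
    (φ : E → C(StdSimplex n, Y)) : Prop where
  invS : Invariant H S
  invT : Invariant H T
  subset : T ⊆ S
  mem (e x) : φ e x ∈ S
  cells : RelativeCells (Subtype.val ⁻¹' T : Set S) n
    fun j : E × H => invS.translate (φ j.1) (mem j.1) j.2

theorem curryLinearEquiv_symm_single_single {α β R : Type*} [Semiring R] (a : α) (b : β) (r : R) :
    (Finsupp.curryLinearEquiv R).symm (Finsupp.single a (Finsupp.single b r)) =
      Finsupp.single (a, b) r := by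
  rw [LinearEquiv.symm_apply_eq]
  ext
  simp [Finsupp.curryLinearEquiv]

theorem toIntChain_sum_smul_singOf (φ : E → C(StdSimplex n, Y)) (f : E →₀ MonoidAlgebra ℤ H) :
    toIntChain H n (f.sum fun e r => r • singOf H (φ e)) =
      Finsupp.linearCombination ℤ (fun j : E × H => ofSimplex (j.2 • φ j.1))
        ((Finsupp.curryLinearEquiv ℤ).symm
          (f.mapRange MonoidAlgebra.coeff MonoidAlgebra.coeff_zero)) := by
  induction f using Finsupp.induction_linear with
  | zero => rw [Finsupp.sum_zero_index, map_zero, Finsupp.mapRange_zero, map_zero, map_zero]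
  | add f g hf hg =>
    rw [Finsupp.sum_add_index' (h := fun e r => r • singOf H (φ e)) (fun _ => zero_smul _ _)
      (fun _ _ _ => add_smul _ _ _), map_add, hf, hg, Finsupp.mapRange_add (fun _ _ => rfl),
      map_add, map_add]
  | single e r =>
    rw [Finsupp.sum_single_index (h := fun e r => r • singOf H (φ e)) (zero_smul _ _),
      Finsupp.mapRange_single]
    induction r using monoidAlgebra_induction_single with
    | zero =>
      rw [zero_smul, map_zero, MonoidAlgebra.coeff_zero, Finsupp.single_zero, map_zero, map_zero]
    | add x y hx hy =>
      rw [add_smul, map_add, hx, hy, MonoidAlgebra.coeff_add, Finsupp.single_add, map_add, map_add]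
    | single h a =>
      rw [toIntChain_single_smul_singOf, MonoidAlgebra.coeff_single,
        curryLinearEquiv_symm_single_single, Finsupp.linearCombination_single]

namespace EquivariantCells

variable (hE : EquivariantCells H S T n φ)
include hE

theorem apply_mem_of_mem_boundarySimplices {e : E} {x : StdSimplex n}
    (hx : x ∈ boundarySimplices n) : φ e x ∈ T := by
  have htranslate : (1 : H) • φ e x ∈ T := hE.cells.bdry (j := (e, 1)) hx
  rwa [one_smul] at htranslate

theorem singOf_mem_relCycles (e : E) : singOf H (φ e) ∈ relCycles H S T n := by
  have hmem : ofSimplex (φ e) ∈ supportedOn (simplicesIn S n) :=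
    ofSimplex_mem_supportedOn (mem_simplicesIn.2 (hE.mem e))
  cases n with
  | zero => exact (mem_chainsIn hE.invS).2 hmem
  | succ n =>
    rw [mem_relCycles_succ hE.invS hE.invT, toIntChain_singOf, singBdryInt_ofSimplex]
    exact ⟨hmem, Submodule.sum_mem _ fun i _ => Submodule.smul_mem _ _ (ofSimplex_mem_supportedOn
      (mem_simplicesIn.2 fun x =>
        hE.apply_mem_of_mem_boundarySimplices ⟨i, faceInclusion_apply_self i x⟩))⟩

/-- The characteristic map `φ e`, as a relative cycle of the pair `(S, T)`. -/
def cellCycle (e : E) : relCycles H S T n := ⟨singOf H (φ e), hE.singOf_mem_relCycles e⟩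

/-- The relative homology class represented by the characteristic map `φ e`. -/
def cellClass (e : E) : RelHomology H S T n := Submodule.Quotient.mk (hE.cellCycle e)

theorem sum_smul_singOf_mem_relBoundaries {f : E →₀ MonoidAlgebra ℤ H}
    (hf : Finsupp.linearCombination (MonoidAlgebra ℤ H) hE.cellClass f = 0) :
    (f.sum fun e r => r • singOf H (φ e)) ∈ relBoundaries H S T n := by
  have hmk : Finsupp.linearCombination (MonoidAlgebra ℤ H) hE.cellClass f =
      Submodule.Quotient.mk (f.sum fun e r => r • hE.cellCycle e) := by
    rw [Finsupp.linearCombination_apply, ← Submodule.mkQ_apply, map_finsuppSum]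
    rfl
  rw [hf, eq_comm, Submodule.Quotient.mk_eq_zero, Submodule.submoduleOf, Submodule.mem_comap,
    map_finsuppSum] at hmk
  exact hmk

theorem symm_mapChain_mem_span {p : IntChain S n}
    (hp : p ∈ supportedOn (range fun j : E × H => hE.invS.translate (φ j.1) (hE.mem j.1) j.2)) :
    (toIntChain H n).symm (mapChain (inclusionMap S) n p) ∈
      (Submodule.span (MonoidAlgebra ℤ H) (range hE.cellCycle)).map
        (relCycles H S T n).subtype := by
  refine map_mem_of_mem_supported
    ((toIntChain H n).symm.toAddMonoidHom.toIntLinearMap ∘ₗ mapChain (inclusionMap S) n)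
    (Submodule.map (relCycles H S T n).subtype _).toAddSubgroup.toIntSubmodule ?_ hp
  rintro _ ⟨⟨e, h⟩, rfl⟩
  refine ⟨MonoidAlgebra.single h 1 • hE.cellCycle e,
    Submodule.smul_mem _ _ (Submodule.subset_span ⟨e, rfl⟩), ?_⟩
  apply (toIntChain H n).injective
  refine (toIntChain_single_smul_singOf H h 1 (φ e)).trans ?_
  rw [one_smul, LinearMap.comp_apply, mapChain_ofSimplex, hE.invS.inclusionMap_comp_translate]
  exact ((toIntChain H n).apply_symm_apply _).symm

theorem mk_eq_mk_of_mapChain_eq {c q : relCycles H S T n} {p a : IntChain S n}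
    {b : IntChain S (n + 1)} (ha : a ∈ supportedOn (simplicesIn (Subtype.val ⁻¹' T : Set S) n))
    (hc : mapChain (inclusionMap S) n (p + (singBdryInt S n b + a)) = toIntChain H n c)
    (hq : mapChain (inclusionMap S) n p = toIntChain H n q) :
    (Submodule.Quotient.mk c : RelHomology H S T n) = Submodule.Quotient.mk q := by
  rw [Submodule.Quotient.eq]
  change (c : SingChain H Y n) - q ∈ relBoundaries H S T n
  rw [mem_relBoundaries hE.invS hE.invT]
  refine ⟨mapChain (inclusionMap S) _ b, ?_, mapChain (inclusionMap S) _ a, ?_, ?_⟩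
  · exact mapChain_mem_supportedOn _ (fun σ _ => mem_simplicesIn.2 fun x => (σ x).2)
      (mem_supportedOn_univ b)
  · exact mapChain_mem_supportedOn _
      (fun σ hσ => mem_simplicesIn.2 fun x => mem_simplicesIn.1 hσ x) ha
  · rw [map_sub, ← hc, ← hq, map_add, map_add, ← singBdryInt_mapChain]
    abel

variable [T2Space Y]

theorem linearIndependent_cellClass : LinearIndependent (MonoidAlgebra ℤ H) hE.cellClass := by
  rw [linearIndependent_iff]
  intro f hf
  obtain ⟨b, hb, a, ha, heq⟩ :=
    (mem_relBoundaries hE.invS hE.invT).1 (hE.sum_smul_singOf_mem_relBoundaries hf)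
  rw [toIntChain_sum_smul_singOf] at heq
  obtain ⟨b, rfl⟩ := exists_mapChain_inclusionMap_eq hb
  obtain ⟨a, rfl⟩ := exists_mapChain_inclusionMap_eq (Finsupp.supported_mono
    (fun σ (hσ : σ ∈ simplicesIn T n) => mem_simplicesIn.2 fun x =>
      hE.subset (mem_simplicesIn.1 hσ x)) ha)
  have hzero := hE.cells.eq_zero_of_linearCombination_eq_singBdryInt_add
    (m := (Finsupp.curryLinearEquiv ℤ).symm
      (f.mapRange MonoidAlgebra.coeff MonoidAlgebra.coeff_zero)) (b := b)
    (mem_supportedOn_of_mapChain_inclusionMap hE.subset ha) <| by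
      apply mapChain_inclusionMap_injective S n
      rw [map_add, ← singBdryInt_mapChain, ← heq, Finsupp.linearCombination_apply,
        Finsupp.linearCombination_apply, map_finsuppSum]
      refine Finsupp.sum_congr fun j _ => ?_
      rw [map_smul, mapChain_ofSimplex, hE.invS.inclusionMap_comp_translate]
  rw [LinearEquiv.map_eq_zero_iff] at hzero
  ext1 e
  have hcoeff := DFunLike.congr_fun hzero e
  rw [Finsupp.mapRange_apply] at hcoeff
  exact MonoidAlgebra.coeff_eq_zero.1 hcoeff

theorem exists_mem_relSpan_of_mem_relCycles {c : SingChain H Y n} (hc : c ∈ relCycles H S T n) :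
    ∃ c' ∈ relSpan (Subtype.val ⁻¹' T : Set S)
        (range fun j : E × H => hE.invS.translate (φ j.1) (hE.mem j.1) j.2),
      mapChain (inclusionMap S) n c' = toIntChain H n c := by
  obtain ⟨c', hc'⟩ :=
    exists_mapChain_inclusionMap_eq (toIntChain_mem_of_mem_relCycles hE.invS hc)
  refine ⟨c', ?_, hc'⟩
  cases n with
  | zero => exact hE.cells.mem_relSpan_range_zero c'
  | succ n =>
    refine hE.cells.mem_relSpan_range (mem_supportedOn_of_mapChain_inclusionMap hE.subset ?_)
    rw [← singBdryInt_mapChain, hc']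
    exact ((mem_relCycles_succ hE.invS hE.invT).1 hc).2

theorem top_le_span_range_cellClass :
    ⊤ ≤ Submodule.span (MonoidAlgebra ℤ H) (range hE.cellClass) := by
  rintro x -
  obtain ⟨c, rfl⟩ := Submodule.Quotient.mk_surjective _ x
  obtain ⟨c', hspan, hc'⟩ := hE.exists_mem_relSpan_of_mem_relCycles c.2
  obtain ⟨p, hp, r, hr, rfl⟩ := Submodule.mem_sup.1 hspan
  obtain ⟨_, ⟨b, rfl⟩, a, ha, rfl⟩ := Submodule.mem_sup.1 hr
  obtain ⟨q, hq, hqp⟩ := hE.symm_mapChain_mem_span hp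
  rw [hE.mk_eq_mk_of_mapChain_eq ha hc' (((toIntChain H n).eq_symm_apply.1 hqp).symm)]
  have hmem := Submodule.mem_map_of_mem
    (f := ((relBoundaries H S T n).submoduleOf (relCycles H S T n)).mkQ) hq
  rwa [Submodule.map_span, ← range_comp] at hmem

/-- The classes of the cells `φ e`, as a basis of the relative homology of `(S, T)` over `ℤ[H]`. -/
def basis : Module.Basis E (MonoidAlgebra ℤ H) (RelHomology H S T n) :=
  Module.Basis.mk hE.linearIndependent_cellClass hE.top_le_span_range_cellClass

theorem basis_apply (e : E) : hE.basis e = hE.cellClass e := Module.Basis.mk_apply _ _ e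

end EquivariantCells

end EquivariantHomology

/-! ### Quotient coverings -/

section QuotientCovering

theorem compl_biUnion_translates {G Y : Type*} [Group G] [MulAction G Y] {K : Set Y}
    (hcover : ∀ y, ∃ g : G, ∃ k ∈ K, g • k = y) {S : Subgroup G}
    (hS : {g : G | ((g • ·) '' K ∩ K).Nonempty} ⊆ S) :
    (⋃ g ∈ (S : Set G), (g • ·) '' K)ᶜ = ⋃ g ∈ (S : Set G)ᶜ, (g • ·) '' K := by
  ext y
  constructor
  · intro hy
    obtain ⟨g, k, hk, rfl⟩ := hcover y
    exact mem_iUnion₂.2 ⟨g, fun hg => hy (mem_iUnion₂.2 ⟨g, hg, k, hk, rfl⟩), k, hk, rfl⟩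
  · intro hy hy'
    obtain ⟨g, hg, k, hk, rfl⟩ := mem_iUnion₂.1 hy
    obtain ⟨a, ha, l, hl, hlk⟩ := mem_iUnion₂.1 hy'
    have hag : a⁻¹ * g ∈ S :=
      hS ⟨l, ⟨k, hk, by simp only [mul_smul, ← hlk, inv_smul_smul]⟩, hl⟩
    exact hg (by simpa using S.mul_mem ha hag)

variable {X : Type u} [TopologicalSpace X] [T2Space X] {Y : Type v} [TopologicalSpace Y]

theorem t2Space_of_isCoveringMap {p : Y → X} (hp : IsCoveringMap p) : T2Space Y := by
  refine ⟨fun y y' hne => ?_⟩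
  by_cases hpy : p y = p y'
  · exact hp.isSeparatedMap y y' hpy hne
  · obtain ⟨U, V, hU, hV, hy, hy', hd⟩ := t2_separation hpy
    exact ⟨p ⁻¹' U, p ⁻¹' V, hU.preimage hp.continuous, hV.preimage hp.continuous, hy, hy',
      hd.preimage p⟩

variable {G : Type w} [Group G] [MulAction G Y] {p : Y → X} (hp : IsQuotientCoveringMap p G)
include hp

theorem exists_nhds_nhds_finite_translates (k y : Y) :
    ∃ V ∈ 𝓝 k, ∃ U ∈ 𝓝 y, {g : G | ((g • ·) '' V ∩ U).Nonempty}.Finite := by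
  have := hp.toContinuousConstSMul
  by_cases hky : p k = p y
  · obtain ⟨a, rfl⟩ := hp.apply_eq_iff_mem_orbit.1 hky
    obtain ⟨W, hW, hd⟩ := hp.disjoint y
    refine ⟨(a⁻¹ • ·) ⁻¹' W, (continuous_const_smul a⁻¹).continuousAt.preimage_mem_nhds ?_, W, hW,
      (finite_singleton a⁻¹).subset ?_⟩
    · simpa using hW
    · rintro g ⟨_, ⟨x, hx, rfl⟩, hxW⟩
      have hga : g * a = 1 := hd _ ⟨g • x, ⟨a⁻¹ • x, hx, by simp [smul_smul]⟩, hxW⟩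
      exact eq_inv_of_mul_eq_one_left hga
  · obtain ⟨U, V, hU, hV, hk, hy, hd⟩ := t2_separation hky
    refine ⟨p ⁻¹' U, (hU.preimage hp.continuous).mem_nhds hk,
      p ⁻¹' V, (hV.preimage hp.continuous).mem_nhds hy, ?_⟩
    convert finite_empty
    rw [eq_empty_iff_forall_notMem]
    rintro g ⟨_, ⟨x, hx, rfl⟩, hxV⟩
    refine disjoint_left.1 hd hx ?_
    have hgx : p (g • x) ∈ V := hxV
    rwa [hp.map_smul] at hgx

theorem exists_nhds_finite_translates_of_isCompact {K : Set Y} (hK : IsCompact K) (y : Y) :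
    ∃ U ∈ 𝓝 y, {g : G | ((g • ·) '' K ∩ U).Nonempty}.Finite := by
  refine hK.induction_on (p := fun K => ∃ U ∈ 𝓝 y, {g : G | ((g • ·) '' K ∩ U).Nonempty}.Finite)
    ⟨univ, Filter.univ_mem, by simp⟩ ?_ ?_ fun k _ => ?_
  · rintro s t hst ⟨U, hU, hf⟩
    exact ⟨U, hU, hf.subset fun g hg => hg.mono (by gcongr)⟩
  · rintro s t ⟨U, hU, hf⟩ ⟨V, hV, hf'⟩
    refine ⟨U ∩ V, Filter.inter_mem hU hV, (hf.union hf').subset ?_⟩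
    rintro g ⟨_, ⟨x, hx | hx, rfl⟩, hxU, hxV⟩
    · exact Or.inl ⟨_, ⟨x, hx, rfl⟩, hxU⟩
    · exact Or.inr ⟨_, ⟨x, hx, rfl⟩, hxV⟩
  · obtain ⟨V, hV, hfinite⟩ := exists_nhds_nhds_finite_translates hp k y
    exact ⟨V, mem_nhdsWithin_of_mem_nhds hV, hfinite⟩

theorem locallyFinite_translates {E : Type*} [Finite E] {K : E → Set Y}
    (hK : ∀ e, IsCompact (K e)) :
    LocallyFinite fun j : E × G => (j.2 • ·) '' K j.1 := by
  intro y
  choose U hU hf using fun e => exists_nhds_finite_translates_of_isCompact hp (hK e) y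
  refine ⟨⋂ e, U e, Filter.iInter_mem.2 hU,
    (finite_iUnion fun e => (hf e).image (Prod.mk e)).subset ?_⟩
  rintro ⟨e, g⟩ ⟨x, hx, hxU⟩
  exact mem_iUnion.2 ⟨e, g, ⟨x, hx, mem_iInter.1 hxU e⟩, rfl⟩

theorem isClosed_biUnion_translates {K : Set Y} (hK : IsCompact K) (S : Set G) :
    IsClosed (⋃ g ∈ S, (g • ·) '' K) := by
  have := t2Space_of_isCoveringMap hp.isCoveringMap
  have := hp.toContinuousConstSMul
  have hlocallyFinite : LocallyFinite fun g : S => ((g : G) • ·) '' K :=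
    (locallyFinite_translates hp (E := Unit) fun _ => hK).comp_injective
      (g := fun g : S => ((), (g : G))) fun a b hab => Subtype.ext (congrArg Prod.snd hab)
  rw [biUnion_eq_iUnion]
  exact hlocallyFinite.isClosed_iUnion fun g => (hK.image (continuous_const_smul _)).isClosed

theorem finite_setOf_translate_inter_nonempty {K : Set Y} (hK : IsCompact K) :
    {g : G | ((g • ·) '' K ∩ K).Nonempty}.Finite := by
  choose U hU hf using exists_nhds_finite_translates_of_isCompact hp hK
  obtain ⟨t, -, ht⟩ := hK.elim_nhds_subcover U fun y _ => hU y
  refine (t.finite_toSet.biUnion fun y _ => hf y).subset ?_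
  rintro g ⟨x, hx, hxK⟩
  obtain ⟨y, hy, hxy⟩ := mem_iUnion₂.1 (ht hxK)
  exact mem_iUnion₂.2 ⟨y, hy, x, hx, hxy⟩

theorem group_fg_of_isCompact_of_translates_cover [PreconnectedSpace Y] [Nonempty Y] {K : Set Y}
    (hK : IsCompact K) (hcover : ∀ y, ∃ g : G, ∃ k ∈ K, g • k = y) : Group.FG G := by
  set S := Subgroup.closure {g : G | ((g • ·) '' K ∩ K).Nonempty} with hS
  refine ⟨(finite_setOf_translate_inter_nonempty hp hK).toFinset, ?_⟩
  rw [Finite.coe_toFinset, ← hS, eq_top_iff]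
  have hcompl := compl_biUnion_translates hcover (S := S) Subgroup.subset_closure
  -- The translates of `K` by `S` and those by the complement of `S` are closed and partition `Y`.
  have hclopen : IsClopen (⋃ g ∈ (S : Set G), (g • ·) '' K) :=
    ⟨isClosed_biUnion_translates hp hK _, by
      rw [← isClosed_compl_iff, hcompl]
      exact isClosed_biUnion_translates hp hK _⟩
  obtain ⟨-, k, hk, -⟩ := hcover (Classical.arbitrary Y)
  have huniv := hclopen.eq_univ ⟨(1 : G) • k, mem_iUnion₂.2 ⟨1, S.one_mem, k, hk, rfl⟩⟩
  rw [← compl_empty_iff, hcompl] at huniv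
  intro g _
  by_contra hg
  exact huniv.subset (mem_iUnion₂.2 ⟨g, hg, k, hk, rfl⟩)

end QuotientCovering

/-! ### Simplices and balls -/

section CornerSimplex

/-- The simplex in `ℝⁿ` with vertices the origin and the standard basis vectors. It is
full-dimensional, unlike the standard simplex in `ℝⁿ⁺¹`. -/
def cornerSimplex (n : ℕ) : Set (Fin n → ℝ) := {y | (∀ i, 0 ≤ y i) ∧ ∑ i, y i ≤ 1}

/-- The interior of `cornerSimplex n`. -/
def openCornerSimplex (n : ℕ) : Set (Fin n → ℝ) := {y | (∀ i, 0 < y i) ∧ ∑ i, y i < 1}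

variable {n : ℕ}

theorem openCornerSimplex_subset (n : ℕ) : openCornerSimplex n ⊆ cornerSimplex n :=
  fun _ hy => ⟨fun i => (hy.1 i).le, hy.2.le⟩

theorem isOpen_openCornerSimplex (n : ℕ) : IsOpen (openCornerSimplex n) := by
  simp only [openCornerSimplex, ofPred_and, ofPred_forall]
  exact (isOpen_iInter_of_finite fun i => isOpen_lt continuous_const (continuous_apply i)).inter
    (isOpen_lt (by fun_prop) continuous_const)

theorem isClosed_cornerSimplex (n : ℕ) : IsClosed (cornerSimplex n) := by
  simp only [cornerSimplex, ofPred_and, ofPred_forall]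
  exact (isClosed_iInter fun i => isClosed_le continuous_const (continuous_apply i)).inter
    (isClosed_le (by fun_prop) continuous_const)

theorem openCornerSimplex_nonempty (n : ℕ) : (openCornerSimplex n).Nonempty := by
  refine ⟨fun _ => 1 / (n + 1 : ℝ), fun _ => by positivity, ?_⟩
  rw [Finset.sum_const, Finset.card_univ, Fintype.card_fin, nsmul_eq_mul, mul_one_div,
    div_lt_one (by positivity)]
  linarith

theorem smul_add_smul_mem_openCornerSimplex {x y : Fin n → ℝ} (hx : x ∈ cornerSimplex n)
    (hy : y ∈ openCornerSimplex n) {t : ℝ} (ht : t ∈ Ioc (0 : ℝ) 1) :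
    (1 - t) • x + t • y ∈ openCornerSimplex n := by
  refine ⟨fun i => ?_, ?_⟩
  · exact add_pos_of_nonneg_of_pos (mul_nonneg (sub_nonneg.2 ht.2) (hx.1 i)) (mul_pos ht.1 (hy.1 i))
  · simp only [Pi.add_apply, Pi.smul_apply, smul_eq_mul, Finset.sum_add_distrib, ← Finset.mul_sum]
    linarith [mul_le_mul_of_nonneg_left hx.2 (sub_nonneg.2 ht.2), mul_lt_mul_of_pos_left hy.2 ht.1]

theorem closure_openCornerSimplex (n : ℕ) : closure (openCornerSimplex n) = cornerSimplex n := by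
  refine Subset.antisymm (closure_minimal (openCornerSimplex_subset n) (isClosed_cornerSimplex n))
    fun x hx => ?_
  obtain ⟨y, hy⟩ := openCornerSimplex_nonempty n
  have hcontinuous : Continuous fun t : ℝ => (1 - t) • x + t • y := by fun_prop
  have htendsto : Filter.Tendsto (fun t : ℝ => (1 - t) • x + t • y) (𝓝[>] 0) (𝓝 x) := by
    simpa using (hcontinuous.tendsto 0).mono_left nhdsWithin_le_nhds
  refine mem_closure_of_tendsto htendsto ?_
  filter_upwards [Ioc_mem_nhdsGT (zero_lt_one' ℝ)] with t ht
  exact smul_add_smul_mem_openCornerSimplex hx hy ht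

theorem convex_openCornerSimplex (n : ℕ) : Convex ℝ (openCornerSimplex n) := by
  rw [convex_iff_forall_pos]
  intro x hx y hy a b ha hb hab
  rw [← sub_eq_of_eq_add hab.symm]
  exact smul_add_smul_mem_openCornerSimplex (openCornerSimplex_subset n hx) hy ⟨hb, by linarith⟩

theorem isBounded_openCornerSimplex (n : ℕ) : Bornology.IsBounded (openCornerSimplex n) := by
  refine (Metric.isBounded_closedBall (x := 0) (r := 1)).subset fun y hy => ?_
  rw [mem_closedBall_zero_iff, pi_norm_le_iff_of_nonneg zero_le_one]
  intro i
  rw [Real.norm_eq_abs, abs_of_pos (hy.1 i)]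
  exact (Finset.single_le_sum (fun j _ => (hy.1 j).le) (Finset.mem_univ i)).trans hy.2.le

theorem exists_homeomorph_image_cornerSimplex (n : ℕ) : ∃ h : (Fin n → ℝ) ≃ₜ (Fin n → ℝ),
    h '' openCornerSimplex n = Metric.ball 0 1 ∧ h '' cornerSimplex n = Metric.closedBall 0 1 ∧
      h '' (cornerSimplex n \ openCornerSimplex n) = Metric.sphere 0 1 := by
  have hopen := isOpen_openCornerSimplex n
  have h := exists_homeomorph_image_interior_closure_frontier_eq_unitBall
    (convex_openCornerSimplex n) (by rw [hopen.interior_eq]; exact openCornerSimplex_nonempty n)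
    (isBounded_openCornerSimplex n)
  rwa [hopen.frontier_eq, hopen.interior_eq, closure_openCornerSimplex] at h

/-- The projection of the standard simplex to the corner simplex that forgets the zeroth barycentric
coordinate. -/
def tailCoords (x : StdSimplex n) : Fin n → ℝ := fun i => x i.succ

theorem continuous_tailCoords : Continuous (tailCoords (n := n)) :=
  continuous_pi fun _ => continuous_coord _

theorem sum_tailCoords (x : StdSimplex n) : ∑ i, tailCoords x i = 1 - x 0 := by
  rw [eq_sub_iff_add_eq', ← stdSimplex.sum_eq_one x, Fin.sum_univ_succ]
  rfl

theorem tailCoords_injective : Function.Injective (tailCoords (n := n)) := by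
  intro x y hxy
  ext i
  refine Fin.cases ?_ (fun i => congrFun hxy i) i
  have hsum := sum_tailCoords x
  rw [hxy, sum_tailCoords y] at hsum
  linarith

theorem tailCoords_mem_cornerSimplex (x : StdSimplex n) : tailCoords x ∈ cornerSimplex n := by
  refine ⟨fun i => x.2.1 _, ?_⟩
  rw [sum_tailCoords]
  linarith [show 0 ≤ x 0 from x.2.1 0]

theorem range_tailCoords : range (tailCoords (n := n)) = cornerSimplex n := by
  refine Subset.antisymm (range_subset_iff.2 tailCoords_mem_cornerSimplex) fun y hy => ?_
  refine ⟨⟨Fin.cons (1 - ∑ i, y i) y, fun i => ?_, ?_⟩, ?_⟩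
  · cases i using Fin.cases with
    | zero => exact sub_nonneg.2 hy.2
    | succ i => exact hy.1 i
  · rw [Fin.sum_univ_succ]
    simp
  · funext i
    exact Fin.cons_succ (α := fun _ => ℝ) (1 - ∑ i, y i) y i

theorem tailCoords_mem_openCornerSimplex {x : StdSimplex n} (hx : x ∈ openSimplex n) :
    tailCoords x ∈ openCornerSimplex n := by
  refine ⟨fun i => hx _, ?_⟩
  rw [sum_tailCoords]
  linarith [hx 0]

theorem tailCoords_notMem_openCornerSimplex {x : StdSimplex n} (hx : x ∈ boundarySimplices n) :
    tailCoords x ∉ openCornerSimplex n := by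
  obtain ⟨i, hi⟩ := hx
  rintro ⟨hpos, hsum⟩
  induction i using Fin.cases with
  | zero =>
    rw [sum_tailCoords, hi] at hsum
    linarith
  | succ i => exact (hpos i).ne' hi

/-- A homeomorphism of the standard simplex onto the closed unit ball of the sup norm, which is the
domain of the characteristic maps of a CW complex. -/
def simplexBall (n : ℕ) (x : StdSimplex n) : Fin n → ℝ :=
  (exists_homeomorph_image_cornerSimplex n).choose (tailCoords x)

theorem continuous_simplexBall (n : ℕ) : Continuous (simplexBall n) :=
  (Homeomorph.continuous _).comp continuous_tailCoords

theorem simplexBall_injective (n : ℕ) : Function.Injective (simplexBall n) :=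
  (Homeomorph.injective _).comp tailCoords_injective

theorem range_simplexBall (n : ℕ) : range (simplexBall n) = Metric.closedBall 0 1 := by
  rw [← (exists_homeomorph_image_cornerSimplex n).choose_spec.2.1]
  exact (range_comp _ tailCoords).trans (congrArg _ range_tailCoords)

theorem simplexBall_mem_ball {x : StdSimplex n} (hx : x ∈ openSimplex n) :
    simplexBall n x ∈ Metric.ball 0 1 := by
  rw [← (exists_homeomorph_image_cornerSimplex n).choose_spec.1]
  exact mem_image_of_mem _ (tailCoords_mem_openCornerSimplex hx)

theorem simplexBall_mem_sphere {x : StdSimplex n} (hx : x ∈ boundarySimplices n) :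
    simplexBall n x ∈ Metric.sphere 0 1 := by
  rw [← (exists_homeomorph_image_cornerSimplex n).choose_spec.2.2]
  exact mem_image_of_mem _ ⟨tailCoords_mem_cornerSimplex x, tailCoords_notMem_openCornerSimplex hx⟩

end CornerSimplex

/-! ### The cells of a covering of a CW complex -/

section CharMap

variable {X : Type u} [TopologicalSpace X] [CWComplex (univ : Set X)] {n : ℕ}

/-- The characteristic map of a cell, as a singular simplex. -/
def charMap (e : RelCWComplex.cell (univ : Set X) n) : C(StdSimplex n, X) where
  toFun x := RelCWComplex.map n e (simplexBall n x)
  continuous_toFun := (RelCWComplex.continuousOn n e).comp_continuous (continuous_simplexBall n)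
    fun x => range_simplexBall n ▸ mem_range_self x

theorem range_charMap (e : RelCWComplex.cell (univ : Set X) n) :
    range (charMap e) = RelCWComplex.closedCell n e := by
  rw [RelCWComplex.closedCell, ← range_simplexBall n, ← range_comp]
  rfl

theorem charMap_mem_openCell (e : RelCWComplex.cell (univ : Set X) n) {x : StdSimplex n}
    (hx : x ∈ openSimplex n) : charMap e x ∈ RelCWComplex.openCell n e :=
  mem_image_of_mem (RelCWComplex.map n e) (simplexBall_mem_ball hx)

theorem exists_charMap_eq (x : X) :
    ∃ (n : ℕ) (e : RelCWComplex.cell (univ : Set X) n), x ∈ range (charMap e) := by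
  have hx : x ∈ ⋃ (n : ℕ) (e : RelCWComplex.cell (univ : Set X) n), RelCWComplex.closedCell n e :=
    (CWComplex.union (C := (univ : Set X))).symm ▸ mem_univ x
  obtain ⟨n, e, he⟩ := mem_iUnion₂.1 hx
  exact ⟨n, e, range_charMap e ▸ he⟩

variable [T2Space X]

theorem charMap_mem_skeletonLT (e : RelCWComplex.cell (univ : Set X) n) {x : StdSimplex n}
    (hx : x ∈ boundarySimplices n) :
    charMap e x ∈ CWComplex.skeletonLT (univ : Set X) (n : ℕ∞) :=
  RelCWComplex.cellFrontier_subset_skeletonLT n e (mem_image_of_mem _ (simplexBall_mem_sphere hx))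

theorem charMap_notMem_skeletonLT (e : RelCWComplex.cell (univ : Set X) n) {x : StdSimplex n}
    (hx : x ∈ openSimplex n) : charMap e x ∉ CWComplex.skeletonLT (univ : Set X) (n : ℕ∞) :=
  fun hmem => disjoint_left.1 (RelCWComplex.disjoint_skeletonLT_openCell le_rfl) hmem
    (charMap_mem_openCell e hx)

theorem charMap_mem_skeletonLT_succ (e : RelCWComplex.cell (univ : Set X) n) (x : StdSimplex n) :
    charMap e x ∈ CWComplex.skeletonLT (univ : Set X) ((n + 1 : ℕ) : ℕ∞) := by
  rw [Nat.cast_add_one]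
  exact RelCWComplex.closedCell_subset_skeletonLT (C := (univ : Set X)) n e
    (range_charMap e ▸ mem_range_self x)

theorem mem_skeletonLT_or_exists_charMap_eq {x : X}
    (hx : x ∈ CWComplex.skeletonLT (univ : Set X) ((n + 1 : ℕ) : ℕ∞)) :
    x ∈ CWComplex.skeletonLT (univ : Set X) (n : ℕ∞) ∨
      ∃ e : RelCWComplex.cell (univ : Set X) n, x ∈ range (charMap e) := by
  rw [← SetLike.mem_coe, Nat.cast_add_one,
    ← RelCWComplex.skeletonLT_union_iUnion_closedCell_eq_skeletonLT_succ] at hx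
  simpa only [mem_union, mem_iUnion, range_charMap, SetLike.mem_coe] using hx

theorem cell_eq_and_eq_of_charMap_eq {e e' : RelCWComplex.cell (univ : Set X) n}
    {x x' : StdSimplex n} (hx : x ∈ openSimplex n) (heq : charMap e x = charMap e' x') :
    e = e' ∧ x = x' := by
  have hx' : x' ∈ openSimplex n := by
    by_contra hx'
    exact charMap_notMem_skeletonLT e hx
      (heq ▸ charMap_mem_skeletonLT e' (mem_boundarySimplices_of_notMem_openSimplex hx'))
  obtain rfl : e = e' := by
    by_contra hne
    exact disjoint_left.1 (RelCWComplex.disjoint_openCell_of_ne (i := e) (j := e') (by simpa))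
      (charMap_mem_openCell e hx) (heq ▸ charMap_mem_openCell e' hx')
  refine ⟨rfl, simplexBall_injective n ((RelCWComplex.map n e).injOn ?_ ?_ heq)⟩ <;>
    rw [RelCWComplex.source_eq]
  · exact simplexBall_mem_ball hx
  · exact simplexBall_mem_ball hx'

end CharMap

theorem invariant_preimage {X : Type u} {Y : Type v} [TopologicalSpace X]
    [TopologicalSpace Y] {H : Type w} [CommGroup H] [MulAction H Y] {p : Y → X}
    (hp : IsQuotientCoveringMap p H) (A : Set X) : Invariant H (p ⁻¹' A) :=
  fun h y hy => by rwa [mem_preimage, hp.map_smul]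

section CWCovering

variable {X : Type u} [TopologicalSpace X] [CWComplex (univ : Set X)] {Y : Type v}
  [TopologicalSpace Y]

theorem exists_lift_charMap {p : Y → X} (hp : IsCoveringMap p) (hsurj : Function.Surjective p)
    {n : ℕ} (e : RelCWComplex.cell (univ : Set X) n) :
    ∃ φ : C(StdSimplex n, Y), ∀ x, p (φ x) = charMap e x := by
  have hconvex := convex_stdSimplex ℝ (Fin (n + 1))
  have : ContractibleSpace (StdSimplex n) := hconvex.contractibleSpace ⟨_, (vertices n 0).2⟩
  have : LocallyPathConnectedSpace (StdSimplex n) := hconvex.locallyPathConnectedSpace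
  obtain ⟨y, hy⟩ := hsurj (charMap e (vertices n 0))
  obtain ⟨φ, ⟨-, hφ⟩, -⟩ := hp.existsUnique_continuousMap_lifts (charMap e) _ y hy
  exact ⟨φ, congrFun hφ⟩

theorem group_fg_of_finite_CWComplex [T2Space X] [CWComplex.Finite (univ : Set X)]
    [PreconnectedSpace Y] [Nonempty Y] {G : Type w} [Group G] [MulAction G Y] {p : Y → X}
    (hp : IsQuotientCoveringMap p G) : Group.FG G := by
  have hfinite : Finite (Σ n, RelCWComplex.cell (univ : Set X) n) :=
    RelCWComplex.finite_cells_of_finite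
  choose φ hφ using fun e : Σ n, RelCWComplex.cell (univ : Set X) n =>
    exists_lift_charMap hp.isCoveringMap hp.surjective e.2
  refine group_fg_of_isCompact_of_translates_cover hp
    (isCompact_iUnion fun e => isCompact_range (φ e).continuous) fun y => ?_
  obtain ⟨n, e, x, hx⟩ := exists_charMap_eq (p y)
  rw [← hφ ⟨n, e⟩] at hx
  obtain ⟨g, hg⟩ := hp.apply_eq_iff_mem_orbit.1 hx.symm
  exact ⟨g, _, mem_iUnion.2 ⟨⟨n, e⟩, mem_range_self x⟩, hg⟩

variable [T2Space X] {H : Type w} [CommGroup H] [MulAction H Y] [ContinuousConstSMul H Y]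
  {p : Y → X} (hp : IsQuotientCoveringMap p H) {n : ℕ}
  {φ : RelCWComplex.cell (univ : Set X) n → C(StdSimplex n, Y)}
  (hφ : ∀ e x, p (φ e x) = charMap e x)

include hφ in
theorem mem_preimage_skeletonLT_succ (e : RelCWComplex.cell (univ : Set X) n) (x : StdSimplex n) :
    φ e x ∈ p ⁻¹' (CWComplex.skeletonLT (univ : Set X) ((n + 1 : ℕ) : ℕ∞)) := by
  rw [mem_preimage, hφ]
  exact charMap_mem_skeletonLT_succ e x

include hp hφ

theorem relativeCells_of_lift [CWComplex.Finite (univ : Set X)] :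
    RelativeCells (Subtype.val ⁻¹' (p ⁻¹' (CWComplex.skeletonLT (univ : Set X) (n : ℕ∞))) :
        Set (p ⁻¹' (CWComplex.skeletonLT (univ : Set X) ((n + 1 : ℕ) : ℕ∞)))) n
      fun j : RelCWComplex.cell (univ : Set X) n × H => (invariant_preimage hp _).translate (φ j.1)
        (mem_preimage_skeletonLT_succ hφ j.1) j.2 where
  isClosed := ((CWComplex.skeletonLT (univ : Set X) (n : ℕ∞)).closed.preimage
    hp.continuous).preimage continuous_subtype_val
  locallyFinite := by
    have : Finite (RelCWComplex.cell (univ : Set X) n) := RelCWComplex.FiniteType.finite_cell n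
    refine ((locallyFinite_translates hp (K := fun e => range (φ e)) fun e =>
      isCompact_range (φ e).continuous).preimage_continuous continuous_subtype_val).subset
        fun j => ?_
    rintro _ ⟨x, rfl⟩
    exact ⟨_, ⟨x, rfl⟩, rfl⟩
  bdry := by
    rintro ⟨e, h⟩ x hx
    change p (h • φ e x) ∈ (CWComplex.skeletonLT (univ : Set X) (n : ℕ∞) : Set X)
    rw [hp.map_smul, hφ]
    exact charMap_mem_skeletonLT e hx
  int := by
    rintro ⟨e, h⟩ x hx hmem
    change p (h • φ e x) ∈ (CWComplex.skeletonLT (univ : Set X) (n : ℕ∞) : Set X) at hmem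
    rw [hp.map_smul, hφ] at hmem
    exact charMap_notMem_skeletonLT e hx hmem
  inj := by
    rintro ⟨e, h⟩ ⟨e', h'⟩ x x' hx heq
    have hsmul : h • φ e x = h' • φ e' x' := congrArg Subtype.val heq
    have hchar := congrArg p hsmul
    rw [hp.map_smul, hp.map_smul, hφ, hφ] at hchar
    obtain ⟨rfl, rfl⟩ := cell_eq_and_eq_of_charMap_eq hx hchar
    have := hp.isCancelSMul
    exact ⟨Prod.ext rfl (IsCancelSMul.right_cancel _ _ _ hsmul), rfl⟩
  cover := by
    rintro ⟨y, hy⟩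
    refine (mem_skeletonLT_or_exists_charMap_eq hy).imp id ?_
    rintro ⟨e, x, hx⟩
    rw [← hφ] at hx
    obtain ⟨h, hh⟩ := hp.apply_eq_iff_mem_orbit.1 hx.symm
    exact ⟨(e, h), x, Subtype.ext hh⟩

theorem equivariantCells_of_lift [CWComplex.Finite (univ : Set X)] :
    EquivariantCells H (p ⁻¹' (CWComplex.skeletonLT (univ : Set X) ((n + 1 : ℕ) : ℕ∞)))
      (p ⁻¹' (CWComplex.skeletonLT (univ : Set X) (n : ℕ∞))) n φ where
  invS := invariant_preimage hp _
  invT := invariant_preimage hp _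
  subset := preimage_mono
    (RelCWComplex.skeletonLT_mono (C := (univ : Set X)) (by exact_mod_cast n.le_succ))
  mem := mem_preimage_skeletonLT_succ hφ
  cells := relativeCells_of_lift hp hφ

end CWCovering

/-! ### Comparison of abelian covers -/

theorem monodromy_symm_monodromy {X Y : Type*} [TopologicalSpace X] [TopologicalSpace Y]
    {p : Y → X} (cov : IsCoveringMap p) {x y : X} (α : Path.Homotopic.Quotient x y)
    (e : p ⁻¹' {x}) : cov.monodromy α.symm (cov.monodromy α e) = e := by
  obtain ⟨a, rfl⟩ := Path.Homotopic.Quotient.mk_surjective α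
  rw [← IsCoveringMap.monodromy_trans_apply, ← Path.Homotopic.Quotient.mk_symm,
    ← Path.Homotopic.Quotient.mk_trans, ← Path.Homotopic.Quotient.eq.2 ⟨.reflTransSymm a⟩,
    Path.Homotopic.Quotient.mk_refl, IsCoveringMap.monodromy_refl]
  rfl

theorem EquivariantCells.relBdry_cellClass_eq_sum_iff {H : Type w} [CommGroup H] {Y : Type v}
    [TopologicalSpace Y] [MulAction H Y] [ContinuousConstSMul H Y] {S T U : Set Y} {n : ℕ}
    {D E : Type*} {φ : D → C(StdSimplex (n + 1), Y)} {ψ : E → C(StdSimplex n, Y)}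
    (hD : EquivariantCells H S T (n + 1) φ) (hE : EquivariantCells H T U n ψ) [Fintype E] (d : D)
    (r : E → MonoidAlgebra ℤ H) :
    relBdry H S T U n (hD.cellClass d) = ∑ i, r i • hE.cellClass i ↔
      singBdry H Y n (singOf H (φ d)) - ∑ i, r i • singOf H (ψ i) ∈ relBoundaries H T U n := by
  have hsum : ∑ i, r i • hE.cellClass i = Submodule.Quotient.mk (∑ i, r i • hE.cellCycle i) := by
    rw [← Submodule.mkQ_apply, map_sum]
    rfl
  have hbdry : relBdry H S T U n (hD.cellClass d) =
      Submodule.Quotient.mk (cycleBdry H S T U n (hD.cellCycle d)) := rfl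
  rw [hsum, hbdry, Submodule.Quotient.eq, Submodule.submoduleOf, Submodule.mem_comap]
  simp [cycleBdry, cellCycle]

section Comparison

variable {X : Type u} [TopologicalSpace X] {x₀ : X}
  {A : Type*} [CommGroup A] {μ : FundamentalGroup X x₀ →* A}
  {Z : Type z} [TopologicalSpace Z] [MulAction A Z] (cZ : AbelianCover x₀ μ Z)
  {H : Type w} [CommGroup H] {ν : FundamentalGroup X x₀ →* H}
  {Y : Type v} [TopologicalSpace Y] [MulAction H Y] (cY : AbelianCover x₀ ν Y)

namespace AbelianCover

section CellBasis

variable [T2Space X] [CWComplex (univ : Set X)] [CWComplex.Finite (univ : Set X)] {n : ℕ}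
  [ContinuousConstSMul H Y]

/-- The basis of the cellular `n`-chains given by lifts `ψ` of the characteristic maps of the
`n`-cells, one for each cell. -/
def cellBasis {ψ : RelCWComplex.cell (univ : Set X) n → C(StdSimplex n, Y)}
    (hψ : ∀ e x, cY.proj (ψ e x) = charMap e x) :
    Module.Basis (RelCWComplex.cell (univ : Set X) n) (MonoidAlgebra ℤ H)
      (RelHomology H (cY.proj ⁻¹' (CWComplex.skeletonLT (univ : Set X) ((n + 1 : ℕ) : ℕ∞)))
        (cY.proj ⁻¹' (CWComplex.skeletonLT (univ : Set X) (n : ℕ∞))) n) :=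
  have := t2Space_of_isCoveringMap cY.isCover.isCoveringMap
  (equivariantCells_of_lift cY.isCover hψ).basis

theorem relBdry_cellBasis_eq_sum_iff [Fintype (RelCWComplex.cell (univ : Set X) n)]
    {ψ : RelCWComplex.cell (univ : Set X) n → C(StdSimplex n, Y)}
    (hψ : ∀ e x, cY.proj (ψ e x) = charMap e x)
    {ψ' : RelCWComplex.cell (univ : Set X) (n + 1) → C(StdSimplex (n + 1), Y)}
    (hψ' : ∀ e x, cY.proj (ψ' e x) = charMap e x) (e : RelCWComplex.cell (univ : Set X) (n + 1))
    (r : RelCWComplex.cell (univ : Set X) n → MonoidAlgebra ℤ H) :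
    relBdry H _ _ _ n (cellBasis cY hψ' e) = ∑ i, r i • cellBasis cY hψ i ↔
      singBdry H Y n (singOf H (ψ' e)) - ∑ i, r i • singOf H (ψ i) ∈ relBoundaries H
        (cY.proj ⁻¹' (CWComplex.skeletonLT (univ : Set X) ((n + 1 : ℕ) : ℕ∞)))
        (cY.proj ⁻¹' (CWComplex.skeletonLT (univ : Set X) (n : ℕ∞))) n := by
  simp only [cellBasis, EquivariantCells.basis_apply]
  exact EquivariantCells.relBdry_cellClass_eq_sum_iff _ _ e r

end CellBasis

/-- The end point of the lift, from the base point, of a path from `x₀`. -/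
abbrev lift {x : X} (α : Path.Homotopic.Quotient x₀ x) : cY.proj ⁻¹' {x} :=
  cY.isCover.isCoveringMap.monodromy α cY.base

theorem exists_lift_eq (y : Y) :
    ∃ α : Path.Homotopic.Quotient x₀ (cY.proj y), cY.lift α = ⟨y, rfl⟩ := by
  have := cY.pathConnected
  obtain ⟨γ⟩ := PathConnectedSpace.joined (cY.base : Y) y
  refine ⟨((Path.Homotopic.Quotient.mk γ).map ⟨cY.proj, cY.isCover.continuous⟩).cast
    (Eq.symm cY.base.2) rfl, ?_⟩
  refine cY.isCover.isCoveringMap.monodromy_eq_of_map_eq (Path.Homotopic.Quotient.mk γ) ?_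
  exact ((Path.Homotopic.Quotient.cast_cast _ _ _ _ _).trans
    (Path.Homotopic.Quotient.cast_rfl_rfl _)).symm

theorem lift_trans_loop (γ : FundamentalGroup X x₀) {x : X} (α : Path.Homotopic.Quotient x₀ x) :
    cY.lift (Path.Homotopic.Quotient.trans γ α) =
      cY.isCover.toPermFiber x (ν γ) (cY.lift α) := by
  have hloop : cY.isCover.isCoveringMap.monodromy γ cY.base =
      cY.isCover.toPermFiber x₀ (ν γ) cY.base := Subtype.ext (cY.monodromy_base γ)
  rw [lift, IsCoveringMap.monodromy_trans_apply, hloop,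
    IsQuotientCoveringMap.monodromy_toPermFiber]

theorem lift_eq_lift_iff {x : X} {α α' : Path.Homotopic.Quotient x₀ x} :
    cY.lift α = cY.lift α' ↔ ν (α.trans α'.symm) = 1 := by
  have hbase : cY.lift α = cY.lift α' ↔
      (cY.isCover.isCoveringMap.monodromy (α.trans α'.symm) cY.base : Y) = cY.base := by
    rw [← (cY.isCover.isCoveringMap.monodromy_bijective α'.symm).1.eq_iff,
      monodromy_symm_monodromy, ← IsCoveringMap.monodromy_trans_apply, Subtype.ext_iff]
  have := cY.isCover.isCancelSMul
  rw [hbase, cY.monodromy_base]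
  exact ⟨fun h => IsCancelSMul.right_cancel _ _ (cY.base : Y) (by rw [h, one_smul]),
    fun h => by rw [h, one_smul]⟩

/-- The map of covers that preserves the base points and the projections to `X`. It sends the end
point of the lift to `Z` of a path from `x₀` to the end point of its lift to `Y`; this does not
depend on the path when `ν` factors through `μ`. -/
def coverMap (x : Z) : Y := cY.lift (cZ.exists_lift_eq x).choose

theorem proj_coverMap (x : Z) : cY.proj (coverMap cZ cY x) = cZ.proj x :=
  (cY.lift (cZ.exists_lift_eq x).choose).2

variable {φ : A →* H} (hφ : ∀ γ, φ (μ γ) = ν γ)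
include hφ

theorem coverMap_eq_lift {x : X} {α : Path.Homotopic.Quotient x₀ x} {y : cZ.proj ⁻¹' {x}}
    (h : cZ.lift α = y) : coverMap cZ cY y = cY.lift α := by
  obtain ⟨y, hy⟩ := y
  obtain rfl : cZ.proj y = x := hy
  have hlift := cZ.lift_eq_lift_iff.1 ((cZ.exists_lift_eq y).choose_spec.trans h.symm)
  refine congrArg Subtype.val (cY.lift_eq_lift_iff.2 ?_)
  rw [← hφ, hlift, map_one]

theorem coverMap_smul (hμ : Function.Surjective μ) (a : A) (x : Z) :
    coverMap cZ cY (a • x) = φ a • coverMap cZ cY x := by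
  obtain ⟨γ, rfl⟩ := hμ a
  obtain ⟨α, hα⟩ := cZ.exists_lift_eq x
  have hγα : cZ.lift (Path.Homotopic.Quotient.trans γ α) =
      cZ.isCover.toPermFiber _ (μ γ) ⟨x, rfl⟩ := by rw [cZ.lift_trans_loop, hα]
  refine (coverMap_eq_lift cZ cY hφ hγα).trans ?_
  rw [hφ, coverMap_eq_lift cZ cY hφ hα, cY.lift_trans_loop]
  rfl

theorem eq_coverMap_of_proj_eq {B : Type*} [TopologicalSpace B] [PathConnectedSpace B]
    (σ : C(B, Z)) (F : C(B, Y)) (hF : ∀ b, cY.proj (F b) = cZ.proj (σ b)) (b₀ b : B)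
    (hb₀ : F b₀ = coverMap cZ cY (σ b₀)) : F b = coverMap cZ cY (σ b) := by
  obtain ⟨δ⟩ := PathConnectedSpace.joined b₀ b
  obtain ⟨α, hα⟩ := cZ.exists_lift_eq (σ b₀)
  set q : C(Z, X) := ⟨cZ.proj, cZ.isCover.continuous⟩
  set β : Path.Homotopic.Quotient (cZ.proj (σ b₀)) (cZ.proj (σ b)) :=
    (Path.Homotopic.Quotient.mk δ).map (q.comp σ) with hβ
  have hβZ : cZ.isCover.isCoveringMap.monodromy β ⟨σ b₀, rfl⟩ = ⟨σ b, rfl⟩ := by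
    rw [hβ, Path.Homotopic.Quotient.map_comp]
    exact cZ.isCover.isCoveringMap.monodromy_map _
  have hβY : cY.isCover.isCoveringMap.monodromy β ⟨F b₀, hF b₀⟩ = ⟨F b, hF b⟩ := by
    refine cY.isCover.isCoveringMap.monodromy_eq_of_map_eq
      ((Path.Homotopic.Quotient.mk δ).map F) (Eq.trans ?_
        (Path.Homotopic.Quotient.mk_cast (δ.map (q.comp σ).continuous) (hF b₀) (hF b)))
    exact congrArg Path.Homotopic.Quotient.mk (Path.ext (funext fun t => hF _))
  have hαβ : cZ.lift (α.trans β) = ⟨σ b, rfl⟩ := by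
    rw [lift, IsCoveringMap.monodromy_trans_apply, ← lift, hα, hβZ]
  have hαY : (⟨F b₀, hF b₀⟩ : cY.proj ⁻¹' {cZ.proj (σ b₀)}) = cY.lift α :=
    Subtype.ext (hb₀.trans (coverMap_eq_lift cZ cY hφ hα))
  rw [coverMap_eq_lift cZ cY hφ hαβ, lift, IsCoveringMap.monodromy_trans_apply, ← lift, ← hαY,
    hβY]

theorem continuous_coverMap_comp {n : ℕ} (σ : C(StdSimplex n, Z)) :
    Continuous fun x => coverMap cZ cY (σ x) := by
  have hconv := convex_stdSimplex ℝ (Fin (n + 1))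
  have : ContractibleSpace (StdSimplex n) := hconv.contractibleSpace ⟨_, (vertices n 0).2⟩
  have : LocallyPathConnectedSpace (StdSimplex n) := hconv.locallyPathConnectedSpace
  obtain ⟨F, ⟨hF₀, hF⟩, -⟩ := cY.isCover.isCoveringMap.existsUnique_continuousMap_lifts
    (⟨fun x => cZ.proj (σ x), cZ.isCover.continuous.comp σ.continuous⟩ : C(StdSimplex n, X))
    (vertices n 0) (coverMap cZ cY (σ (vertices n 0))) (proj_coverMap cZ cY _)
  exact F.continuous.congr fun x =>
    eq_coverMap_of_proj_eq cZ cY hφ σ F (congrFun hF) (vertices n 0) x hF₀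

/-- The image of a singular simplex under the map of covers. -/
def mapSimplex {n : ℕ} (σ : SingSimplex Z n) : SingSimplex Y n :=
  ⟨fun x => coverMap cZ cY (σ x), continuous_coverMap_comp cZ cY hφ σ⟩

theorem proj_mapSimplex {n : ℕ} (σ : SingSimplex Z n) (x : StdSimplex n) :
    cY.proj (mapSimplex cZ cY hφ σ x) = cZ.proj (σ x) := proj_coverMap cZ cY (σ x)

theorem proj_mapSimplex_eq_charMap [CWComplex (univ : Set X)] {n : ℕ}
    {ψ : RelCWComplex.cell (univ : Set X) n → C(StdSimplex n, Z)}
    (hψ : ∀ e x, cZ.proj (ψ e x) = charMap e x) (e : RelCWComplex.cell (univ : Set X) n)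
    (x : StdSimplex n) : cY.proj (mapSimplex cZ cY hφ (ψ e) x) = charMap e x := by
  rw [proj_mapSimplex, hψ]

/-- The map of integral chains induced by the map of covers. -/
def mapIntChain (n : ℕ) : IntChain Z n →ₗ[ℤ] IntChain Y n :=
  Finsupp.lmapDomain ℤ ℤ (mapSimplex cZ cY hφ)

theorem mapIntChain_ofSimplex {n : ℕ} (σ : SingSimplex Z n) :
    mapIntChain cZ cY hφ n (ofSimplex σ) = ofSimplex (mapSimplex cZ cY hφ σ) := by
  simp [mapIntChain]

theorem singBdryInt_mapIntChain (n : ℕ) (c : IntChain Z (n + 1)) :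
    singBdryInt Y n (mapIntChain cZ cY hφ (n + 1) c) =
      mapIntChain cZ cY hφ n (singBdryInt Z n c) := by
  refine apply_eq_of_forall_single (singBdryInt Y n ∘ₗ mapIntChain cZ cY hφ (n + 1))
    (mapIntChain cZ cY hφ n ∘ₗ singBdryInt Z n) (fun σ => ?_) c
  simp only [LinearMap.comp_apply, mapIntChain_ofSimplex, singBdryInt_ofSimplex, map_sum,
    map_smul]
  rfl

theorem mapIntChain_mem_supportedOn {S : Set X} {n : ℕ} {c : IntChain Z n}
    (hc : c ∈ supportedOn (simplicesIn (cZ.proj ⁻¹' S) n)) :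
    mapIntChain cZ cY hφ n c ∈ supportedOn (simplicesIn (cY.proj ⁻¹' S) n) := by
  refine map_mem_of_mem_supported _ _ (fun σ hσ => ?_) hc
  rw [mapIntChain_ofSimplex]
  refine ofSimplex_mem_supportedOn (mem_simplicesIn.2 fun x => ?_)
  rw [mem_preimage, proj_mapSimplex]
  exact mem_simplicesIn.1 hσ x

variable [ContinuousConstSMul A Z] [ContinuousConstSMul H Y]

theorem mapSimplex_smul (hμ : Function.Surjective μ) {n : ℕ} (a : A) (σ : SingSimplex Z n) :
    mapSimplex cZ cY hφ (a • σ) = φ a • mapSimplex cZ cY hφ σ :=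
  ContinuousMap.ext fun x => coverMap_smul cZ cY hφ hμ a (σ x)

/-- The map of equivariant chains induced by the map of covers; it is semilinear along `φ`. -/
def mapSingChain (n : ℕ) : SingChain A Z n →+ SingChain H Y n :=
  ((toIntChain H n).symm.toAddMonoidHom.comp (mapIntChain cZ cY hφ n).toAddMonoidHom).comp
    (toIntChain A n).toAddMonoidHom

theorem toIntChain_mapSingChain (n : ℕ) (c : SingChain A Z n) :
    toIntChain H n (mapSingChain cZ cY hφ n c) = mapIntChain cZ cY hφ n (toIntChain A n c) :=
  (toIntChain H n).apply_symm_apply _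

theorem mapSingChain_singOf {n : ℕ} (σ : SingSimplex Z n) :
    mapSingChain cZ cY hφ n (singOf A σ) = singOf H (mapSimplex cZ cY hφ σ) := by
  apply (toIntChain H n).injective
  rw [toIntChain_mapSingChain, toIntChain_singOf, toIntChain_singOf, mapIntChain_ofSimplex]

theorem singBdry_mapSingChain (n : ℕ) (c : SingChain A Z (n + 1)) :
    singBdry H Y n (mapSingChain cZ cY hφ (n + 1) c) =
      mapSingChain cZ cY hφ n (singBdry A Z n c) := by
  apply (toIntChain H n).injective
  rw [toIntChain_mapSingChain, toIntChain_singBdry, toIntChain_singBdry, toIntChain_mapSingChain,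
    singBdryInt_mapIntChain]

theorem mapSingChain_smul_singOf (hμ : Function.Surjective μ) {n : ℕ} (r : MonoidAlgebra ℤ A)
    (σ : SingSimplex Z n) : mapSingChain cZ cY hφ n (r • singOf A σ) =
      MonoidAlgebra.mapDomainRingHom ℤ φ r • singOf H (mapSimplex cZ cY hφ σ) := by
  induction r using monoidAlgebra_induction_single with
  | zero => rw [zero_smul, map_zero, map_zero, zero_smul]
  | add x y hx hy => rw [add_smul, map_add, hx, hy, map_add, add_smul]
  | single a m =>
    apply (toIntChain H n).injective
    have hsingle : MonoidAlgebra.mapDomainRingHom ℤ φ (MonoidAlgebra.single a m) =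
        MonoidAlgebra.single (φ a) m := MonoidAlgebra.mapDomain_single
    rw [toIntChain_mapSingChain, toIntChain_single_smul_singOf, hsingle,
      toIntChain_single_smul_singOf, map_smul, mapIntChain_ofSimplex,
      mapSimplex_smul cZ cY hφ hμ]

theorem mapSingChain_mem_relBoundaries {S T : Set X} {n : ℕ} {c : SingChain A Z n}
    (hc : c ∈ relBoundaries A (cZ.proj ⁻¹' S) (cZ.proj ⁻¹' T) n) :
    mapSingChain cZ cY hφ n c ∈ relBoundaries H (cY.proj ⁻¹' S) (cY.proj ⁻¹' T) n := by
  rw [mem_relBoundaries (invariant_preimage cZ.isCover S) (invariant_preimage cZ.isCover T)] at hc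
  rw [mem_relBoundaries (invariant_preimage cY.isCover S) (invariant_preimage cY.isCover T),
    toIntChain_mapSingChain]
  obtain ⟨b, hb, a, ha, h⟩ := hc
  exact ⟨_, mapIntChain_mem_supportedOn cZ cY hφ hb, _,
    mapIntChain_mem_supportedOn cZ cY hφ ha, by rw [h, map_add, singBdryInt_mapIntChain]⟩

theorem repr_relBdry_cellBasis_mapSimplex [T2Space X] [CWComplex (univ : Set X)]
    [CWComplex.Finite (univ : Set X)] {n : ℕ} (hμ : Function.Surjective μ)
    {ψ : RelCWComplex.cell (univ : Set X) n → C(StdSimplex n, Z)}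
    (hψ : ∀ e x, cZ.proj (ψ e x) = charMap e x)
    {ψ' : RelCWComplex.cell (univ : Set X) (n + 1) → C(StdSimplex (n + 1), Z)}
    (hψ' : ∀ e x, cZ.proj (ψ' e x) = charMap e x)
    (e : RelCWComplex.cell (univ : Set X) (n + 1)) (e' : RelCWComplex.cell (univ : Set X) n) :
    (cellBasis cY (proj_mapSimplex_eq_charMap cZ cY hφ hψ)).repr
        (relBdry H _ _ _ n (cellBasis cY (proj_mapSimplex_eq_charMap cZ cY hφ hψ') e)) e' =
      MonoidAlgebra.mapDomainRingHom ℤ φ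
        ((cellBasis cZ hψ).repr (relBdry A _ _ _ n (cellBasis cZ hψ' e)) e') := by
  have : Finite (RelCWComplex.cell (univ : Set X) n) := RelCWComplex.FiniteType.finite_cell n
  cases nonempty_fintype (RelCWComplex.cell (univ : Set X) n)
  set r := (cellBasis cZ hψ).repr (relBdry A _ _ _ n (cellBasis cZ hψ' e))
  have hcell := relBdry_cellBasis_eq_sum_iff cY (proj_mapSimplex_eq_charMap cZ cY hφ hψ)
    (proj_mapSimplex_eq_charMap cZ cY hφ hψ') e
    (fun i => MonoidAlgebra.mapDomainRingHom ℤ φ (r i))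
  suffices hsum : relBdry H _ _ _ n (cellBasis cY (proj_mapSimplex_eq_charMap cZ cY hφ hψ') e) =
      ∑ i, MonoidAlgebra.mapDomainRingHom ℤ φ (r i) •
        cellBasis cY (proj_mapSimplex_eq_charMap cZ cY hφ hψ) i by
    rw [hsum, Module.Basis.repr_sum_self]
  refine hcell.2 ?_
  have hmem := mapSingChain_mem_relBoundaries cZ cY hφ <|
    (relBdry_cellBasis_eq_sum_iff cZ hψ hψ' e r).1 ((cellBasis cZ hψ).sum_repr _).symm
  simpa only [map_sub, map_sum, ← singBdry_mapSingChain, mapSingChain_singOf,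
    mapSingChain_smul_singOf cZ cY hφ hμ] using hmem

end AbelianCover

end Comparison

/-! ### Finiteness and tropical varieties -/

section Tropical

variable {R : Type u} [CommRing R] {H : Type v} [CommGroup H] {χ : Additive H →+ ℝ}

/-- All terms of `g` have positive `χ`-degree. The initial ideal of `I` is trivial exactly when `I`
contains `1 + g` for such a `g`. -/
def IsPositive (χ : Additive H →+ ℝ) (g : MonoidAlgebra R H) : Prop :=
  ∀ h, g.coeff h ≠ 0 → 0 < χ (Additive.ofMul h)

namespace IsPositive

theorem zero : IsPositive χ (0 : MonoidAlgebra R H) := fun _ hh => absurd rfl hh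

theorem add {f g : MonoidAlgebra R H} (hf : IsPositive χ f) (hg : IsPositive χ g) :
    IsPositive χ (f + g) := fun h hh => by
  by_cases hfh : f.coeff h = 0
  · refine hg h fun hgh => hh ?_
    rw [MonoidAlgebra.coeff_add, Finsupp.add_apply, hfh, hgh, add_zero]
  · exact hf h hfh

theorem mul {f g : MonoidAlgebra R H} (hf : IsPositive χ f) (hg : IsPositive χ g) :
    IsPositive χ (f * g) := fun h hh => by
  classical
  obtain ⟨a, ha, b, hb, rfl⟩ := Finset.mem_mul.1
    (MonoidAlgebra.support_coeff_mul_subset f g (Finsupp.mem_support_iff.2 hh))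
  rw [ofMul_mul, map_add]
  exact add_pos (hf a (Finsupp.mem_support_iff.1 ha)) (hg b (Finsupp.mem_support_iff.1 hb))

theorem exists_one_add_pow_eq {g : MonoidAlgebra R H} (hg : IsPositive χ g) (N : ℕ) :
    ∃ g', IsPositive χ g' ∧ (1 + g) ^ N = 1 + g' := by
  induction N with
  | zero => exact ⟨0, zero, by simp⟩
  | succ N ih =>
    obtain ⟨g', hg', h⟩ := ih
    exact ⟨g' + g + g' * g, (hg'.add hg).add (hg'.mul hg), by rw [pow_succ, h]; ring⟩

theorem single {h : H} (hh : 0 < χ (Additive.ofMul h)) (r : R) :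
    IsPositive χ (MonoidAlgebra.single h r) := fun h' hh' => by
  rw [MonoidAlgebra.coeff_single, Finsupp.single_apply_ne_zero] at hh'
  rwa [hh'.1]

theorem mapDomain {H' : Type*} [CommGroup H'] {χ' : Additive H' →+ ℝ} (φ : H →* H')
    (hχ : ∀ h, χ (Additive.ofMul h) = χ' (Additive.ofMul (φ h))) {g : MonoidAlgebra R H}
    (hg : IsPositive χ g) : IsPositive χ' (MonoidAlgebra.mapDomainRingHom R φ g) := fun h hh => by
  classical
  have hcoeff : (MonoidAlgebra.mapDomainRingHom R φ g).coeff = Finsupp.mapDomain φ g.coeff :=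
    MonoidAlgebra.coeff_mapDomain _ _
  rw [hcoeff] at hh
  obtain ⟨a, ha, rfl⟩ := Finset.mem_image.1
    (Finsupp.mapDomain_support (Finsupp.mem_support_iff.2 hh))
  rw [← hχ]
  exact hg a (Finsupp.mem_support_iff.1 ha)

theorem coeff_one_eq_zero {g : MonoidAlgebra R H} (hg : IsPositive χ g) : g.coeff 1 = 0 := by
  by_contra hne
  simpa using hg 1 hne

end IsPositive

theorem coeff_initialForm (f : MonoidAlgebra R H) (h : H) [Decidable (∀ h' ∈ f.coeff.support,
      χ (Additive.ofMul h) ≤ χ (Additive.ofMul h'))] :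
    (initialForm χ f).coeff h = if ∀ h' ∈ f.coeff.support,
      χ (Additive.ofMul h) ≤ χ (Additive.ofMul h') then f.coeff h else 0 := by
  classical
  rw [initialForm, MonoidAlgebra.coeff_ofCoeff, Finsupp.filter_apply]
  congr

theorem coeff_one_of_ne_one {h : H} (hh : h ≠ 1) : (1 : MonoidAlgebra R H).coeff h = 0 := by
  rw [MonoidAlgebra.one_def, MonoidAlgebra.coeff_single, Finsupp.single_eq_of_ne hh]

theorem IsPositive.initialForm_one_add [Nontrivial R] {g : MonoidAlgebra R H}
    (hg : IsPositive χ g) : initialForm χ (1 + g) = 1 := by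
  classical
  have hcoeff_one : (1 + g).coeff 1 = 1 := by
    rw [MonoidAlgebra.coeff_add, Finsupp.add_apply, hg.coeff_one_eq_zero, add_zero,
      MonoidAlgebra.one_def, MonoidAlgebra.coeff_single, Finsupp.single_eq_same]
  have hcoeff_ne {h : H} (hh : h ≠ 1) : (1 + g).coeff h = g.coeff h := by
    rw [MonoidAlgebra.coeff_add, Finsupp.add_apply, coeff_one_of_ne_one hh, zero_add]
  refine MonoidAlgebra.ext (Finsupp.ext fun h => ?_)
  rw [coeff_initialForm]
  by_cases hh : h = 1
  · subst hh
    rw [if_pos fun h' hh' => ?_, hcoeff_one, MonoidAlgebra.one_def, MonoidAlgebra.coeff_single,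
      Finsupp.single_eq_same]
    rw [ofMul_one, map_zero]
    by_cases hh'1 : h' = 1
    · rw [hh'1, ofMul_one, map_zero]
    · exact (hg h' (hcoeff_ne hh'1 ▸ Finsupp.mem_support_iff.1 hh')).le
  · rw [coeff_one_of_ne_one hh, hcoeff_ne hh, ite_eq_right_iff]
    intro hmin
    by_contra hne
    have hle := hmin 1 (Finsupp.mem_support_iff.2 (by rw [hcoeff_one]; exact one_ne_zero))
    rw [ofMul_one, map_zero] at hle
    exact (hg h hne).not_ge hle

/-- `f` has no terms of `χ`-degree less than `t`, and in degree `t` it has the terms of `y`. -/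
def HasLowestLayer (χ : Additive H →+ ℝ) (t : ℝ) (y f : MonoidAlgebra R H) : Prop :=
  (∀ h, χ (Additive.ofMul h) < t → f.coeff h = 0) ∧
    ∀ h, χ (Additive.ofMul h) = t → f.coeff h = y.coeff h

namespace HasLowestLayer

variable {t : ℝ} {x y f g : MonoidAlgebra R H}

theorem zero : HasLowestLayer χ t (0 : MonoidAlgebra R H) 0 := ⟨fun _ _ => rfl, fun _ _ => rfl⟩

theorem add (hf : HasLowestLayer χ t x f) (hg : HasLowestLayer χ t y g) :
    HasLowestLayer χ t (x + y) (f + g) := by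
  refine ⟨fun h hh => ?_, fun h hh => ?_⟩
  · rw [MonoidAlgebra.coeff_add, Finsupp.add_apply, hf.1 h hh, hg.1 h hh, add_zero]
  · rw [MonoidAlgebra.coeff_add, MonoidAlgebra.coeff_add, Finsupp.add_apply, Finsupp.add_apply,
      hf.2 h hh, hg.2 h hh]

theorem single_mul {a : H} (hf : HasLowestLayer χ (t - χ (Additive.ofMul a)) x f) (r : R) :
    HasLowestLayer χ t (MonoidAlgebra.single a r * x) (MonoidAlgebra.single a r * f) := by
  have hχ (h : H) : χ (Additive.ofMul (a⁻¹ * h)) =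
      χ (Additive.ofMul h) - χ (Additive.ofMul a) := by
    rw [ofMul_mul, ofMul_inv, map_add, map_neg]
    ring
  refine ⟨fun h hh => ?_, fun h hh => ?_⟩
  · rw [MonoidAlgebra.coeff_single_mul_apply, hf.1 _ (by rw [hχ]; linarith), mul_zero]
  · rw [MonoidAlgebra.coeff_single_mul_apply, MonoidAlgebra.coeff_single_mul_apply,
      hf.2 _ (by rw [hχ]; linarith)]

theorem isPositive_sub_one (hf : HasLowestLayer χ 0 1 f) : IsPositive χ (f - 1) := fun h hh => by
  by_contra hle
  apply hh
  rw [MonoidAlgebra.coeff_sub, Finsupp.sub_apply]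
  obtain hlt | heq := (not_lt.1 hle).lt_or_eq
  · rw [hf.1 h hlt, coeff_one_of_ne_one (by rintro rfl; simp at hlt), sub_zero]
  · rw [hf.2 h heq, sub_self]

end HasLowestLayer

theorem exists_hasLowestLayer_initialForm {I : Ideal (MonoidAlgebra R H)} {f : MonoidAlgebra R H}
    (hf : f ∈ I) (t : ℝ) : ∃ g ∈ I, HasLowestLayer χ t (initialForm χ f) g := by
  classical
  by_cases hex : ∃ h₀, χ (Additive.ofMul h₀) = t ∧
      ∀ h ∈ f.coeff.support, χ (Additive.ofMul h₀) ≤ χ (Additive.ofMul h)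
  · obtain ⟨h₀, rfl, hmin⟩ := hex
    refine ⟨f, hf, fun h hh => ?_, fun h hh => ?_⟩
    · by_contra hne
      exact (hmin h (Finsupp.mem_support_iff.2 hne)).not_gt hh
    · rw [coeff_initialForm, if_pos]
      rwa [hh]
  · refine ⟨0, I.zero_mem, fun _ _ => rfl, fun h hh => ?_⟩
    rw [coeff_initialForm, if_neg fun hmin => hex ⟨h, hh, hmin⟩]
    rfl

theorem exists_hasLowestLayer_of_mem_initialIdeal {I : Ideal (MonoidAlgebra R H)}
    {y : MonoidAlgebra R H} (hy : y ∈ initialIdeal χ I) (t : ℝ) :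
    ∃ f ∈ I, HasLowestLayer χ t y f := by
  induction hy using Submodule.span_induction generalizing t with
  | mem x hx =>
    obtain ⟨f, hf, rfl⟩ := hx
    exact exists_hasLowestLayer_initialForm hf t
  | zero => exact ⟨0, I.zero_mem, .zero⟩
  | add x y _ _ hx hy =>
    obtain ⟨f, hf, hxf⟩ := hx t
    obtain ⟨g, hg, hyg⟩ := hy t
    exact ⟨f + g, I.add_mem hf hg, hxf.add hyg⟩
  | smul r x _ hx =>
    induction r using monoidAlgebra_induction_single generalizing t with
    | zero => exact ⟨0, I.zero_mem, by rw [zero_smul]; exact .zero⟩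
    | add r s hr hs =>
      obtain ⟨f, hf, hrf⟩ := hr t
      obtain ⟨g, hg, hsg⟩ := hs t
      exact ⟨f + g, I.add_mem hf hg, by rw [add_smul]; exact hrf.add hsg⟩
    | single a r =>
      obtain ⟨f, hf, hxf⟩ := hx (t - χ (Additive.ofMul a))
      exact ⟨_, I.mul_mem_left _ hf, hxf.single_mul r⟩

theorem initialIdeal_eq_top_iff {I : Ideal (MonoidAlgebra R H)} :
    initialIdeal χ I = ⊤ ↔ ∃ g, IsPositive χ g ∧ 1 + g ∈ I := by
  constructor
  · intro h
    have hone : (1 : MonoidAlgebra R H) ∈ initialIdeal χ I := h ▸ Submodule.mem_top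
    obtain ⟨f, hf, hlayer⟩ := exists_hasLowestLayer_of_mem_initialIdeal hone 0
    exact ⟨f - 1, hlayer.isPositive_sub_one, by rwa [add_sub_cancel]⟩
  · rintro ⟨g, hg, hI⟩
    nontriviality R
    rw [Ideal.eq_top_iff_one, ← hg.initialForm_one_add]
    exact Submodule.subset_span ⟨_, hI, rfl⟩

theorem tropVariety_subset_iff {I : Ideal (MonoidAlgebra R H)} :
    tropVariety I ⊆ {0} ↔ ∀ χ : Additive H →+ ℝ, χ ≠ 0 → ∃ g, IsPositive χ g ∧ 1 + g ∈ I := by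
  simp only [← initialIdeal_eq_top_iff]
  exact forall_congr' fun χ => not_imp_comm

theorem exists_apply_pos {A : Type*} [AddGroup A] {χ : A →+ ℝ} (hχ : χ ≠ 0) : ∃ a, 0 < χ a := by
  obtain ⟨a, ha⟩ := DFunLike.ne_iff.1 hχ
  obtain hlt | hgt := lt_or_gt_of_ne ha
  · exact ⟨-a, by rw [map_neg]; exact neg_pos.2 hlt⟩
  · exact ⟨a, hgt⟩

theorem exists_isPositive_of_monic {I : Ideal (MonoidAlgebra R H)} {h : H}
    (hh : χ (Additive.ofMul h) < 0) {P : Polynomial R} (hP : P.Monic)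
    (hI : Polynomial.aeval (MonoidAlgebra.single h (1 : R)) P ∈ I) :
    ∃ g, IsPositive χ g ∧ 1 + g ∈ I := by
  refine ⟨∑ k ∈ Finset.range P.natDegree,
    MonoidAlgebra.single ((h ^ P.natDegree)⁻¹ * h ^ k) (P.coeff k), ?_, ?_⟩
  · refine Finset.sum_induction _ (IsPositive χ) (fun _ _ => .add) .zero fun k hk => .single ?_ _
    rw [ofMul_mul, ofMul_inv, ofMul_pow, ofMul_pow, map_add, map_neg, map_nsmul, map_nsmul,
      nsmul_eq_mul, nsmul_eq_mul]
    have hdeg : (k : ℝ) < P.natDegree := by exact_mod_cast Finset.mem_range.1 hk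
    nlinarith
  · convert Ideal.mul_mem_left _ (MonoidAlgebra.single (h ^ P.natDegree)⁻¹ (1 : R)) hI using 1
    simp only [Polynomial.aeval_eq_sum_range, Finset.sum_range_succ, hP.coeff_natDegree, mul_add,
      MonoidAlgebra.single_pow, one_pow, MonoidAlgebra.single_mul_single, inv_mul_cancel, mul_one,
      ← MonoidAlgebra.one_def, Finset.mul_sum, MonoidAlgebra.smul_single, smul_eq_mul, one_mul]
    exact add_comm _ _

theorem tropVariety_annihilator_of_finite {M : Type*} [AddCommGroup M] [Module R M]
    [Module (MonoidAlgebra R H) M] [IsScalarTower R (MonoidAlgebra R H) M] [Module.Finite R M] :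
    tropVariety (Module.annihilator (MonoidAlgebra R H) M) ⊆ {0} := by
  refine tropVariety_subset_iff.2 fun χ hχ => ?_
  obtain ⟨a, ha⟩ := exists_apply_pos hχ
  set x : MonoidAlgebra R H := MonoidAlgebra.single a.toMul⁻¹ 1
  obtain ⟨P, hP, hPx⟩ := LinearMap.exists_monic_and_aeval_eq_zero R (Algebra.lsmul R R M x)
  refine exists_isPositive_of_monic (h := a.toMul⁻¹) ?_ hP (Module.mem_annihilator.2 fun m => ?_)
  · rw [ofMul_inv, ofMul_toMul, map_neg]
    exact neg_neg_of_pos ha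
  · rw [Polynomial.aeval_algHom_apply] at hPx
    exact LinearMap.congr_fun hPx m

theorem exists_mapDomain_eq_of_isPositive {L : Type*} [CommGroup L] {π : L →* H}
    (hπ : Function.Surjective π) {χL : Additive L →+ ℝ}
    (hχ : ∀ l, χL (Additive.ofMul l) = χ (Additive.ofMul (π l))) {g : MonoidAlgebra R H}
    (hg : IsPositive χ g) :
    ∃ f, IsPositive χL f ∧ MonoidAlgebra.mapDomainRingHom R π f = g := by
  obtain ⟨s, hs⟩ := hπ.hasRightInverse
  refine ⟨g.coeff.sum fun h r => MonoidAlgebra.single (s h) r, ?_, ?_⟩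
  · refine Finset.sum_induction _ (IsPositive χL) (fun _ _ => .add) .zero fun h hh => .single ?_ _
    rw [hχ, hs]
    exact hg h (Finsupp.mem_support_iff.1 hh)
  · have hsingle (h : H) (r : R) : MonoidAlgebra.mapDomainRingHom R π
        (MonoidAlgebra.single (s h) r) = MonoidAlgebra.single h r :=
      MonoidAlgebra.mapDomain_single.trans (by rw [hs])
    rw [map_finsuppSum]
    simp only [hsingle]
    exact MonoidAlgebra.sum_coeff_single g

theorem tropVariety_comap_mapDomain {L : Type*} [CommGroup L] {π : L →* H}
    (hπ : Function.Surjective π) {I : Ideal (MonoidAlgebra R H)} (hI : tropVariety I ⊆ {0}) :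
    tropVariety (I.comap (MonoidAlgebra.mapDomainRingHom R π)) ⊆ {0} := by
  refine tropVariety_subset_iff.2 fun χL hχL => ?_
  by_cases hker : ∀ l, π.toAdditive l = 0 → χL l = 0
  · obtain ⟨s, hs⟩ := hπ.hasRightInverse
    set χ : Additive H →+ ℝ := π.toAdditive.liftOfRightInverse s hs ⟨χL, hker⟩
    have hχ (l : L) : χL (Additive.ofMul l) = χ (Additive.ofMul (π l)) :=
      (π.toAdditive.liftOfRightInverse_comp_apply s hs ⟨χL, hker⟩ (Additive.ofMul l)).symm
    have hχ₀ : χ ≠ 0 := fun h => hχL (AddMonoidHom.ext fun l => by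
      rw [← ofMul_toMul l, hχ, h, AddMonoidHom.zero_apply, AddMonoidHom.zero_apply])
    obtain ⟨g, hg, hgI⟩ := tropVariety_subset_iff.1 hI χ hχ₀
    obtain ⟨f, hf, rfl⟩ := exists_mapDomain_eq_of_isPositive hπ hχ hg
    exact ⟨f, hf, by rwa [Ideal.mem_comap, map_add, map_one]⟩
  · push Not at hker
    obtain ⟨l, hl, hχl⟩ := hker
    obtain ⟨k, hk, hχk⟩ : ∃ k : L, π k = 1 ∧ 0 < χL (Additive.ofMul k) := by
      obtain hlt | hgt := lt_or_gt_of_ne hχl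
      · exact ⟨l.toMul⁻¹, by rw [map_inv]; exact inv_eq_one.2 hl,
          by rw [ofMul_inv, map_neg]; exact neg_pos.2 hlt⟩
      · exact ⟨l.toMul, hl, hgt⟩
    have hsingle : MonoidAlgebra.mapDomainRingHom R π (MonoidAlgebra.single k (-1 : R)) = -1 := by
      refine MonoidAlgebra.mapDomain_single.trans ?_
      rw [hk, MonoidAlgebra.single_neg, ← MonoidAlgebra.one_def]
    refine ⟨MonoidAlgebra.single k (-1), .single hχk _, ?_⟩
    rw [Ideal.mem_comap, map_add, map_one, hsingle, add_neg_cancel]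
    exact I.zero_mem

theorem tropVariety_subset_of_le_comap_radical {A : Type*} [CommGroup A] {φ : A →* H}
    (hφ : Function.Surjective φ) {J : Ideal (MonoidAlgebra R A)} {I : Ideal (MonoidAlgebra R H)}
    (hJI : J ≤ I.radical.comap (MonoidAlgebra.mapDomainRingHom R φ)) (hJ : tropVariety J ⊆ {0}) :
    tropVariety I ⊆ {0} := by
  refine tropVariety_subset_iff.2 fun χ hχ => ?_
  have hχφ : χ.comp φ.toAdditive ≠ 0 := by
    refine fun hzero => hχ (AddMonoidHom.ext fun h => ?_)
    obtain ⟨a, rfl⟩ : ∃ a, φ.toAdditive a = h := hφ h.toMul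
    exact DFunLike.congr_fun hzero a
  obtain ⟨g, hg, hgJ⟩ := tropVariety_subset_iff.1 hJ _ hχφ
  obtain ⟨N, hN⟩ := hJI hgJ
  rw [map_add, map_one] at hN
  obtain ⟨g', hg', hpow⟩ := (hg.mapDomain (χ' := χ) φ fun _ => rfl).exists_one_add_pow_eq N
  exact ⟨g', hg', hpow ▸ hN⟩

end Tropical

section TropicalFiniteness

variable {R : Type u} [CommRing R]

section Lattice

variable {n : ℕ}

/-- The character `k ↦ ⟨v, k⟩` of the lattice `ℤⁿ`, written multiplicatively. -/
def latticeCharacter (v : Fin n → ℝ) : Additive (Multiplicative (Fin n → ℤ)) →+ ℝ where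
  toFun k := ∑ i, v i * (k.toMul.toAdd i : ℝ)
  map_zero' := by simp
  map_add' k l := by simp [mul_add, Finset.sum_add_distrib]

theorem latticeCharacter_apply (v : Fin n → ℝ) (k : Multiplicative (Fin n → ℤ)) :
    latticeCharacter v (Additive.ofMul k) = ∑ i, v i * (k.toAdd i : ℝ) := rfl

theorem latticeCharacter_ne_zero {v : Fin n → ℝ} (hv : v ≠ 0) : latticeCharacter v ≠ 0 := by
  obtain ⟨i, hi⟩ := Function.ne_iff.1 hv
  intro h
  have hvi := DFunLike.congr_fun h (Additive.ofMul (Multiplicative.ofAdd (Pi.single i 1)))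
  rw [latticeCharacter_apply, Finset.sum_eq_single i (fun j _ hj => by simp [hj]) (by simp)] at hvi
  exact hi (by simpa using hvi)

theorem latticeCharacter_smul (r : ℝ) (v : Fin n → ℝ) (k : Multiplicative (Fin n → ℤ)) :
    latticeCharacter (r • v) (Additive.ofMul k) = r * latticeCharacter v (Additive.ofMul k) := by
  simp [latticeCharacter_apply, Finset.mul_sum, mul_assoc]

theorem norm_intCast_pi (a : Fin n → ℤ) : ‖fun i => (a i : ℝ)‖ = ‖a‖ := by
  rw [Pi.norm_def, Pi.norm_def]
  exact congrArg NNReal.toReal (Finset.sup_congr rfl fun i _ => NNReal.eq (Int.norm_cast_real _))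

variable {I : Ideal (MonoidAlgebra R (Multiplicative (Fin n → ℤ)))}

/-- The constants `δ` and `B` witness that `I` contains, for every `v` in `V`, an element `1 + g`
all of whose exponents `k ≠ 0` satisfy `⟨v, k⟩ > δ` and `∑ kᵢ² ≤ B`. -/
def HasUniformRelations (I : Ideal (MonoidAlgebra R (Multiplicative (Fin n → ℤ))))
    (V : Set (Fin n → ℝ)) (δ B : ℝ) : Prop :=
  ∀ v ∈ V, ∃ g, 1 + g ∈ I ∧ ∀ k ∈ g.coeff.support,
    δ < latticeCharacter v (Additive.ofMul k) ∧ ∑ i, (k.toAdd i : ℝ) ^ 2 ≤ B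

theorem HasUniformRelations.union {V W : Set (Fin n → ℝ)} {δ δ' B B' : ℝ}
    (hV : HasUniformRelations I V δ B) (hW : HasUniformRelations I W δ' B') :
    HasUniformRelations I (V ∪ W) (min δ δ') (max B B') := by
  rintro v (hv | hv)
  · obtain ⟨g, hg, hk⟩ := hV v hv
    exact ⟨g, hg, fun k hkg => ⟨(min_le_left _ _).trans_lt (hk k hkg).1,
      (hk k hkg).2.trans (le_max_left _ _)⟩⟩
  · obtain ⟨g, hg, hk⟩ := hW v hv
    exact ⟨g, hg, fun k hkg => ⟨(min_le_right _ _).trans_lt (hk k hkg).1,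
      (hk k hkg).2.trans (le_max_right _ _)⟩⟩

theorem exists_nhds_hasUniformRelations (hI : tropVariety I ⊆ {0}) {v : Fin n → ℝ} (hv : v ≠ 0) :
    ∃ V ∈ 𝓝 v, ∃ δ, 0 < δ ∧ ∃ B, HasUniformRelations I V δ B := by
  obtain ⟨g, hg, hgI⟩ := tropVariety_subset_iff.1 hI _ (latticeCharacter_ne_zero hv)
  have hcont (k : Multiplicative (Fin n → ℤ)) :
      Continuous fun w : Fin n → ℝ => latticeCharacter w (Additive.ofMul k) := by
    simp only [latticeCharacter_apply]
    fun_prop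
  have hev : ∀ᶠ x : ℝ × (Fin n → ℝ) in 𝓝 (0, v), ∀ k ∈ g.coeff.support,
      x.1 < latticeCharacter x.2 (Additive.ofMul k) := by
    refine (Filter.eventually_all_finset _).2 fun k hk => ?_
    exact (isOpen_lt continuous_fst ((hcont k).comp continuous_snd)).mem_nhds
      (hg k (Finsupp.mem_support_iff.1 hk))
  rw [nhds_prod_eq] at hev
  obtain ⟨p, hp, q, hq, hpq⟩ := Filter.eventually_prod_iff.1 hev
  obtain ⟨δ, hpδ, hδ⟩ := ((hp.filter_mono nhdsWithin_le_nhds).and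
    (self_mem_nhdsWithin (a := (0 : ℝ)) (s := Ioi 0))).exists
  refine ⟨{w | q w}, hq, δ, hδ, ∑ k ∈ g.coeff.support, ∑ i, (k.toAdd i : ℝ) ^ 2,
    fun w hw => ⟨g, hgI, fun k hk => ⟨hpq hpδ hw k hk, ?_⟩⟩⟩
  exact Finset.single_le_sum (f := fun k : Multiplicative (Fin n → ℤ) =>
    ∑ i, (k.toAdd i : ℝ) ^ 2) (fun k _ => Finset.sum_nonneg fun i _ => sq_nonneg _) hk

theorem exists_hasUniformRelations_sphere (hI : tropVariety I ⊆ {0}) :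
    ∃ δ, 0 < δ ∧ ∃ B, HasUniformRelations I (Metric.sphere 0 1) δ B := by
  refine (isCompact_sphere (0 : Fin n → ℝ) 1).induction_on
    (p := fun V => ∃ δ, 0 < δ ∧ ∃ B, HasUniformRelations I V δ B)
    ⟨1, one_pos, 0, fun _ hv => hv.elim⟩ ?_ ?_ ?_
  · rintro V W hVW ⟨δ, hδ, B, hW⟩
    exact ⟨δ, hδ, B, fun v hv => hW v (hVW hv)⟩
  · rintro V W ⟨δ, hδ, B, hV⟩ ⟨δ', hδ', B', hW⟩
    exact ⟨_, lt_min hδ hδ', _, hV.union hW⟩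
  · intro v hv
    obtain ⟨V, hV, h⟩ := exists_nhds_hasUniformRelations hI (Metric.ne_of_mem_sphere hv one_ne_zero)
    exact ⟨V, mem_nhdsWithin_of_mem_nhds hV, h⟩

/-- The exponent `k` comes from the relation for `v = -a / ‖a‖`. -/
theorem HasUniformRelations.exists_sum_sq_add_lt {δ B : ℝ} (hδ : 0 < δ)
    (hB : HasUniformRelations I (Metric.sphere 0 1) δ B) {a : Fin n → ℤ} (ha₀ : 0 < ‖a‖)
    (ha : B / (2 * δ) < ‖a‖) : ∃ g, 1 + g ∈ I ∧ ∀ k ∈ g.coeff.support,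
      ∑ i, (a + k.toAdd) i ^ 2 < ∑ i, a i ^ 2 := by
  set w : Fin n → ℝ := fun i => (a i : ℝ) with hw
  have hsphere : (-‖a‖⁻¹) • w ∈ Metric.sphere (0 : Fin n → ℝ) 1 := by
    rw [mem_sphere_zero_iff_norm, norm_smul, norm_intCast_pi, norm_neg, norm_inv, norm_norm,
      inv_mul_cancel₀ ha₀.ne']
  obtain ⟨g, hgI, hg⟩ := hB _ hsphere
  refine ⟨g, hgI, fun k hk => ?_⟩
  obtain ⟨hδk, hkB⟩ := hg k hk
  rw [latticeCharacter_smul, neg_mul, ← div_eq_inv_mul, ← neg_div, lt_div_iff₀ ha₀] at hδk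
  rw [div_lt_iff₀ (by positivity)] at ha
  have hexpand : ((∑ i, (a + k.toAdd) i ^ 2 : ℤ) : ℝ) = ((∑ i, a i ^ 2 : ℤ) : ℝ) +
      2 * latticeCharacter w (Additive.ofMul k) + ∑ i, (k.toAdd i : ℝ) ^ 2 := by
    rw [latticeCharacter_apply, Finset.mul_sum]
    push_cast
    rw [← Finset.sum_add_distrib, ← Finset.sum_add_distrib]
    refine Finset.sum_congr rfl fun i _ => ?_
    rw [Pi.add_apply, Int.cast_add, hw]
    ring
  have hlt : ((∑ i, (a + k.toAdd) i ^ 2 : ℤ) : ℝ) < ((∑ i, a i ^ 2 : ℤ) : ℝ) := by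
    rw [hexpand]
    linarith
  exact_mod_cast hlt

theorem single_mem_span_sup_of_norm_le {δ B : ℝ} (hδ : 0 < δ)
    (hB : HasUniformRelations I (Metric.sphere 0 1) δ B) (a : Fin n → ℤ) :
    MonoidAlgebra.single (Multiplicative.ofAdd a) (1 : R) ∈ Submodule.span R
        ((fun b => MonoidAlgebra.single (Multiplicative.ofAdd b) (1 : R)) ''
          {b : Fin n → ℤ | ‖b‖ ≤ max 0 (B / (2 * δ))}) ⊔ I.restrictScalars R := by
  set N := Submodule.span R ((fun b => MonoidAlgebra.single (Multiplicative.ofAdd b) (1 : R)) ''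
    {b : Fin n → ℤ | ‖b‖ ≤ max 0 (B / (2 * δ))}) ⊔ I.restrictScalars R
  induction hs : (∑ i, a i ^ 2).toNat using Nat.strong_induction_on generalizing a with
  | h s ih =>
    by_cases ha : ‖a‖ ≤ max 0 (B / (2 * δ))
    · exact Submodule.mem_sup_left (Submodule.subset_span ⟨a, ha, rfl⟩)
    rw [not_le, max_lt_iff] at ha
    obtain ⟨g, hgI, hg⟩ := hB.exists_sum_sq_add_lt hδ ha.1 ha.2
    set x := MonoidAlgebra.single (Multiplicative.ofAdd a) (1 : R)
    have hxg : x * g ∈ N := by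
      have hsum : x * g = ∑ k ∈ g.coeff.support, g.coeff k •
          MonoidAlgebra.single (Multiplicative.ofAdd (a + k.toAdd)) (1 : R) := by
        conv_lhs => rw [← MonoidAlgebra.sum_coeff_single g, Finsupp.sum, Finset.mul_sum]
        refine Finset.sum_congr rfl fun k _ => ?_
        rw [MonoidAlgebra.single_mul_single, MonoidAlgebra.smul_single, one_mul, smul_eq_mul,
          mul_one, ofAdd_add, ofAdd_toAdd]
      rw [hsum]
      refine Submodule.sum_mem _ fun k hk => Submodule.smul_mem _ _ (ih _ ?_ (a + k.toAdd) rfl)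
      have hlt := hg k hk
      have hnonneg : 0 ≤ ∑ i, (a + k.toAdd) i ^ 2 := Finset.sum_nonneg fun i _ => sq_nonneg _
      omega
    have hxI : x * (1 + g) ∈ N := Submodule.mem_sup_right (I.mul_mem_left x hgI)
    rw [show x = x * (1 + g) - x * g by ring]
    exact N.sub_mem hxI hxg

theorem finite_quotient_lattice_of_tropVariety_subset (hI : tropVariety I ⊆ {0}) :
    Module.Finite R (MonoidAlgebra R (Multiplicative (Fin n → ℤ)) ⧸ I) := by
  obtain ⟨δ, hδ, B, hB⟩ := exists_hasUniformRelations_sphere hI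
  set ρ := max 0 (B / (2 * δ))
  have hfinite : {b : Fin n → ℤ | ‖b‖ ≤ ρ}.Finite :=
    (isCompact_closedBall (0 : Fin n → ℤ) ρ).finite_of_discrete.subset
      fun b hb => mem_closedBall_zero_iff.2 hb
  set S := (fun b => MonoidAlgebra.single (Multiplicative.ofAdd b) (1 : R)) ''
    {b : Fin n → ℤ | ‖b‖ ≤ ρ}
  have htop : Submodule.span R S ⊔ I.restrictScalars R = ⊤ := by
    refine eq_top_iff.2 fun f _ => ?_
    induction f using monoidAlgebra_induction_single with
    | zero => exact Submodule.zero_mem _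
    | add f g hf hg => exact Submodule.add_mem _ (hf trivial) (hg trivial)
    | single k r =>
      rw [← mul_one r, ← smul_eq_mul, ← MonoidAlgebra.smul_single]
      exact Submodule.smul_mem _ r (single_mem_span_sup_of_norm_le hδ hB k.toAdd)
  have hmap : (Submodule.span R S).map (Ideal.Quotient.mkₐ R I).toLinearMap = ⊤ := by
    refine eq_top_iff.2 fun y _ => ?_
    obtain ⟨f, rfl⟩ := Ideal.Quotient.mk_surjective y
    obtain ⟨x, hx, z, hz, rfl⟩ := Submodule.mem_sup.1 (htop ▸ Submodule.mem_top : f ∈ _)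
    refine ⟨x, hx, (Ideal.Quotient.eq.2 ?_).symm⟩
    rwa [add_sub_cancel_left]
  exact ⟨hmap ▸ (Submodule.fg_span (hfinite.image _)).map _⟩

end Lattice

variable {H : Type v} [CommGroup H]

theorem mapDomainAlgHom_surjective {L : Type*} [CommGroup L] {π : L →* H}
    (hπ : Function.Surjective π) : Function.Surjective (MonoidAlgebra.mapDomainAlgHom R R π) := by
  intro f
  induction f using monoidAlgebra_induction_single with
  | zero => exact ⟨0, map_zero _⟩
  | add f g hf hg =>
    obtain ⟨⟨f, rfl⟩, ⟨g, rfl⟩⟩ := And.intro hf hg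
    exact ⟨f + g, map_add _ f g⟩
  | single h r =>
    obtain ⟨l, rfl⟩ := hπ h
    exact ⟨MonoidAlgebra.single l r, MonoidAlgebra.mapDomain_single⟩

theorem finite_quotient_of_tropVariety_subset [Group.FG H] {I : Ideal (MonoidAlgebra R H)}
    (hI : tropVariety I ⊆ {0}) : Module.Finite R (MonoidAlgebra R H ⧸ I) := by
  have : Module.Finite ℤ (Additive H) := Module.Finite.iff_addGroup_fg.2 inferInstance
  obtain ⟨n, π, hπ⟩ := Module.Finite.exists_fin' ℤ (Additive H)
  set πH : Multiplicative (Fin n → ℤ) →* H := AddMonoidHom.toMultiplicativeLeft π.toAddMonoidHom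
  have hπH : Function.Surjective πH := hπ
  have := finite_quotient_lattice_of_tropVariety_subset (tropVariety_comap_mapDomain hπH hI)
  exact .of_surjective (Ideal.quotientMapₐ (I := I.comap (MonoidAlgebra.mapDomainRingHom R πH)) I
    (MonoidAlgebra.mapDomainAlgHom R R πH) le_rfl).toLinearMap
    (Ideal.quotientMap_surjective (H := le_rfl) (mapDomainAlgHom_surjective hπH))

theorem finite_of_tropVariety_annihilator [Group.FG H] {M : Type*} [AddCommGroup M] [Module R M]
    [Module (MonoidAlgebra R H) M] [IsScalarTower R (MonoidAlgebra R H) M]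
    [Module.Finite (MonoidAlgebra R H) M]
    (hM : tropVariety (Module.annihilator (MonoidAlgebra R H) M) ⊆ {0}) : Module.Finite R M := by
  set A := MonoidAlgebra R H ⧸ Module.annihilator (MonoidAlgebra R H) M
  have : Module.Finite R A := finite_quotient_of_tropVariety_subset hM
  let : Module A M := Module.quotientAnnihilator
  have : IsScalarTower (MonoidAlgebra R H) A M := Module.IsTorsionBySet.isScalarTower _
  have : IsScalarTower R A M := Module.IsTorsionBySet.isScalarTower _
  have : Module.Finite A M := .of_restrictScalars_finite (MonoidAlgebra R H) A M
  exact .trans A M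

end TropicalFiniteness

/-! ### Jump ideals and annihilators of homology -/

section JumpIdeals

variable {ι l r s : Type*} [Fintype ι] [Fintype l] [Fintype r] [Fintype s]

section Field

variable {K : Type*} [Field K]

theorem exists_comp_add_comp_eq_id {V W U : Type*} [AddCommGroup V] [Module K V] [AddCommGroup W]
    [Module K W] [AddCommGroup U] [Module K U] {f : V →ₗ[K] W} {g : W →ₗ[K] U}
    (hfg : Function.Exact f g) :
    ∃ (τ : W →ₗ[K] V) (q : U →ₗ[K] W), f ∘ₗ τ + q ∘ₗ g = LinearMap.id := by
  obtain ⟨σ, hσ⟩ := g.rangeRestrict.exists_rightInverse_of_surjective g.range_rangeRestrict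
  obtain ⟨q, hq⟩ := LinearMap.exists_extend σ
  have hgqg (x : W) : g (q (g x)) = g x := by
    have hqσ : q (g x) = σ (g.rangeRestrict x) := LinearMap.congr_fun hq (g.rangeRestrict x)
    rw [hqσ]
    exact congrArg Subtype.val (LinearMap.congr_fun hσ (g.rangeRestrict x))
  have hrange (x : W) : (LinearMap.id - q ∘ₗ g : W →ₗ[K] W) x ∈ LinearMap.range f := by
    refine (hfg _).1 ?_
    rw [LinearMap.sub_apply, map_sub, LinearMap.comp_apply, hgqg, LinearMap.id_apply, sub_self]
  obtain ⟨τ, hτ⟩ := f.rangeRestrict.exists_rightInverse_of_surjective f.range_rangeRestrict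
  refine ⟨τ ∘ₗ (LinearMap.id - q ∘ₗ g).codRestrict _ hrange, q, ?_⟩
  rw [← LinearMap.comp_assoc, ← eq_sub_iff_add_eq]
  exact LinearMap.ext fun x => congrArg Subtype.val (LinearMap.congr_fun hτ ⟨_, hrange x⟩)

theorem le_finrank_range_add_finrank_range [DecidableEq l] {A : Matrix ι r K}
    {B : Matrix s ι K} {W₁ : Matrix l ι K} {U₁ : Matrix r l K} {W₂ : Matrix l s K}
    {U₂ : Matrix ι l K} (hdet : (W₁ * A * U₁ + W₂ * B * U₂).det ≠ 0) :
    Fintype.card l ≤ Module.finrank K (LinearMap.range A.mulVecLin) +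
      Module.finrank K (LinearMap.range B.mulVecLin) := by
  set k : (l → K) →ₗ[K] LinearMap.range A.mulVecLin × LinearMap.range B.mulVecLin :=
    (A.mulVecLin.rangeRestrict ∘ₗ U₁.mulVecLin).prod (B.mulVecLin.rangeRestrict ∘ₗ U₂.mulVecLin)
  have hinj : Function.Injective k := by
    refine (injective_iff_map_eq_zero k).2 fun x hx => ?_
    have hA : A.mulVec (U₁.mulVec x) = 0 := congrArg (fun y => (y.1 : ι → K)) hx
    have hB : B.mulVec (U₂.mulVec x) = 0 := congrArg (fun y => (y.2 : s → K)) hx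
    refine Matrix.eq_zero_of_mulVec_eq_zero hdet ?_
    rw [Matrix.add_mulVec, ← Matrix.mulVec_mulVec, ← Matrix.mulVec_mulVec, hA,
      ← Matrix.mulVec_mulVec, ← Matrix.mulVec_mulVec, hB, Matrix.mulVec_zero, Matrix.mulVec_zero,
      add_zero]
  simpa only [Module.finrank_prod, Module.finrank_fintype_fun_eq_card] using
    LinearMap.finrank_le_finrank_of_injective hinj

theorem exact_mulVecLin_of_det_ne_zero [DecidableEq l] {A : Matrix ι r K} {B : Matrix s ι K}
    (hBA : B * A = 0) (hl : Fintype.card ι ≤ Fintype.card l) {W₁ : Matrix l ι K}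
    {U₁ : Matrix r l K} {W₂ : Matrix l s K} {U₂ : Matrix ι l K}
    (hdet : (W₁ * A * U₁ + W₂ * B * U₂).det ≠ 0) :
    Function.Exact A.mulVecLin B.mulVecLin := by
  have hle : LinearMap.range A.mulVecLin ≤ LinearMap.ker B.mulVecLin := by
    rw [LinearMap.range_le_ker_iff, ← Matrix.mulVecLin_mul, hBA, Matrix.mulVecLin_zero]
  have hrank := le_finrank_range_add_finrank_range hdet
  have hnullity := LinearMap.finrank_range_add_finrank_ker B.mulVecLin
  rw [Module.finrank_fintype_fun_eq_card] at hnullity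
  exact LinearMap.exact_iff.2 (Submodule.eq_of_le_of_finrank_le hle (by omega)).symm

theorem exists_mul_add_mul_eq_one [DecidableEq ι] [DecidableEq l] {A : Matrix ι r K}
    {B : Matrix s ι K} (hBA : B * A = 0) (hl : Fintype.card ι ≤ Fintype.card l) {W₁ : Matrix l ι K}
    {U₁ : Matrix r l K} {W₂ : Matrix l s K} {U₂ : Matrix ι l K}
    (hdet : (W₁ * A * U₁ + W₂ * B * U₂).det ≠ 0) :
    ∃ (P : Matrix r ι K) (Q : Matrix ι s K), A * P + Q * B = 1 := by
  classical
  obtain ⟨τ, q, h⟩ := exists_comp_add_comp_eq_id (exact_mulVecLin_of_det_ne_zero hBA hl hdet)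
  refine ⟨LinearMap.toMatrix' τ, LinearMap.toMatrix' q, Matrix.toLin'.injective ?_⟩
  rwa [map_add, Matrix.toLin'_mul, Matrix.toLin'_mul, Matrix.toLin'_toMatrix',
    Matrix.toLin'_toMatrix', Matrix.toLin'_one]

end Field

variable {R : Type*} [CommRing R]

theorem exists_smul_eq_map {p : Ideal R} [p.IsPrime] {α : Type*} [Finite α]
    (x : α → FractionRing (R ⧸ p)) :
    ∃ b : FractionRing (R ⧸ p), b ≠ 0 ∧ ∃ y : α → R,
      ∀ i, algebraMap (R ⧸ p) (FractionRing (R ⧸ p)) (Ideal.Quotient.mk p (y i)) = b * x i := by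
  obtain ⟨b, hb⟩ := IsLocalization.exist_integer_multiples_of_finite (nonZeroDivisors (R ⧸ p)) x
  have hlift (i : α) : ∃ y : R,
      algebraMap (R ⧸ p) (FractionRing (R ⧸ p)) (Ideal.Quotient.mk p y) =
        algebraMap (R ⧸ p) (FractionRing (R ⧸ p)) b * x i := by
    obtain ⟨z, hz⟩ := hb i
    obtain ⟨y, rfl⟩ := Ideal.Quotient.mk_surjective z
    exact ⟨y, hz.trans (Algebra.smul_def _ _)⟩
  choose y hy using hlift
  refine ⟨_, ?_, y, hy⟩
  rw [Ne, FaithfulSMul.algebraMap_eq_zero_iff]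
  exact nonZeroDivisors.coe_ne_zero b

/-- Modulo a prime over `I` the determinant, were it nonzero, would make the pair `A`, `B` split
exact over the residue field, and clearing denominators in `A * P + Q * B = 1` contradicts `hI`. -/
theorem det_mem_radical [DecidableEq ι] [DecidableEq l] {A : Matrix ι r R} {B : Matrix s ι R}
    (hBA : B * A = 0) (hl : Fintype.card ι ≤ Fintype.card l) {I : Ideal R}
    (hI : ∀ (P : Matrix r ι R) (Q : Matrix ι s R), (A * P + Q * B).det ∈ I)
    (W₁ : Matrix l ι R) (U₁ : Matrix r l R) (W₂ : Matrix l s R) (U₂ : Matrix ι l R) :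
    (W₁ * A * U₁ + W₂ * B * U₂).det ∈ I.radical := by
  rw [Ideal.radical_eq_sInf, Ideal.mem_sInf]
  rintro p ⟨hIp, hp⟩
  by_contra hx
  set ψ : R →+* FractionRing (R ⧸ p) := (algebraMap (R ⧸ p) _).comp (Ideal.Quotient.mk p) with hψ
  have hker (x : R) : ψ x = 0 ↔ x ∈ p := by
    rw [hψ, RingHom.comp_apply, FaithfulSMul.algebraMap_eq_zero_iff, Ideal.Quotient.eq_zero_iff_mem]
  have hBA' : B.map ψ * A.map ψ = 0 := by rw [← Matrix.map_mul, hBA, Matrix.map_zero _ (map_zero ψ)]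
  have hdet : (W₁.map ψ * A.map ψ * U₁.map ψ + W₂.map ψ * B.map ψ * U₂.map ψ).det ≠ 0 := by
    rwa [← Matrix.map_mul, ← Matrix.map_mul, ← Matrix.map_mul, ← Matrix.map_mul,
      ← Matrix.map_add _ (map_add ψ), ← RingHom.mapMatrix_apply, ← RingHom.map_det, Ne, hker]
  obtain ⟨P', Q', hPQ⟩ := exists_mul_add_mul_eq_one hBA' hl hdet
  obtain ⟨b, hb, y, hy⟩ := exists_smul_eq_map
    (Sum.elim (fun i : r × ι => P' i.1 i.2) fun i : ι × s => Q' i.1 i.2)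
  set P : Matrix r ι R := fun i j => y (Sum.inl (i, j))
  set Q : Matrix ι s R := fun i j => y (Sum.inr (i, j))
  have hP : P.map ψ = b • P' := Matrix.ext fun i j => hy (Sum.inl (i, j))
  have hQ : Q.map ψ = b • Q' := Matrix.ext fun i j => hy (Sum.inr (i, j))
  have hzero : ψ (A * P + Q * B).det = 0 := (hker _).2 (hIp (hI P Q))
  rw [RingHom.map_det, RingHom.mapMatrix_apply, Matrix.map_add _ (map_add ψ), Matrix.map_mul,
    Matrix.map_mul, hP, hQ, Matrix.mul_smul, Matrix.smul_mul, ← smul_add, hPQ, Matrix.det_smul,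
    Matrix.det_one, mul_one] at hzero
  exact hb (eq_zero_of_pow_eq_zero hzero)

theorem aeval_mul_of_mul_eq [DecidableEq ι] [DecidableEq r] {N : Matrix ι ι R} {D : Matrix r r R}
    {A : Matrix ι r R} (h : N * A = A * D) (q : Polynomial R) :
    Polynomial.aeval N q * A = A * Polynomial.aeval D q := by
  induction q using Polynomial.induction_on' with
  | add p q hp hq => rw [map_add, map_add, Matrix.add_mul, Matrix.mul_add, hp, hq]
  | monomial k a =>
    have hpow : N ^ k * A = A * D ^ k := by
      induction k with
      | zero => rw [pow_zero, pow_zero, Matrix.one_mul, Matrix.mul_one]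
      | succ k ih => rw [pow_succ, Matrix.mul_assoc, h, ← Matrix.mul_assoc, ih, Matrix.mul_assoc,
          ← pow_succ]
    rw [Polynomial.aeval_monomial, Polynomial.aeval_monomial, ← Algebra.smul_def,
      ← Algebra.smul_def, Matrix.smul_mul, Matrix.mul_smul, hpow]

/-- `N = A * P + Q * B` acts as `A * P` on the kernel of `B`, and `N * A = A * (P * A)`. By
Cayley–Hamilton, `N.det` is up to sign a polynomial in `N` without constant term, so it maps the
kernel of `B` into the range of `A`. -/
theorem exists_mulVec_eq_det_smul [DecidableEq ι] {A : Matrix ι r R} {B : Matrix s ι R}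
    (hBA : B * A = 0) (P : Matrix r ι R) (Q : Matrix ι s R) {x : ι → R} (hx : B.mulVec x = 0) :
    ∃ y, A.mulVec y = (A * P + Q * B).det • x := by
  classical
  set N := A * P + Q * B with hN
  have hNA : N * A = A * (P * A) := by
    rw [hN, Matrix.add_mul, Matrix.mul_assoc Q, hBA, Matrix.mul_zero, add_zero, Matrix.mul_assoc]
  have hNx : N.mulVec x = A.mulVec (P.mulVec x) := by
    rw [hN, Matrix.add_mulVec, ← Matrix.mulVec_mulVec, ← Matrix.mulVec_mulVec, hx,
      Matrix.mulVec_zero, add_zero]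
  have hcayley : Polynomial.aeval N N.charpoly.divX * N = -algebraMap R _ (N.charpoly.coeff 0) := by
    have hzero := N.aeval_self_charpoly
    rw [← N.charpoly.divX_mul_X_add, map_add, map_mul, Polynomial.aeval_X,
      Polynomial.aeval_C] at hzero
    simpa only [Polynomial.divX_mul_X_add] using eq_neg_of_add_eq_zero_left hzero
  have hcoeff : N.charpoly.coeff 0 • x =
      A.mulVec (-(Polynomial.aeval (P * A) N.charpoly.divX).mulVec (P.mulVec x)) := by
    rw [Matrix.mulVec_neg, Matrix.mulVec_mulVec, ← aeval_mul_of_mul_eq hNA, ← Matrix.mulVec_mulVec,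
      ← hNx, Matrix.mulVec_mulVec, hcayley, Matrix.neg_mulVec, neg_neg,
      Algebra.algebraMap_eq_smul_one, Matrix.smul_mulVec, Matrix.one_mulVec]
  rw [Matrix.det_eq_sign_charpoly_coeff, mul_smul, hcoeff]
  exact ⟨_, Matrix.mulVec_smul _ _ _⟩

end JumpIdeals

section Complexes

variable {R : Type u} [CommRing R]

theorem next_down (j : ℕ) : (ComplexShape.down ℕ).next j = j - 1 := by
  cases j with
  | zero => exact ChainComplex.next_nat_zero
  | succ j => exact ChainComplex.next_nat_succ j

section

variable (K : ChainComplex (ModuleCat.{v} R) ℕ)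

theorem exists_surjective_ker_homology (j : ℕ) :
    ∃ π : LinearMap.ker (K.d j (j - 1)).hom →ₗ[R] K.homology j, Function.Surjective π ∧
      ∀ z : LinearMap.ker (K.d j (j - 1)).hom,
        (z : K.X j) ∈ LinearMap.range (K.d (j + 1) j).hom → π z = 0 := by
  let S := K.sc' (j + 1) j (j - 1)
  let e : S.moduleCatLeftHomologyData.H ≅ K.homology j := S.moduleCatHomologyIso.symm ≪≫
    ShortComplex.homologyMapIso (K.isoSc' (j + 1) j (j - 1) (ChainComplex.prev ℕ j)
      (next_down j)).symm
  let π : LinearMap.ker S.g.hom →ₗ[R] K.homology j :=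
    e.hom.hom.comp (LinearMap.range S.moduleCatToCycles).mkQ
  refine ⟨π, (ConcreteCategory.bijective_of_isIso e.hom).2.comp (Submodule.mkQ_surjective
    (LinearMap.range S.moduleCatToCycles)), ?_⟩
  rintro z ⟨y, hy⟩
  have hz : (LinearMap.range S.moduleCatToCycles).mkQ z = 0 :=
    (Submodule.Quotient.mk_eq_zero _).2 ⟨y, Subtype.ext hy⟩
  exact (congrArg e.hom.hom hz).trans (map_zero _)

theorem finite_homology [IsNoetherianRing R] (j : ℕ) [Module.Finite R (K.X j)] :
    Module.Finite R (K.homology j) :=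
  have ⟨π, hπ, _⟩ := exists_surjective_ker_homology K j
  .of_surjective π hπ

theorem mem_annihilator_homology {j : ℕ} {x : R}
    (hx : ∀ z, (K.d j (j - 1)).hom z = 0 → ∃ y, (K.d (j + 1) j).hom y = x • z) :
    x ∈ Module.annihilator R (K.homology j) := by
  obtain ⟨π, hπ, hzero⟩ := exists_surjective_ker_homology K j
  refine Module.mem_annihilator.2 fun m => ?_
  obtain ⟨z, rfl⟩ := hπ m
  rw [← map_smul]
  exact hzero _ (hx z z.2)

theorem toMatrix_d_mul_toMatrix_d (i j k : ℕ) {ι r s : Type*} [Fintype ι] [Fintype r] [Finite s]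
    [DecidableEq ι] [DecidableEq r] (b₂ : Module.Basis r R (K.X i)) (b₁ : Module.Basis ι R (K.X j))
    (b₀ : Module.Basis s R (K.X k)) :
    LinearMap.toMatrix b₁ b₀ (K.d j k).hom * LinearMap.toMatrix b₂ b₁ (K.d i j).hom = 0 := by
  rw [← LinearMap.toMatrix_comp, ← ModuleCat.hom_comp, K.d_comp_d, ModuleCat.hom_zero, map_zero]

theorem det_mem_annihilator_homology {j : ℕ} {ι r s : Type*} [Fintype ι] [Fintype r] [Fintype s]
    [DecidableEq ι] [DecidableEq r] (b₂ : Module.Basis r R (K.X (j + 1)))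
    (b₁ : Module.Basis ι R (K.X j)) (b₀ : Module.Basis s R (K.X (j - 1)))
    (P : Matrix r ι R) (Q : Matrix ι s R) :
    (LinearMap.toMatrix b₂ b₁ (K.d (j + 1) j).hom * P +
      Q * LinearMap.toMatrix b₁ b₀ (K.d j (j - 1)).hom).det ∈
        Module.annihilator R (K.homology j) := by
  refine mem_annihilator_homology K fun z hz => ?_
  have hcycle : (LinearMap.toMatrix b₁ b₀ (K.d j (j - 1)).hom).mulVec (b₁.repr z) = 0 := by
    rw [LinearMap.toMatrix_mulVec_repr, hz, map_zero, Finsupp.coe_zero]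
  obtain ⟨y, hy⟩ := exists_mulVec_eq_det_smul (toMatrix_d_mul_toMatrix_d K _ _ _ b₂ b₁ b₀) P Q
    hcycle
  have hrepr : ⇑(b₂.repr (b₂.equivFun.symm y)) = y := b₂.equivFun.apply_symm_apply y
  refine ⟨b₂.equivFun.symm y, b₁.repr.injective (DFunLike.coe_injective ?_)⟩
  rw [← LinearMap.toMatrix_mulVec_repr b₂ b₁, hrepr, hy, map_smul, Finsupp.coe_smul]

end

theorem toMatrix_prodMap {M₁ M₂ N₁ N₂ : Type*} [AddCommGroup M₁] [Module R M₁] [AddCommGroup M₂]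
    [Module R M₂] [AddCommGroup N₁] [Module R N₁] [AddCommGroup N₂] [Module R N₂]
    {κ₁ κ₂ ι₁ ι₂ κ ι : Type*} [Fintype κ₁] [Fintype κ₂] [Fintype ι₁] [Fintype ι₂] [Fintype κ]
    [Finite ι] [DecidableEq κ₁] [DecidableEq κ₂] [DecidableEq ι₁] [DecidableEq ι₂] [DecidableEq κ]
    (a₁ : Module.Basis κ₁ R M₁) (a₂ : Module.Basis κ₂ R M₂) (b₁ : Module.Basis ι₁ R N₁)
    (b₂ : Module.Basis ι₂ R N₂) (b : Module.Basis κ R (M₁ × M₂)) (c : Module.Basis ι R (N₁ × N₂))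
    (f : M₁ →ₗ[R] N₁) (g : M₂ →ₗ[R] N₂) :
    LinearMap.toMatrix b c (f.prodMap g) =
      LinearMap.toMatrix b₁ c (.inl R N₁ N₂) * LinearMap.toMatrix a₁ b₁ f *
          LinearMap.toMatrix b a₁ (.fst R M₁ M₂) +
        LinearMap.toMatrix b₂ c (.inr R N₁ N₂) * LinearMap.toMatrix a₂ b₂ g *
          LinearMap.toMatrix b a₂ (.snd R M₁ M₂) := by
  rw [← LinearMap.toMatrix_comp, ← LinearMap.toMatrix_comp, ← LinearMap.toMatrix_comp,
    ← LinearMap.toMatrix_comp, ← map_add]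
  congr 1
  exact LinearMap.ext fun x => Prod.ext (add_zero (f x.1)).symm (zero_add (g x.2)).symm

theorem jumpIdeal_le_comap_radical_annihilator [Nontrivial R] {R' : Type w} [CommRing R']
    (K : ChainComplex (ModuleCat.{v} R) ℕ) (K' : ChainComplex (ModuleCat.{z} R') ℕ) (Φ : R →+* R')
    {j : ℕ} {ι r s : Type*} [Fintype ι] [Fintype r] [Finite s] [DecidableEq ι] [DecidableEq r]
    (b₂ : Module.Basis r R (K.X (j + 1))) (b₁ : Module.Basis ι R (K.X j))
    (b₀ : Module.Basis s R (K.X (j - 1))) (b₂' : Module.Basis r R' (K'.X (j + 1)))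
    (b₁' : Module.Basis ι R' (K'.X j)) (b₀' : Module.Basis s R' (K'.X (j - 1)))
    (h₂ : LinearMap.toMatrix b₂' b₁' (K'.d (j + 1) j).hom =
      (LinearMap.toMatrix b₂ b₁ (K.d (j + 1) j).hom).map Φ)
    (h₁ : LinearMap.toMatrix b₁' b₀' (K'.d j (j - 1)).hom =
      (LinearMap.toMatrix b₁ b₀ (K.d j (j - 1)).hom).map Φ) :
    jumpIdeal K j ≤ (Module.annihilator R' (K'.homology j)).radical.comap Φ := by
  classical
  have := Fintype.ofFinite s
  rw [jumpIdeal, minorsIdeal, Ideal.span_le]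
  rintro _ ⟨m, n, b, c, p, q, rfl⟩
  have hcard : Fintype.card ι ≤ Fintype.card (Fin (Module.finrank R (K.X j))) := by
    rw [Fintype.card_fin, Module.finrank_eq_card_basis b₁]
  rw [SetLike.mem_coe, Ideal.mem_comap, toMatrix_prodMap b₂ b₁ b₁ b₀, Matrix.submatrix_add,
    Pi.add_apply, Pi.add_apply, Matrix.submatrix_mul _ _ p id q Function.bijective_id,
    Matrix.submatrix_mul _ _ p id q Function.bijective_id,
    Matrix.submatrix_mul _ _ p id id Function.bijective_id,
    Matrix.submatrix_mul _ _ p id id Function.bijective_id, Matrix.submatrix_id_id,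
    Matrix.submatrix_id_id, RingHom.map_det, RingHom.mapMatrix_apply,
    Matrix.map_add _ (map_add Φ), Matrix.map_mul, Matrix.map_mul, Matrix.map_mul, Matrix.map_mul,
    ← h₁, ← h₂]
  exact det_mem_radical (toMatrix_d_mul_toMatrix_d K' _ _ _ b₂' b₁' b₀') hcard
    (det_mem_annihilator_homology K' b₂' b₁' b₀') _ _ _ _

end Complexes

/-! ### Homology of abelian covers -/

theorem filtrationComplex_d (H : Type w) [CommGroup H] {Y : Type v} [TopologicalSpace Y]
    [MulAction H Y] [ContinuousConstSMul H Y] (F : ℕ → Set Y) (n : ℕ) :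
    (filtrationComplex H F).d (n + 1) n =
      ModuleCat.ofHom (relBdry H (F (n + 2)) (F (n + 1)) (F n) n) :=
  ChainComplex.of_d (fun n => ModuleCat.of (MonoidAlgebra ℤ H) (RelHomology H (F (n + 1)) (F n) n))
    (fun n => ModuleCat.ofHom (relBdry H (F (n + 2)) (F (n + 1)) (F n) n)) n

section CoverHomology

variable {X : Type u} [TopologicalSpace X] [T2Space X] [CWComplex (univ : Set X)] {x₀ : X}
  {H : Type w} [CommGroup H] {ν : FundamentalGroup X x₀ →* H} {Y : Type v} [TopologicalSpace Y]
  [MulAction H Y]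

namespace AbelianCover

section Finiteness

variable (cY : AbelianCover x₀ ν Y)

theorem cellularComplex_d [ContinuousConstSMul H Y] (n : ℕ) :
    cY.cellularComplex.d (n + 1) n = ModuleCat.ofHom
      (relBdry H (cY.proj ⁻¹' (CWComplex.skeletonLT (univ : Set X) ((n + 2 : ℕ) : ℕ∞)))
        (cY.proj ⁻¹' (CWComplex.skeletonLT (univ : Set X) ((n + 1 : ℕ) : ℕ∞)))
        (cY.proj ⁻¹' (CWComplex.skeletonLT (univ : Set X) (n : ℕ∞))) n) :=
  filtrationComplex_d H _ n

variable [CWComplex.Finite (univ : Set X)]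

include cY in
theorem group_fg : Group.FG H :=
  have := cY.pathConnected
  group_fg_of_finite_CWComplex cY.isCover

include cY in
theorem isNoetherianRing_monoidAlgebra : IsNoetherianRing (MonoidAlgebra ℤ H) :=
  have := cY.group_fg
  Algebra.FiniteType.isNoetherianRing ℤ _

variable [ContinuousConstSMul H Y]

/-- The basis `cellBasis` of relative homology, as a basis of the cellular complex: the two modules
are definitionally equal, but only the second is a term of a chain complex. -/
def cellularBasis {n : ℕ} {ψ : RelCWComplex.cell (univ : Set X) n → C(StdSimplex n, Y)}
    (hψ : ∀ e x, cY.proj (ψ e x) = charMap e x) :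
    Module.Basis (RelCWComplex.cell (univ : Set X) n) (MonoidAlgebra ℤ H)
      (cY.cellularComplex.X n) :=
  cY.cellBasis hψ

theorem finite_cellularComplex (n : ℕ) :
    Module.Finite (MonoidAlgebra ℤ H) (cY.cellularComplex.X n) := by
  have : Finite (RelCWComplex.cell (univ : Set X) n) := RelCWComplex.FiniteType.finite_cell n
  choose ψ hψ using
    exists_lift_charMap (X := X) (n := n) cY.isCover.isCoveringMap cY.isCover.surjective
  exact .of_basis (cY.cellularBasis hψ)

theorem finite_homology (i : ℕ) : Module.Finite (MonoidAlgebra ℤ H) (cY.homology i) :=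
  have := cY.isNoetherianRing_monoidAlgebra
  have := cY.finite_cellularComplex i
  AbCover.finite_homology _ i

theorem finite_int_homology_iff (i : ℕ) : Module.Finite ℤ (cY.homology i) ↔
    tropVariety (Module.annihilator (MonoidAlgebra ℤ H) (cY.homology i)) ⊆ {0} := by
  have := cY.group_fg
  have := cY.finite_homology i
  exact ⟨fun _ => tropVariety_annihilator_of_finite, finite_of_tropVariety_annihilator⟩

end Finiteness

variable [CWComplex.Finite (univ : Set X)] [ContinuousConstSMul H Y] (cY : AbelianCover x₀ ν Y)
  {A : Type*} [CommGroup A] {μ : FundamentalGroup X x₀ →* A} {Z : Type z} [TopologicalSpace Z]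
  [MulAction A Z] [ContinuousConstSMul A Z] (cZ : AbelianCover x₀ μ Z) {φ : A →* H}
  (hφ : ∀ γ, φ (μ γ) = ν γ) (hμ : Function.Surjective μ)
include hφ hμ

theorem toMatrix_cellularComplex_d [∀ n, Fintype (RelCWComplex.cell (univ : Set X) n)]
    [∀ n, DecidableEq (RelCWComplex.cell (univ : Set X) n)]
    {ψ : ∀ n, RelCWComplex.cell (univ : Set X) n → C(StdSimplex n, Z)}
    (hψ : ∀ n e x, cZ.proj (ψ n e x) = charMap e x) (i j : ℕ) :
    LinearMap.toMatrix (cY.cellularBasis (proj_mapSimplex_eq_charMap cZ cY hφ (hψ i)))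
        (cY.cellularBasis (proj_mapSimplex_eq_charMap cZ cY hφ (hψ j)))
        (cY.cellularComplex.d i j).hom =
      (LinearMap.toMatrix (cZ.cellularBasis (hψ i)) (cZ.cellularBasis (hψ j))
        (cZ.cellularComplex.d i j).hom).map (MonoidAlgebra.mapDomainRingHom ℤ φ) := by
  by_cases hij : j + 1 = i
  · subst hij
    ext1 e' e
    rw [Matrix.map_apply, LinearMap.toMatrix_apply, LinearMap.toMatrix_apply, cellularComplex_d,
      cellularComplex_d]
    exact repr_relBdry_cellBasis_mapSimplex cZ cY hφ hμ (hψ j) (hψ (j + 1)) e e'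
  · rw [cY.cellularComplex.shape i j hij, cZ.cellularComplex.shape i j hij, ModuleCat.hom_zero,
      ModuleCat.hom_zero, map_zero, map_zero, Matrix.map_zero _ (map_zero _)]

theorem jumpIdeal_le_comap_radical_annihilator_homology (j : ℕ) :
    jumpIdeal cZ.cellularComplex j ≤
      (Module.annihilator (MonoidAlgebra ℤ H) (cY.homology j)).radical.comap
        (MonoidAlgebra.mapDomainRingHom ℤ φ) := by
  classical
  have (n : ℕ) : Finite (RelCWComplex.cell (univ : Set X) n) :=
    RelCWComplex.FiniteType.finite_cell n
  have (n : ℕ) : Fintype (RelCWComplex.cell (univ : Set X) n) := Fintype.ofFinite _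
  choose ψ hψ using fun n =>
    exists_lift_charMap (X := X) (n := n) cZ.isCover.isCoveringMap cZ.isCover.surjective
  exact jumpIdeal_le_comap_radical_annihilator _ _ _ _ _ _ _ _ _
    (toMatrix_cellularComplex_d cY cZ hφ hμ hψ (j + 1) j)
    (toMatrix_cellularComplex_d cY cZ hφ hμ hψ j (j - 1))

theorem finite_int_homology_of_tropVariety_jumpIdealLE (hν : Function.Surjective ν) {k : ℕ}
    (hk : tropVariety (jumpIdealLE cZ.cellularComplex k) ⊆ {0}) {i : ℕ} (hi : i ≤ k) :
    Module.Finite ℤ (cY.homology i) := by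
  have hφ_surj : Function.Surjective φ := .of_comp (g := μ) ((funext hφ : φ ∘ μ = ν) ▸ hν)
  exact (cY.finite_int_homology_iff i).2 (tropVariety_subset_of_le_comap_radical hφ_surj
    ((iInf₂_le i hi).trans (jumpIdeal_le_comap_radical_annihilator_homology cY cZ hφ hμ i)) hk)

end AbelianCover

end CoverHomology

end AbCover

end

theorem mainTheorem8 {X : Type u} [TopologicalSpace X] [T2Space X]
    [CWComplex (Set.univ : Set X)] [CWComplex.Finite (Set.univ : Set X)] [ConnectedSpace X]
    (x₀ : X) :
    (∀ (H' : Type w) [CommGroup H'] (ν : FundamentalGroup X x₀ →* H'),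
      Function.Surjective ν → 1 ≤ Module.finrank ℤ (Additive H') →
      ∀ (Y : Type v) [TopologicalSpace Y] [MulAction H' Y] [ContinuousConstSMul H' Y]
        (c : AbelianCover x₀ ν Y) (i : ℕ),
        Module.Finite (MonoidAlgebra ℤ H') (c.homology i) ∧
        (Module.Finite ℤ (c.homology i) ↔
          tropVariety (Module.annihilator (MonoidAlgebra ℤ H') (c.homology i)) ⊆ {0})) ∧
    (∀ (Z : Type z) [TopologicalSpace Z] [MulAction (Abelianization (FundamentalGroup X x₀)) Z]
        [ContinuousConstSMul (Abelianization (FundamentalGroup X x₀)) Z]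
        (cmax : AbelianCover x₀ (Abelianization.of (G := FundamentalGroup X x₀)) Z) (k : ℕ),
      tropVariety (jumpIdealLE cmax.cellularComplex k) ⊆ {0} →
      ∀ (H' : Type w) [CommGroup H'] (ν : FundamentalGroup X x₀ →* H'),
        Function.Surjective ν → 1 ≤ Module.finrank ℤ (Additive H') →
        ∀ (Y : Type v) [TopologicalSpace Y] [MulAction H' Y] [ContinuousConstSMul H' Y]
          (c : AbelianCover x₀ ν Y) (i : ℕ), i ≤ k → Module.Finite ℤ (c.homology i)) := by
  refine ⟨fun H' _ ν _ _ Y _ _ _ c i => ⟨c.finite_homology i, c.finite_int_homology_iff i⟩,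
    fun Z _ _ _ cmax k hk H' _ ν hν _ Y _ _ _ c i hi => ?_⟩
  exact AbelianCover.finite_int_homology_of_tropVariety_jumpIdealLE c cmax
    (Abelianization.lift_apply_of ν) QuotientGroup.mk_surjective hν hk hi
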